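/- **Setting.** A *general hyperbolic manifold* $M$ is a $3$-manifold, possibly with boundary, with an atlas of charts onto subsets of $\mathbb H^3$ whose transition maps are (locally) restrictions of isometries of $\mathbb H^3$, equipped with the induced length metric $d_M$, which is required to be complete, and admitting a locally finite triangulation by hyperbolic tetrahedra. For two arcs $c,c'$ in $M$ issuing from the same point $p$, $\angle(c,c')\in[0,\pi]$ is the upper angle, i.e. the $\limsup$, as $s,t\to0^+$, of the angle at $p$ of the Euclidean comparison triangle of $(p,c(s),c'(t))$. A geodesic of $M$ is a local geodesic of $(M,d_M)$. A *compact triangulated hyperbolic surface* $\Sigma$ is a compact surface, possibly with boundary, with a finite (simplicial) triangulation in which each triangle is isometrically identified with a geodesic triangle of $\mathbb H^2$, the metrics agreeing on common edges; degenerate triangles, with three distinct collinear vertices, are allowed. $\mathrm{Area}(\Sigma)$ is the sum of the hyperbolic areas of its triangles. Let $f:\Sigma\to M$ map each triangle to a totally geodesic hyperbolic triangle of $M$, i.e. so that, in the charts of $M$, $f$ is on each triangle locally the restriction of an isometric embedding $\mathbb H^2\to\mathbb H^3$. The angle sum at a vertex is the sum of the angles at that vertex of all triangles containing it. The map $f$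 is a *hyperbolic-map* if the angle sum at each interior vertex of $\Sigma$ is at least $2\pi$; it is a *hyperbolic-map relative to* distinct boundary vertices $v_1,\dots,v_n$ ($n\ge 0$) if moreover the angle sum at each boundary vertex other than $v_1,\dots,v_n$ is at least $\pi$. Let $\theta_i$ be the exterior angle at $v_i$ in $M$: $\pi$ minus the angle in $M$ between the images of the two boundary edges issuing from $v_i$. **Theorem.** Let $\Sigma$, $M$, $f$, $v_1,\dots,v_n$ and $\theta_i$ be as above, and suppose that either $f$ is a hyperbolic-map relative to $v_1,\dots,v_n$, or $f$ is a hyperbolic-map and $f$ maps each arc (or closed curve) of $\partial\Sigma\setminus\{v_1,\dots,v_n\}$ to a geodesic of $M$. Then $$\mathrm{Area}(\Sigma)\le\sum_{i=1}^n\theta_i-2\pi\chi(\Sigma).$$ If in addition $\Sigma$ is homeomorphic to a closed disk (so that $\Sigma$ is a hyperbolically-mapped $n$-gon), then $\mathrm{Area}(\Sigma)\le(n-2)\pi$. -/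

import Mathlib

open Set Filter Topology MeasureTheory

noncomputable section

/-! ### Hyperbolic 3-space (upper half-space model) -/

/-- Points of hyperbolic 3-space: the points of `ℝ³` with positive last coordinate. -/
@[ext]
structure Hyp3 where
  pt : EuclideanSpace ℝ (Fin 3)
  height_pos : 0 < pt 2

namespace Hyp3

/-- The hyperbolic distance: `sinh (d / 2) = ‖x - y‖ / (2 √(height x * height y))`, the same formula
as for Mathlib's upper half-plane. -/
instance : Dist Hyp3 :=
  ⟨fun x y => 2 * Real.arsinh (dist x.pt y.pt / (2 * √(x.pt 2 * y.pt 2)))⟩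

theorem dist_def (x y : Hyp3) :
    dist x y = 2 * Real.arsinh (dist x.pt y.pt / (2 * √(x.pt 2 * y.pt 2))) := rfl

/-- Euclidean reflection in the boundary plane (auxiliary, for the triangle inequality). -/
def refl (x : EuclideanSpace ℝ (Fin 3)) : EuclideanSpace ℝ (Fin 3) := !₂[x 0, x 1, -x 2]

theorem dist_refl_comm (x y : EuclideanSpace ℝ (Fin 3)) : dist (refl x) y = dist x (refl y) := by
  simp only [EuclideanSpace.dist_eq, Fin.sum_univ_three, Real.dist_eq, sq_abs, refl]
  congr 1
  simp
  ring

theorem dist_self_refl (x : Hyp3) : dist x.pt (refl x.pt) = 2 * x.pt 2 := by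
  have h := x.height_pos
  simp only [EuclideanSpace.dist_eq, Fin.sum_univ_three, Real.dist_eq, sq_abs, refl]
  rw [Real.sqrt_eq_iff_mul_self_eq_of_pos (by positivity)]
  simp
  ring

theorem sinh_half_dist (x y : Hyp3) :
    Real.sinh (dist x y / 2) = dist x.pt y.pt / (2 * √(x.pt 2 * y.pt 2)) := by
  rw [dist_def, mul_div_cancel_left₀ _ two_ne_zero, Real.sinh_arsinh]

theorem cosh_half_dist (x y : Hyp3) :
    Real.cosh (dist x y / 2) = dist x.pt (refl y.pt) / (2 * √(x.pt 2 * y.pt 2)) := by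
  have hx := x.height_pos
  have hy := y.height_pos
  rw [← sq_eq_sq₀ (Real.cosh_pos _).le (by positivity), Real.cosh_sq', sinh_half_dist, div_pow,
    div_pow, one_add_div (by positivity), mul_pow, Real.sq_sqrt (by positivity)]
  congr 1
  simp only [EuclideanSpace.dist_eq, Fin.sum_univ_three, Real.dist_eq, sq_abs, refl]
  rw [Real.sq_sqrt (by positivity), Real.sq_sqrt (by positivity)]
  simp
  ring

theorem sinh_half_dist_add_dist (a b c : Hyp3) : Real.sinh ((dist a b + dist b c) / 2) =
    (dist a.pt b.pt * dist c.pt (refl b.pt) + dist b.pt c.pt * dist a.pt (refl b.pt)) /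
      (2 * √(a.pt 2 * c.pt 2) * dist b.pt (refl b.pt)) := by
  have ha := a.height_pos
  have hb := b.height_pos
  have hc := c.height_pos
  rw [add_div, Real.sinh_add, sinh_half_dist, sinh_half_dist, cosh_half_dist, cosh_half_dist,
    dist_self_refl, Real.sqrt_mul ha.le, Real.sqrt_mul hb.le, Real.sqrt_mul ha.le,
    ← dist_refl_comm b.pt c.pt, dist_comm (refl b.pt) c.pt]
  have e : b.pt 2 = √(b.pt 2) * √(b.pt 2) := (Real.mul_self_sqrt hb.le).symm
  have h1 : √(a.pt 2) ≠ 0 := by positivity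
  have h2 : √(b.pt 2) ≠ 0 := by positivity
  have h3 : √(c.pt 2) ≠ 0 := by positivity
  conv_rhs => rw [e]
  field_simp

instance : MetricSpace Hyp3 where
  dist_self x := by simp [dist_def]
  dist_comm x y := by simp only [dist_def, dist_comm x.pt, mul_comm (x.pt 2)]
  dist_triangle a b c := by
    have ha := a.height_pos
    have hc := c.height_pos
    rw [← div_le_div_iff_of_pos_right (zero_lt_two' ℝ), ← Real.sinh_le_sinh,
      sinh_half_dist_add_dist, sinh_half_dist, div_mul_eq_div_div _ _ (dist _ _),
      le_div_iff₀ (by rw [dist_self_refl]; linarith [b.height_pos]), div_mul_eq_mul_div]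
    gcongr
    have := EuclideanGeometry.mul_dist_le_mul_dist_add_mul_dist a.pt b.pt c.pt (refl b.pt)
    exact this
  eq_of_dist_eq_zero {x y} h := by
    have hx := x.height_pos
    have hy := y.height_pos
    have h0 : dist x.pt y.pt / (2 * √(x.pt 2 * y.pt 2)) = 0 := by
      rw [← sinh_half_dist, h]; simp
    rcases div_eq_zero_iff.1 h0 with h1 | h1
    · exact Hyp3.ext (dist_eq_zero.1 h1)
    · exact absurd h1 (by positivity)

end Hyp3

/-! ### Segments, convex hulls and angles in metric spaces -/

/-- The union of the geodesic segments from `x` to `y` in a geodesic metric space; in a hyperbolic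
space, the geodesic segment. -/
def metricSegment {X : Type*} [MetricSpace X] (x y : X) : Set X :=
  {z | dist x z + dist z y = dist x y}

/-- The geodesic convex hull of `A`: the smallest set that contains `A` and, with any two points,
the geodesic segment between them. -/
def geodesicHull {X : Type*} [MetricSpace X] (A : Set X) : Set X :=
  ⋂₀ {C | A ⊆ C ∧ ∀ x ∈ C, ∀ y ∈ C, metricSegment x y ⊆ C}

/-- The angle at the vertex corresponding to `p` of the Euclidean comparison triangle of
`(p, x, y)`. -/
def comparisonAngle {X : Type*} [MetricSpace X] (p x y : X) : ℝ :=
  Real.arccos ((dist p x ^ 2 + dist p y ^ 2 - dist x y ^ 2) / (2 * dist p x * dist p y))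

/-- The upper (Alexandrov) angle at `c 0 = c' 0` between two arcs, the upper limit of the comparison
angles at `c 0` of `c s` and `c' t` as `s, t → 0+`. It does not depend on the parametrizations. -/
def upperAngle {X : Type*} [MetricSpace X] (c c' : ℝ → X) : ℝ :=
  limsup (fun z : ℝ × ℝ => comparisonAngle (c 0) (c z.1) (c' z.2)) (𝓝[>] 0 ×ˢ 𝓝[>] 0)

/-! ### General hyperbolic 3-manifolds -/

/-- `X` carries a length metric: the distance is the infimum of the lengths of paths. -/
def IsLengthMetric (X : Type*) [MetricSpace X] : Prop :=
  ∀ x y : X, edist x y = ⨅ γ : Path x y, eVariationOn (γ : unitInterval → X) univ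

/-- A chart to hyperbolic space: a homeomorphism of an open set onto its image in `Hyp3`. The image
need not be open, since the manifold may have a boundary. -/
structure HypChart (M : Type*) [TopologicalSpace M] where
  source : Set M
  toFun : M → Hyp3
  isOpen_source : IsOpen source
  isEmbedding : IsEmbedding (source.domRestrict toFun)

/-- An atlas of charts to `Hyp3` whose transition maps are locally restrictions of isometries of
`Hyp3`, such that the given metric measures the length of each path by its hyperbolic length in the
charts. -/
structure HypAtlas (M : Type*) [MetricSpace M] where
  charts : Set (HypChart M)
  covers : ∀ x : M, ∃ φ ∈ charts, x ∈ φ.source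
  transition : ∀ φ ∈ charts, ∀ ψ ∈ charts, ∀ x ∈ φ.source ∩ ψ.source,
    ∃ g : Hyp3 ≃ᵢ Hyp3, ∀ᶠ y in 𝓝 x, ψ.toFun y = g (φ.toFun y)
  length_eq : ∀ φ ∈ charts, ∀ γ : C(unitInterval, M), (∀ s, γ s ∈ φ.source) →
    eVariationOn (fun s => φ.toFun (γ s)) univ = eVariationOn γ univ

/-- On `D`, the map `ι` is, read in the charts of `M`, locally the restriction of an isometric
embedding `X → Hyp3`. For `X` the hyperbolic plane this says that `ι` is a locally isometric map
onto totally geodesic pieces of `M`. -/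
def HypAtlas.IsTotallyGeodesicOn {M X : Type*} [MetricSpace M] [MetricSpace X] (A : HypAtlas M)
    (ι : X → M) (D : Set X) : Prop :=
  ∀ p ∈ D, ∃ φ ∈ A.charts, ι p ∈ φ.source ∧ ∃ e : X → Hyp3, Isometry e ∧
    ∀ᶠ x in 𝓝[D] p, ι x ∈ φ.source ∧ φ.toFun (ι x) = e x

/-- `M` is triangulated by hyperbolic tetrahedra: a locally finite family of embedded
nondegenerate hyperbolic tetrahedra covers `M`, and two different tetrahedra meet in a common
proper face (which may be empty). -/
def HypAtlas.IsTriangulated {M : Type*} [MetricSpace M] (A : HypAtlas M) : Prop :=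
  ∃ (J : Type) (p : J → Fin 4 → Hyp3) (g : J → Hyp3 → M),
    (∀ j, ¬ ∃ e : UpperHalfPlane → Hyp3, Isometry e ∧ range (p j) ⊆ range e) ∧
    (∀ j, A.IsTotallyGeodesicOn (g j) (geodesicHull (range (p j)))) ∧
    (∀ j, InjOn (g j) (geodesicHull (range (p j)))) ∧
    (⋃ j, g j '' geodesicHull (range (p j))) = univ ∧
    LocallyFinite (fun j => g j '' geodesicHull (range (p j))) ∧
    ∀ i j, i ≠ j → ∃ a b : Set (Fin 4), a ≠ univ ∧ b ≠ univ ∧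
      g i '' (p i '' a) = g j '' (p j '' b) ∧
      g i '' geodesicHull (p i '' a) = g j '' geodesicHull (p j '' b) ∧
      g i '' geodesicHull (range (p i)) ∩ g j '' geodesicHull (range (p j)) =
        g i '' geodesicHull (p i '' a)

/-- A general hyperbolic (3-)manifold: a 3-manifold with (possibly empty) boundary, with an atlas of
charts to hyperbolic space whose transition maps are isometries, with the induced length metric,
complete, and triangulated by hyperbolic tetrahedra. -/
structure GeneralHyperbolicManifold (M : Type*) [MetricSpace M] extends HypAtlas M where
  isManifold : Nonempty (ChartedSpace (EuclideanHalfSpace 3) M)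
  isLengthMetric : IsLengthMetric M
  isComplete : CompleteSpace M
  isTriangulated : toHypAtlas.IsTriangulated

/-! ### Compact triangulated surfaces -/

/-- A compact triangulated surface, with or without boundary, as a finite simplicial complex in `E`.
The triangles are enumerated by the finite type `T`; `corner t` lists the three vertices of the
triangle `t`. The surface condition is that every edge lies in one or two triangles and that the
links of the vertices are connected (so that they are arcs or circles). -/
structure TriangulatedSurface (E T : Type*) [NormedAddCommGroup E] [NormedSpace ℝ E] [Fintype T]
    extends Geometry.SimplicialComplex ℝ E where
  corner : T → Fin 3 → E
  corner_injective : ∀ t, Function.Injective (corner t)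
  triangle_injective : Function.Injective fun t => range (corner t)
  mem_faces_iff : ∀ s : Finset E, s ∈ faces ↔ s.Nonempty ∧ ∃ t, (s : Set E) ⊆ range (corner t)
  edge_le_two : ∀ a b, a ≠ b → {t | a ∈ range (corner t) ∧ b ∈ range (corner t)}.ncard ≤ 2
  link_connected : ∀ v, {v} ∈ faces →
    (SimpleGraph.fromRel fun a b : {a : E // a ≠ v ∧ ∃ t, v ∈ range (corner t) ∧
        a ∈ range (corner t)} =>
      ∃ t, v ∈ range (corner t) ∧ a.1 ∈ range (corner t) ∧ b.1 ∈ range (corner t)).Connected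

namespace TriangulatedSurface

variable {E T : Type*} [NormedAddCommGroup E] [NormedSpace ℝ E] [Fintype T]

/-- The closed triangle `t` of the surface. -/
def cell (S : TriangulatedSurface E T) (t : T) : Set E := convexHull ℝ (range (S.corner t))

/-- The segment `[a, b]` is a boundary edge: it is an edge of exactly one triangle. -/
def IsBoundaryEdge (S : TriangulatedSurface E T) (a b : E) : Prop :=
  a ≠ b ∧ {t | a ∈ range (S.corner t) ∧ b ∈ range (S.corner t)}.ncard = 1

def IsBoundaryVertex (S : TriangulatedSurface E T) (v : E) : Prop := ∃ a, S.IsBoundaryEdge v a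

def IsInteriorVertex (S : TriangulatedSurface E T) (v : E) : Prop :=
  {v} ∈ S.faces ∧ ¬ S.IsBoundaryVertex v

/-- The boundary of the surface. -/
def boundary (S : TriangulatedSurface E T) : Set E :=
  {x | ∃ a b, S.IsBoundaryEdge a b ∧ x ∈ segment ℝ a b}

/-- The Euler characteristic, `#vertices - #edges + #triangles`. -/
def eulerChar (S : TriangulatedSurface E T) : ℤ :=
  {s ∈ S.faces | s.card = 1}.ncard - {s ∈ S.faces | s.card = 2}.ncard
    + {s ∈ S.faces | s.card = 3}.ncard

/-- The surface is homeomorphic to the closed disk. -/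
def IsDisk (S : TriangulatedSurface E T) : Prop :=
  Nonempty (S.space ≃ₜ Metric.closedBall (0 : EuclideanSpace ℝ (Fin 2)) 1)

end TriangulatedSurface

/-! ### Triangulated hyperbolic surfaces and hyperbolic-maps -/

/-- A compact triangulated hyperbolic surface: each triangle `t` is identified by `dev t` with a
hyperbolic triangle in the hyperbolic plane, and the metrics agree on common edges. Degenerate
triangles (three distinct points on a geodesic) are allowed; these are collapsed to a segment, with
the edges mapped injectively. -/
structure HyperbolicSurface (E T : Type*) [NormedAddCommGroup E] [NormedSpace ℝ E] [Fintype T]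
    extends TriangulatedSurface E T where
  dev : T → E → UpperHalfPlane
  dev_continuousOn : ∀ t, ContinuousOn (dev t) (toTriangulatedSurface.cell t)
  dev_edge : ∀ t i j, i ≠ j → BijOn (dev t) (segment ℝ (corner t i) (corner t j))
    (metricSegment (dev t (corner t i)) (dev t (corner t j)))
  dev_image : ∀ t, dev t '' toTriangulatedSurface.cell t =
    geodesicHull (range fun i => dev t (corner t i))
  dev_injOn : ∀ t, (∀ i, dev t (corner t i) ∉
      metricSegment (dev t (corner t (i + 1))) (dev t (corner t (i + 2)))) →
    InjOn (dev t) (toTriangulatedSurface.cell t)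
  dev_compat : ∀ t t', ∀ x ∈ toTriangulatedSurface.cell t ∩ toTriangulatedSurface.cell t',
    ∀ y ∈ toTriangulatedSurface.cell t ∩ toTriangulatedSurface.cell t',
      dist (dev t x) (dev t y) = dist (dev t' x) (dev t' y)

namespace HyperbolicSurface

variable {E T M : Type*} [NormedAddCommGroup E] [NormedSpace ℝ E] [Fintype T] [MetricSpace M]

/-- The hyperbolic triangle with which the triangle `t` is identified. -/
def model (S : HyperbolicSurface E T) (t : T) : Set UpperHalfPlane :=
  geodesicHull (range fun i => S.dev t (S.corner t i))

/-- The area of the surface, for the hyperbolic area measure `dx dy / y ^ 2` on each triangle. -/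
def area (S : HyperbolicSurface E T) : ℝ :=
  ∑ t, (volume (S.model t)).toReal

/-- The angle of the hyperbolic triangle `t` at its `i`-th vertex. -/
def angle (S : HyperbolicSurface E T) (t : T) (i : Fin 3) : ℝ :=
  upperAngle (fun s => S.dev t (AffineMap.lineMap (S.corner t i) (S.corner t (i + 1)) s))
    (fun s => S.dev t (AffineMap.lineMap (S.corner t i) (S.corner t (i + 2)) s))

open Classical in
/-- The sum of the angles at `v` of the triangles around `v`. -/
def angleSum (S : HyperbolicSurface E T) (v : E) : ℝ :=
  ∑ t, ∑ i, if S.corner t i = v then S.angle t i else 0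

/-- `f` maps each triangle of the surface, isometrically for the metric of the surface, to a
(totally geodesic) hyperbolic triangle of `M`. -/
def IsTriangulatedMap (S : HyperbolicSurface E T) (A : HypAtlas M) (f : E → M) : Prop :=
  ∀ t, ∃ ι : UpperHalfPlane → M, A.IsTotallyGeodesicOn ι (S.model t) ∧
    ∀ x ∈ S.cell t, f x = ι (S.dev t x)

/-- `f` is a hyperbolic-map: the image triangles around each interior vertex have angle sum at
least `2π`. -/
structure IsHyperbolicMap (S : HyperbolicSurface E T) (A : HypAtlas M) (f : E → M) : Prop where
  isTriangulatedMap : S.IsTriangulatedMap A f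
  interior : ∀ v, S.IsInteriorVertex v → 2 * Real.pi ≤ S.angleSum v

/-- `f` is a hyperbolic-map relative to the set `V` of boundary vertices: moreover the angle sum at
each boundary vertex outside `V` is at least `π`. -/
structure IsHyperbolicMapRel (S : HyperbolicSurface E T) (A : HypAtlas M) (f : E → M)
    (V : Set E) : Prop extends S.IsHyperbolicMap A f where
  boundary : ∀ v, S.IsBoundaryVertex v → v ∉ V → Real.pi ≤ S.angleSum v

/-- `f` maps each arc of the boundary with `V` removed to a geodesic of `M`, i.e. a local geodesic
of the metric space `M`: near each of its points the boundary has a parametrization `γ` such that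
`f ∘ γ` preserves distances. -/
def HasGeodesicBoundary (S : HyperbolicSurface E T) (f : E → M) (V : Set E) : Prop :=
  ∀ x ∈ S.boundary, x ∉ V → ∃ ε > 0, ∃ γ : ℝ → E, γ 0 = x ∧
    ContinuousOn γ (Ioo (-ε) ε) ∧ MapsTo γ (Ioo (-ε) ε) S.boundary ∧
    γ '' Ioo (-ε) ε ∈ 𝓝[S.boundary] x ∧
    ∀ s ∈ Ioo (-ε) ε, ∀ t ∈ Ioo (-ε) ε, dist (f (γ s)) (f (γ t)) = |s - t|

/-- `θ` is the exterior angle in `M` at the boundary vertex `v`: `π` minus the angle, measured in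
`M`, between the images of the two boundary edges `[v, a]` and `[v, b]` at `v`. -/
def IsExteriorAngle (S : HyperbolicSurface E T) (f : E → M) (v : E) (θ : ℝ) : Prop :=
  ∃ a b, a ≠ b ∧ S.IsBoundaryEdge v a ∧ S.IsBoundaryEdge v b ∧
    θ = Real.pi - upperAngle (fun s => f (AffineMap.lineMap v a s))
      (fun s => f (AffineMap.lineMap v b s))

end HyperbolicSurface

end

/-! The theorem is Gauss–Bonnet for a surface glued from hyperbolic triangles, combined with the
triangle inequality for angles in M.

A hyperbolic triangle, degenerate or not, has area π minus its angle sum (`triangleArea_eq`).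
Counting links of vertices gives 2E = 3F + (number of boundary vertices), so summing the defects
over all triangles yields `area_eq_gaussBonnet`: the area is the sum of 2π minus the angle sum over
interior vertices, plus the sum of π minus the angle sum over boundary vertices, minus 2πχ. The
terms at interior vertices are nonpositive by hypothesis. It remains to bound the terms at boundary
vertices, by θ at the marked vertices and by 0 at the others.

At a marked vertex this says that the angle in M between the two boundary edges is at most the angle
sum. On each triangle f is locally distance preserving into M (`exists_isometric_near`, which needs
M to carry a length metric), so every angle of the surface is an upper angle in M. Upper angles obey
the triangle inequality (`upperAngle_triangle`), and a path in the link of the vertex joins one edge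
to the other through distinct triangles (`upperAngle_le_angleSum`). If the boundary is geodesic at
an unmarked vertex, the angle in M between its two edges is π, and the same inequality gives an
angle sum of at least π (`HasGeodesicBoundary.pi_le_angleSum`).

The area formula is proved in the chart `parab`, where geodesics are straight and geodesic hulls are
Euclidean convex hulls. A triangle is then a region between piecewise linear graphs. Integrating dx
dy / y² vertically leaves one integral per side, and this integral is the change of direction of the
tangent along that side; the three changes add up to the angle defect.

For a disk, each θ is at most π, so χ ≥ 1 suffices. A simplicial integral 1-cocycle defines a
piecewise affine map to ℝ/ℤ; on a disk it lifts to ℝ, so the cocycle is a coboundary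
(`exists_primitive`). Counting ranks in the cochain complex then gives χ ≥ 1. -/

noncomputable section

/-! ### Upper angles in metric spaces -/

section UpperAngle

variable {X : Type*} [MetricSpace X]

/-- The upper angle of the curves `c` and `c'` is at most `α`, in terms of comparison angles. -/
def AngleLE (c c' : ℝ → X) (α : ℝ) : Prop :=
  ∀ β > α, ∀ᶠ z : ℝ × ℝ in 𝓝[>] 0 ×ˢ 𝓝[>] 0, comparisonAngle (c 0) (c z.1) (c' z.2) ≤ β

theorem comparisonAngle_nonneg (p x y : X) : 0 ≤ comparisonAngle p x y := Real.arccos_nonneg _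

theorem comparisonAngle_le_pi (p x y : X) : comparisonAngle p x y ≤ Real.pi := Real.arccos_le_pi _

theorem isBoundedUnder_comparisonAngle (c c' : ℝ → X) :
    IsBoundedUnder (· ≤ ·) (𝓝[>] (0 : ℝ) ×ˢ 𝓝[>] (0 : ℝ))
      (fun z : ℝ × ℝ => comparisonAngle (c 0) (c z.1) (c' z.2)) :=
  isBoundedUnder_of ⟨Real.pi, fun _ => comparisonAngle_le_pi _ _ _⟩

theorem isCoboundedUnder_comparisonAngle (c c' : ℝ → X) :
    IsCoboundedUnder (· ≤ ·) (𝓝[>] (0 : ℝ) ×ˢ 𝓝[>] (0 : ℝ))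
      (fun z : ℝ × ℝ => comparisonAngle (c 0) (c z.1) (c' z.2)) :=
  IsBoundedUnder.isCoboundedUnder_le (isBoundedUnder_of ⟨0, fun _ => comparisonAngle_nonneg _ _ _⟩)

theorem upperAngle_le_iff {c c' : ℝ → X} {α : ℝ} : upperAngle c c' ≤ α ↔ AngleLE c c' α := by
  constructor
  · intro h β hβ
    exact (eventually_lt_of_limsup_lt (h.trans_lt hβ)
      (isBoundedUnder_comparisonAngle c c')).mono fun _ hz => hz.le
  · intro h
    refine le_of_forall_gt_imp_ge_of_dense fun β hβ => ?_
    exact limsup_le_of_le (isCoboundedUnder_comparisonAngle c c') (h β hβ)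

theorem upperAngle_nonneg (c c' : ℝ → X) : 0 ≤ upperAngle c c' :=
  le_limsup_of_frequently_le (Eventually.of_forall fun _ => comparisonAngle_nonneg _ _ _).frequently
    (isBoundedUnder_comparisonAngle c c')

theorem upperAngle_eq_of_tendsto {c c' : ℝ → X} {α : ℝ}
    (h : Tendsto (fun z : ℝ × ℝ => comparisonAngle (c 0) (c z.1) (c' z.2))
      (𝓝[>] 0 ×ˢ 𝓝[>] 0) (𝓝 α)) : upperAngle c c' = α := h.limsup_eq

theorem upperAngle_congr {Y : Type*} [MetricSpace Y] {c c' : ℝ → X} {d d' : ℝ → Y}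
    (h : ∀ᶠ z : ℝ × ℝ in 𝓝[>] 0 ×ˢ 𝓝[>] 0, comparisonAngle (c 0) (c z.1) (c' z.2) =
      comparisonAngle (d 0) (d z.1) (d' z.2)) : upperAngle c c' = upperAngle d d' :=
  limsup_congr h

theorem eventually_prod_nhdsGT_zero {P : ℝ × ℝ → Prop} :
    (∀ᶠ z in 𝓝[>] (0 : ℝ) ×ˢ 𝓝[>] (0 : ℝ), P z) ↔
      ∃ δ > 0, ∀ s ∈ Ioo 0 δ, ∀ t ∈ Ioo 0 δ, P (s, t) := by
  rw [(nhdsGT_basis (0 : ℝ)).prod_self.eventually_iff]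
  constructor
  · rintro ⟨δ, hδ, h⟩
    exact ⟨δ, hδ, fun s hs t ht => h (mk_mem_prod hs ht)⟩
  · rintro ⟨δ, hδ, h⟩
    exact ⟨δ, hδ, fun z hz => h _ hz.1 _ hz.2⟩

/-- Since `Real.arccos` truncates its argument to [-1, 1], inverting it needs care at both ends: the
triangle inequality keeps the quotient at least -1, and a quotient above 1 dominates every cosine
anyway. -/
theorem cos_comparisonAngle_le {p x y : X} (hx : x ≠ p) (hy : y ≠ p) {β : ℝ} (hβ : β ≤ Real.pi)
    (h : comparisonAngle p x y ≤ β) :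
    dist x y ^ 2 ≤ dist p x ^ 2 + dist p y ^ 2 - 2 * dist p x * dist p y * Real.cos β := by
  have h1 : 0 < dist p x := dist_pos.2 hx.symm
  have h2 : 0 < dist p y := dist_pos.2 hy.symm
  set u := (dist p x ^ 2 + dist p y ^ 2 - dist x y ^ 2) / (2 * dist p x * dist p y) with hu
  have hu1 : -1 ≤ u := by
    rw [hu, le_div_iff₀ (by positivity)]
    have := dist_triangle_left x y p
    nlinarith [dist_nonneg (x := x) (y := y)]
  have h3 : Real.cos β ≤ u := by
    have h4 : Real.cos β ≤ Real.cos (Real.arccos u) :=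
      Real.cos_le_cos_of_nonneg_of_le_pi (Real.arccos_nonneg _) hβ h
    rcases le_total u 1 with h5 | h5
    · rwa [Real.cos_arccos hu1 h5] at h4
    · exact (Real.cos_le_one _).trans h5
  rw [hu, le_div_iff₀ (by positivity)] at h3
  linarith

theorem comparisonAngle_le_of_dist_sq_le {p x y : X} (hx : x ≠ p) (hy : y ≠ p) {β : ℝ}
    (hβ0 : 0 ≤ β) (hβ : β ≤ Real.pi)
    (h : dist x y ^ 2 ≤ dist p x ^ 2 + dist p y ^ 2 - 2 * dist p x * dist p y * Real.cos β) :
    comparisonAngle p x y ≤ β := by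
  have h1 : 0 < dist p x := dist_pos.2 hx.symm
  have h2 : 0 < dist p y := dist_pos.2 hy.symm
  rw [← Real.arccos_cos hβ0 hβ]
  apply Real.arccos_le_arccos
  rw [le_div_iff₀ (by positivity)]
  linarith

/-- A ray inside a planar angle `β₁ + β₂ < π` meets the segment between points at distances `x`
and `y` on the sides. -/
theorem exists_point_on_segment_planar {x y β₁ β₂ : ℝ} (hx : 0 < x) (hy : 0 < y) (h1 : 0 < β₁)
    (h2 : 0 < β₂) (h12 : β₁ + β₂ < Real.pi) : ∃ r, 0 < r ∧ r ≤ max x y ∧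
      √(x ^ 2 + r ^ 2 - 2 * x * r * Real.cos β₁) + √(r ^ 2 + y ^ 2 - 2 * r * y * Real.cos β₂) =
        √(x ^ 2 + y ^ 2 - 2 * x * y * Real.cos (β₁ + β₂)) := by
  have hs1 : 0 < Real.sin β₁ := Real.sin_pos_of_pos_of_lt_pi h1 (by linarith)
  have hs2 : 0 < Real.sin β₂ := Real.sin_pos_of_pos_of_lt_pi h2 (by linarith)
  have hS : 0 < Real.sin (β₁ + β₂) := Real.sin_pos_of_pos_of_lt_pi (by linarith) h12
  have hc1 : Real.cos β₁ ≤ 1 := Real.cos_le_one _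
  have hc2 : Real.cos β₂ ≤ 1 := Real.cos_le_one _
  have e1 := Real.sin_sq_add_cos_sq β₁
  have e2 := Real.sin_sq_add_cos_sq β₂
  rw [Real.cos_add]
  rw [Real.sin_add] at hS
  set s1 := Real.sin β₁
  set s2 := Real.sin β₂
  set c1 := Real.cos β₁
  set c2 := Real.cos β₂
  set W := x * s1 + y * s2 with hW
  have hWpos : 0 < W := by positivity
  -- The ray cuts the triangle in two; equating twice the areas, x r sin β₁ + r y sin β₂ = x y sin
  -- (β₁ + β₂), determines r. The numbers l and m are the barycentric coordinates of the
  -- intersection point on the segment.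
  set r := x * y * (s1 * c2 + c1 * s2) / W with hr
  have hrW : r * W = x * y * (s1 * c2 + c1 * s2) := by rw [hr]; field_simp
  set m := x * s1 / W with hm
  set l := y * s2 / W with hl
  have hlm : l + m = 1 := by rw [hl, hm, ← add_div, div_eq_one_iff_eq hWpos.ne', hW]; ring
  have hmW : m * W = x * s1 := by rw [hm]; field_simp
  have hlW : l * W = y * s2 := by rw [hl]; field_simp
  have hm0 : 0 ≤ m := by positivity
  have hl0 : 0 ≤ l := by positivity
  -- Cartesian coordinates of the intersection point, with the vertex at the origin and the side of
  -- length x along the first axis. They show that the point divides the segment in the ratio m : l.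
  have k1 : r * c1 = l * x + m * y * (c1 * c2 - s1 * s2) := by
    apply mul_right_cancel₀ hWpos.ne'
    linear_combination c1 * hrW - x * hlW - y * (c1 * c2 - s1 * s2) * hmW + (x * y * s2) * e1
  have k2 : r * s1 = m * y * (s1 * c2 + c1 * s2) := by
    apply mul_right_cancel₀ hWpos.ne'
    linear_combination s1 * hrW - y * (s1 * c2 + c1 * s2) * hmW
  refine ⟨r, by positivity, ?_, ?_⟩
  · rw [hr, div_le_iff₀ hWpos, hW]
    have := le_max_left x y
    have := le_max_right x y
    have a1 : x * y * (s1 * c2) ≤ max x y * (x * s1) := by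
      calc x * y * (s1 * c2) = y * (x * s1) * c2 := by ring
        _ ≤ y * (x * s1) * 1 := by gcongr
        _ = y * (x * s1) := by ring
        _ ≤ _ := by gcongr
    have a2 : x * y * (c1 * s2) ≤ max x y * (y * s2) := by
      calc x * y * (c1 * s2) = x * (y * s2) * c1 := by ring
        _ ≤ x * (y * s2) * 1 := by gcongr
        _ = x * (y * s2) := by ring
        _ ≤ _ := by gcongr
    linarith
  · set D := x ^ 2 + y ^ 2 - 2 * x * y * (c1 * c2 - s1 * s2) with hD
    have f1 : x ^ 2 + r ^ 2 - 2 * x * r * c1 = m ^ 2 * D := by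
      have : x ^ 2 + r ^ 2 - 2 * x * r * c1 = (x - r * c1) ^ 2 + (r * s1) ^ 2 := by
        linear_combination (-r ^ 2) * e1
      rw [this, k1, k2, hD]
      have hl' : l = 1 - m := by linarith
      rw [hl']
      linear_combination m ^ 2 * y ^ 2 * (s2 ^ 2 + c2 ^ 2) * e1 + m ^ 2 * y ^ 2 * e2
    have f2 : r ^ 2 + y ^ 2 - 2 * r * y * c2 = l ^ 2 * D := by
      have : r ^ 2 + y ^ 2 - 2 * r * y * c2 =
          (y * (c1 * c2 - s1 * s2) - r * c1) ^ 2 + (y * (s1 * c2 + c1 * s2) - r * s1) ^ 2 := by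
        linear_combination (2 * r * y * c2 - r ^ 2 - y ^ 2 * (s2 ^ 2 + c2 ^ 2)) * e1 - y ^ 2 * e2
      rw [this, k1, k2, hD]
      have hm' : m = 1 - l := by linarith
      rw [hm']
      linear_combination l ^ 2 * y ^ 2 * (s2 ^ 2 + c2 ^ 2) * e1 + l ^ 2 * y ^ 2 * e2
    rw [f1, f2, Real.sqrt_mul (by positivity), Real.sqrt_mul (by positivity), Real.sqrt_sq hm0,
      Real.sqrt_sq hl0, ← add_mul, add_comm m l, hlm, one_mul]

/-- Near `0`, the curve `c` is continuous on the right and does not return to its initial point. -/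
def IsArc (c : ℝ → X) : Prop :=
  ∃ δ > 0, ContinuousOn c (Icc 0 δ) ∧ ∀ s ∈ Ioc (0 : ℝ) δ, c s ≠ c 0

theorem IsArc.tendsto {c : ℝ → X} (h : IsArc c) : Tendsto c (𝓝[>] 0) (𝓝 (c 0)) := by
  obtain ⟨δ, hδ, hc, -⟩ := h
  refine (hc 0 (left_mem_Icc.2 hδ.le)).tendsto.mono_left ?_
  rw [nhdsWithin_le_iff]
  exact Icc_mem_nhdsGT hδ

theorem IsArc.eventually_ne {c : ℝ → X} (h : IsArc c) : ∀ᶠ s in 𝓝[>] 0, c s ≠ c 0 := by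
  obtain ⟨δ, hδ, -, hc⟩ := h
  filter_upwards [Ioc_mem_nhdsGT hδ] with s hs using hc s hs

theorem IsArc.exists_dist_lt {c : ℝ → X} (h : IsArc c) {ρ : ℝ} (hρ : 0 < ρ) :
    ∃ δ > 0, ∀ s ∈ Ioo 0 δ, c s ≠ c 0 ∧ dist (c 0) (c s) < ρ := by
  have := h.eventually_ne.and (h.tendsto.eventually (Metric.ball_mem_nhds _ hρ))
  obtain ⟨δ, hδ, H⟩ := (nhdsGT_basis (0 : ℝ)).eventually_iff.1 this
  refine ⟨δ, hδ, fun s hs => ?_⟩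
  rw [dist_comm]
  exact H hs

/-- Intermediate value theorem for the distance to the starting point: an arc attains every small
radius, even if it is not parametrized by length. -/
theorem IsArc.exists_dist_eq {c : ℝ → X} (h : IsArc c) {δ : ℝ} (hδ : 0 < δ) :
    ∃ ρ > 0, ∀ r, 0 < r → r ≤ ρ → ∃ u ∈ Ioo 0 δ, c u ≠ c 0 ∧ dist (c 0) (c u) = r := by
  obtain ⟨δ', hδ', hc, hne⟩ := h
  set u₀ := min (δ / 2) δ'
  have hu₀ : 0 < u₀ := lt_min (by linarith) hδ'
  have hu₁ : u₀ ≤ δ' := min_le_right _ _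
  have hu₂ : u₀ < δ := (min_le_left _ _).trans_lt (by linarith)
  refine ⟨dist (c 0) (c u₀), dist_pos.2 (hne _ ⟨hu₀, hu₁⟩).symm, fun r hr hr' => ?_⟩
  have hcont : ContinuousOn (fun u => dist (c 0) (c u)) (Icc 0 u₀) :=
    (continuous_const.dist continuous_id).comp_continuousOn (hc.mono (Icc_subset_Icc_right hu₁))
  obtain ⟨u, hu, he⟩ := intermediate_value_Icc hu₀.le hcont
    (show r ∈ Icc (dist (c 0) (c 0)) (dist (c 0) (c u₀)) from ⟨by simpa using hr.le, hr'⟩)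
  have hu0 : 0 < u := by
    refine lt_of_le_of_ne hu.1 ?_
    rintro rfl
    simp at he
    exact hr.ne he
  exact ⟨u, ⟨hu0, hu.2.trans_lt hu₂⟩, hne u ⟨hu0, hu.2.trans hu₁⟩, he⟩

/-- The triangle inequality for upper angles. -/
theorem AngleLE.trans {c c' c'' : ℝ → X} {α₁ α₂ : ℝ} (h1 : AngleLE c c' α₁)
    (h2 : AngleLE c' c'' α₂) (hc : IsArc c) (hc' : IsArc c') (hc'' : IsArc c'')
    (e : c 0 = c' 0) (e' : c' 0 = c'' 0) (hα₁ : 0 ≤ α₁) (hα₂ : 0 ≤ α₂) :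
    AngleLE c c'' (α₁ + α₂) := by
  intro β hβ
  -- A comparison angle never exceeds π, so only β < π has content; this is also the range in which
  -- the planar picture is valid.
  rcases le_or_gt Real.pi β with hπ | hπ
  · exact Eventually.of_forall fun z => (comparisonAngle_le_pi _ _ _).trans hπ
  set η := (β - (α₁ + α₂)) / 2
  have hη : 0 < η := by simp only [η]; linarith
  set β₁ := α₁ + η
  set β₂ := α₂ + η
  have hsum : β₁ + β₂ = β := by simp only [β₁, β₂, η]; ring
  obtain ⟨δ₁, hδ₁, H1⟩ := eventually_prod_nhdsGT_zero.1 (h1 β₁ (by simp only [β₁]; linarith))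
  obtain ⟨δ₂, hδ₂, H2⟩ := eventually_prod_nhdsGT_zero.1 (h2 β₂ (by simp only [β₂]; linarith))
  obtain ⟨ρ, hρ, Hρ⟩ := hc'.exists_dist_eq (lt_min hδ₁ hδ₂)
  obtain ⟨δ₃, hδ₃, H3⟩ := hc.exists_dist_lt hρ
  obtain ⟨δ₄, hδ₄, H4⟩ := hc''.exists_dist_lt hρ
  rw [eventually_prod_nhdsGT_zero]
  refine ⟨min (min δ₁ δ₂) (min δ₃ δ₄), by positivity, fun s hs t ht => ?_⟩
  simp only [mem_Ioo, lt_min_iff] at hs ht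
  obtain ⟨hs0, hxρ⟩ := H3 s ⟨hs.1, hs.2.2.1⟩
  obtain ⟨ht0, hyρ⟩ := H4 t ⟨ht.1, ht.2.2.2⟩
  rw [← e', ← e] at hyρ ht0
  have hx : 0 < dist (c 0) (c s) := dist_pos.2 hs0.symm
  have hy : 0 < dist (c 0) (c'' t) := dist_pos.2 ht0.symm
  -- Draw a planar angle β₁ + β₂ with sides of the actual distances. The middle curve is sampled at
  -- the radius where the planar ray crosses the third side, so the two planar bounds add up to
  -- exactly that side.
  obtain ⟨r, hr, hr', hre⟩ := exists_point_on_segment_planar hx hy (β₁ := β₁) (β₂ := β₂)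
    (by simp only [β₁]; linarith) (by simp only [β₂]; linarith) (by linarith)
  obtain ⟨u, hu, hu0, hru⟩ := Hρ r hr (hr'.trans (max_le hxρ.le hyρ.le))
  simp only [mem_Ioo, lt_min_iff] at hu
  rw [← e] at hu0
  have a1 := cos_comparisonAngle_le hs0 hu0 (by linarith) (H1 s ⟨hs.1, hs.2.1.1⟩ u ⟨hu.1, hu.2.1⟩)
  have a2 := H2 u ⟨hu.1, hu.2.2⟩ t ⟨ht.1, ht.2.1.2⟩
  simp only [← e] at a2 hru
  have a3 := cos_comparisonAngle_le hu0 ht0 (by linarith) a2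
  rw [hru] at a1 a3
  refine comparisonAngle_le_of_dist_sq_le hs0 ht0 (by linarith) hπ.le ?_
  have hD : 0 ≤ dist (c 0) (c s) ^ 2 + dist (c 0) (c'' t) ^ 2 -
      2 * dist (c 0) (c s) * dist (c 0) (c'' t) * Real.cos β := by
    nlinarith [Real.cos_le_one β, sq_nonneg (dist (c 0) (c s) - dist (c 0) (c'' t)),
      mul_pos hx hy]
  rw [hsum] at hre
  rw [← Real.le_sqrt dist_nonneg hD]
  calc dist (c s) (c'' t) ≤ dist (c s) (c' u) + dist (c' u) (c'' t) := dist_triangle _ _ _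
    _ ≤ _ := add_le_add (Real.le_sqrt_of_sq_le a1) (Real.le_sqrt_of_sq_le a3)
    _ = _ := hre

theorem upperAngle_triangle {c c' c'' : ℝ → X} (hc : IsArc c) (hc' : IsArc c') (hc'' : IsArc c'')
    (e : c 0 = c' 0) (e' : c' 0 = c'' 0) :
    upperAngle c c'' ≤ upperAngle c c' + upperAngle c' c'' :=
  upperAngle_le_iff.2 <| (upperAngle_le_iff.1 le_rfl).trans (upperAngle_le_iff.1 le_rfl) hc hc' hc''
    e e' (upperAngle_nonneg _ _) (upperAngle_nonneg _ _)

end UpperAngle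

/-! ### Geodesics and angles in the hyperbolic plane -/

namespace UpperHalfPlane

/-- The chart `z ↦ (re z, |z|²)` of the upper half-plane, in which geodesics are straight. -/
def parab (z : UpperHalfPlane) : ℂ := ⟨z.re, z.re ^ 2 + z.im ^ 2⟩

@[simp] theorem parab_re (z : UpperHalfPlane) : (parab z).re = z.re := rfl

@[simp] theorem parab_im (z : UpperHalfPlane) : (parab z).im = z.re ^ 2 + z.im ^ 2 := rfl

/-- The convex set above the parabola, the image of `parab`. -/
def aboveParabola : Set ℂ := {w | w.re ^ 2 < w.im}

/-- The inverse of `parab` on `aboveParabola`. -/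
def unparab (w : ℂ) (hw : w ∈ aboveParabola) : UpperHalfPlane :=
  ⟨⟨w.re, √(w.im - w.re ^ 2)⟩, Real.sqrt_pos.2 (sub_pos.2 hw)⟩

theorem parab_mem (z : UpperHalfPlane) : parab z ∈ aboveParabola := by
  simp only [aboveParabola, mem_ofPred_eq, parab_re, parab_im]
  nlinarith [z.im_pos]

theorem parab_unparab (w : ℂ) (hw : w ∈ aboveParabola) : parab (unparab w hw) = w := by
  have h : (0 : ℝ) ≤ w.im - w.re ^ 2 := (sub_pos.2 hw).le
  apply Complex.ext
  · rfl
  · change w.re ^ 2 + √(w.im - w.re ^ 2) ^ 2 = w.im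
    rw [Real.sq_sqrt h]; ring

theorem parab_injective : Function.Injective parab := by
  intro z w h
  have h1 : z.re = w.re := by simpa using congrArg Complex.re h
  have h2 : z.re ^ 2 + z.im ^ 2 = w.re ^ 2 + w.im ^ 2 := by
    simpa using congrArg Complex.im h
  have h3 : z.im = w.im := by
    rw [h1] at h2
    exact (pow_left_inj₀ z.im_pos.le w.im_pos.le two_ne_zero).1 (by linarith)
  exact UpperHalfPlane.ext (Complex.ext h1 h3)

theorem convex_aboveParabola : Convex ℝ aboveParabola := by
  have : aboveParabola = {w : ℂ | w.re ^ 2 - w.im < 0} := by ext; simp [aboveParabola]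
  rw [this]
  have hc : ConvexOn ℝ univ (fun w : ℂ => w.re ^ 2 - w.im) := by
    have h1 : ConvexOn ℝ univ (fun x : ℝ => x ^ 2) := (even_two).convexOn_pow
    have h2 := h1.comp_linearMap Complex.reLm
    exact h2.sub (Complex.imLm.concaveOn convex_univ)
  simpa using hc.convex_lt 0

/-- The differential of a conformal chart at `P` composed with the differential of `parab⁻¹`,
rescaled. -/
def tangentMap (P : UpperHalfPlane) : ℂ →ₗ[ℝ] ℂ where
  toFun w := ⟨P.im * w.re, (w.im - 2 * P.re * w.re) / 2⟩
  map_add' v w := by apply Complex.ext <;> simp <;> ring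
  map_smul' r w := by apply Complex.ext <;> simp <;> ring

theorem tangentMap_injective (P : UpperHalfPlane) : Function.Injective (tangentMap P) := by
  rw [injective_iff_map_eq_zero]
  intro w hw
  have h1 : P.im * w.re = 0 := congrArg Complex.re hw
  have h2 : (w.im - 2 * P.re * w.re) / 2 = 0 := congrArg Complex.im hw
  have h3 : w.re = 0 := (mul_eq_zero.1 h1).resolve_left P.im_pos.ne'
  apply Complex.ext
  · exact h3
  · rw [h3] at h2; simp at h2; exact h2

/-- The tangent vector at `P`, of length `sinh (dist P Q)`, that points to `Q`. -/
def tangentVec (P Q : UpperHalfPlane) : ℂ :=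
  (P.im * Q.im)⁻¹ • tangentMap P (parab Q - parab P)

theorem tangentVec_re (P Q : UpperHalfPlane) : (tangentVec P Q).re = (Q.re - P.re) / Q.im := by
  have := P.im_pos.ne'
  simp [tangentVec, tangentMap]
  field_simp

theorem tangentVec_im (P Q : UpperHalfPlane) : (tangentVec P Q).im =
    ((Q.re - P.re) ^ 2 + Q.im ^ 2 - P.im ^ 2) / (2 * P.im * Q.im) := by
  have := P.im_pos.ne'
  have := Q.im_pos.ne'
  simp [tangentVec, tangentMap]
  field_simp
  ring

/-- This is the hyperbolic law of cosines in vector form. Both sides are rational functions of the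
coordinates, so it is an algebraic identity. -/
theorem inner_tangentVec (P Q R : UpperHalfPlane) : inner ℝ (tangentVec P Q) (tangentVec P R) =
    Real.cosh (dist P Q) * Real.cosh (dist P R) - Real.cosh (dist Q R) := by
  have := P.im_pos.ne'
  have := Q.im_pos.ne'
  have := R.im_pos.ne'
  rw [Complex.inner, Complex.mul_re, Complex.conj_re, Complex.conj_im]
  simp only [tangentVec_re, tangentVec_im, cosh_dist']
  field_simp
  ring

theorem norm_tangentVec (P Q : UpperHalfPlane) : ‖tangentVec P Q‖ = Real.sinh (dist P Q) := by
  have h := inner_tangentVec P Q Q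
  rw [real_inner_self_eq_norm_sq, dist_self, Real.cosh_zero] at h
  have h2 := Real.cosh_sq (dist P Q)
  have h3 : 0 ≤ Real.sinh (dist P Q) := Real.sinh_nonneg_iff.2 dist_nonneg
  exact (pow_left_inj₀ (norm_nonneg _) h3 two_ne_zero).1 (by linarith)

theorem sameRay_pos_smul_iff {x y : ℂ} {r s : ℝ} (hr : 0 < r) (hs : 0 < s) :
    SameRay ℝ (r • x) (s • y) ↔ SameRay ℝ x y := by
  refine ⟨fun h => ?_, fun h => (h.pos_smul_left hr).pos_smul_right hs⟩
  have := (h.pos_smul_left (inv_pos.2 hr)).pos_smul_right (inv_pos.2 hs)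
  rwa [inv_smul_smul₀ hr.ne', inv_smul_smul₀ hs.ne'] at this

/-- By the addition formula for cosh, equality in the triangle inequality at R is equality in
Cauchy–Schwarz for the tangent vectors at R towards P and away from Q. Hence the two vectors lie on
one ray, and the injective linear map `tangentMap` carries this over to the chart. -/
theorem mem_metricSegment_iff {P Q R : UpperHalfPlane} :
    R ∈ metricSegment P Q ↔ parab R ∈ segment ℝ (parab P) (parab Q) := by
  have hpos : ∀ A B : UpperHalfPlane, 0 < (A.im * B.im)⁻¹ := fun A B => by positivity
  have key : parab R ∈ segment ℝ (parab P) (parab Q) ↔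
      SameRay ℝ (tangentVec R P) (-tangentVec R Q) := by
    rw [mem_segment_iff_sameRay, ← sameRay_neg_iff, neg_sub, neg_sub,
      ← (tangentMap_injective R).sameRay_map_iff, tangentVec, tangentVec, ← smul_neg,
      sameRay_pos_smul_iff (hpos _ _) (hpos _ _), ← map_neg, neg_sub]
  have h1 : SameRay ℝ (tangentVec R P) (-tangentVec R Q) ↔
      inner ℝ (tangentVec R P) (-tangentVec R Q) = ‖tangentVec R P‖ * ‖-tangentVec R Q‖ := by
    rw [sameRay_iff_norm_smul_eq, inner_eq_norm_mul_iff_real, eq_comm]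
  rw [key, h1, inner_neg_right, norm_neg, inner_tangentVec, norm_tangentVec, norm_tangentVec,
    metricSegment, mem_ofPred_eq, dist_comm P R, neg_sub, sub_eq_iff_eq_add', ← Real.cosh_add]
  constructor
  · intro h; rw [h]
  · intro h
    exact Real.cosh_injOn (mem_Ici.2 (add_nonneg dist_nonneg dist_nonneg)) (mem_Ici.2 dist_nonneg)
      h.symm

/-- Segments correspond under `parab`, hence so do convex sets. Convexity of `aboveParabola` is
needed so that Euclidean segments between image points stay in the image. -/
theorem geodesicHull_eq (A : Set UpperHalfPlane) :
    geodesicHull A = parab ⁻¹' convexHull ℝ (parab '' A) := by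
  apply Subset.antisymm
  · apply sInter_subset_of_mem
    refine ⟨fun x hx => subset_convexHull ℝ _ (mem_image_of_mem _ hx), fun x hx y hy z hz => ?_⟩
    exact (convex_convexHull ℝ _).segment_subset hx hy (mem_metricSegment_iff.1 hz)
  · intro z hz
    rw [geodesicHull, mem_sInter]
    rintro C ⟨hAC, hC⟩
    have hconv : Convex ℝ (parab '' C) := by
      rw [convex_iff_segment_subset]
      rintro _ ⟨x, hx, rfl⟩ _ ⟨y, hy, rfl⟩ w hw
      have hw' := convex_aboveParabola.segment_subset (parab_mem x) (parab_mem y) hw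
      refine ⟨unparab w hw', hC x hx y hy ?_, parab_unparab w hw'⟩
      rwa [mem_metricSegment_iff, parab_unparab]
    obtain ⟨y, hy, e⟩ := convexHull_min (image_mono hAC) hconv hz
    rwa [← parab_injective e]

/-- Moving a point along a geodesic from P only rescales the tangent vector at P, so angles at P
depend only on the sides. -/
theorem tangentVec_of_mem_metricSegment {P Q R : UpperHalfPlane} (h : R ∈ metricSegment P Q)
    (hR : R ≠ P) : ∃ r : ℝ, 0 < r ∧ tangentVec P R = r • tangentVec P Q := by
  rw [mem_metricSegment_iff, segment_eq_image'] at h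
  obtain ⟨l, ⟨hl0, hl1⟩, hl⟩ := h
  have hl' : parab R - parab P = l • (parab Q - parab P) := by simp only [← hl]; abel
  have hl2 : l ≠ 0 := by
    rintro rfl
    simp [sub_eq_zero] at hl'
    exact hR (parab_injective hl')
  have := P.im_pos
  have := Q.im_pos
  have := R.im_pos
  refine ⟨(P.im * R.im)⁻¹ * l * (P.im * Q.im), by positivity, ?_⟩
  rw [tangentVec, tangentVec, hl', map_smul, smul_smul, smul_smul, mul_assoc,
    mul_inv_cancel₀ (by positivity), mul_one]

theorem angle_tangentVec_of_mem_metricSegment {P A B Q R : UpperHalfPlane}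
    (hQ : Q ∈ metricSegment P A) (hR : R ∈ metricSegment P B) (hQP : Q ≠ P) (hRP : R ≠ P) :
    InnerProductGeometry.angle (tangentVec P Q) (tangentVec P R) =
      InnerProductGeometry.angle (tangentVec P A) (tangentVec P B) := by
  obtain ⟨r, hr, h⟩ := tangentVec_of_mem_metricSegment hQ hQP
  obtain ⟨s, hs, h'⟩ := tangentVec_of_mem_metricSegment hR hRP
  rw [h, h', InnerProductGeometry.angle_smul_left_of_pos _ _ hr,
    InnerProductGeometry.angle_smul_right_of_pos _ _ hs]

theorem law_of_cosines (P Q R : UpperHalfPlane) : Real.cosh (dist Q R) =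
    Real.cosh (dist P Q) * Real.cosh (dist P R) - Real.sinh (dist P Q) * Real.sinh (dist P R) *
      Real.cos (InnerProductGeometry.angle (tangentVec P Q) (tangentVec P R)) := by
  have h := InnerProductGeometry.cos_angle_mul_norm_mul_norm (tangentVec P Q) (tangentVec P R)
  rw [inner_tangentVec, norm_tangentVec, norm_tangentVec] at h
  linarith

theorem sinh_le_self_mul_cosh {a : ℝ} (ha : 0 ≤ a) : Real.sinh a ≤ a * Real.cosh a := by
  have hd : ∀ x : ℝ, HasDerivAt (fun x => x * Real.cosh x - Real.sinh x) (x * Real.sinh x) x := by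
    intro x
    have := ((hasDerivAt_id x).mul (Real.hasDerivAt_cosh x)).sub (Real.hasDerivAt_sinh x)
    convert! this using 1
    simp
  have hm : MonotoneOn (fun x => x * Real.cosh x - Real.sinh x) (Ici 0) := by
    refine monotoneOn_of_deriv_nonneg (convex_Ici 0)
      (fun x _ => (hd x).continuousAt.continuousWithinAt)
      (fun x _ => (hd x).differentiableAt.differentiableWithinAt) fun x hx => ?_
    rw [interior_Ici, mem_Ioi] at hx
    rw [(hd x).deriv]
    exact mul_nonneg hx.le (Real.sinh_nonneg_iff.2 hx.le)
  have := hm (mem_Ici.2 le_rfl) (mem_Ici.2 ha) ha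
  simp at this
  linarith

/-- Comparison between the Euclidean and the hyperbolic angle of a small triangle. -/
theorem cos_comparison_bounds {x y z c : ℝ} (hx : 0 < x) (hy : 0 < y) (hz1 : |x - y| ≤ z)
    (hc : c ≤ 1) (h : Real.cosh z = Real.cosh x * Real.cosh y - Real.sinh x * Real.sinh y * c) :
    1 - Real.cosh x * Real.cosh y * (1 - c) ≤ (x ^ 2 + y ^ 2 - z ^ 2) / (2 * x * y) ∧
    (x ^ 2 + y ^ 2 - z ^ 2) / (2 * x * y) ≤ 1 - (1 - c) / Real.cosh z ^ 2 := by
  set w := |x - y| with hw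
  have hw0 : 0 ≤ w := abs_nonneg _
  have hw2 : w ^ 2 = (x - y) ^ 2 := sq_abs _
  -- This is the analogue of z² - (x - y)² = 2xy(1 - cos) in Euclidean geometry. Factoring both left
  -- sides through (z ± w) / 2 reduces the comparison to u ≤ sinh u ≤ u cosh u.
  have hcw : Real.cosh z - Real.cosh w = Real.sinh x * Real.sinh y * (1 - c) := by
    rw [hw, Real.cosh_abs, Real.cosh_sub, h]; ring
  have hprod : Real.cosh z - Real.cosh w = 2 *
      (Real.sinh ((z + w) / 2) * Real.sinh ((z - w) / 2)) := by
    have e1 : z = (z + w) / 2 + (z - w) / 2 := by ring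
    have e2 : w = (z + w) / 2 - (z - w) / 2 := by ring
    have c1 := Real.cosh_add ((z + w) / 2) ((z - w) / 2)
    have c2 := Real.cosh_sub ((z + w) / 2) ((z - w) / 2)
    rw [← e1] at c1
    rw [← e2] at c2
    linarith
  set a := (z + w) / 2 with ha
  set b := (z - w) / 2 with hb
  have ha0 : 0 ≤ a := by rw [ha]; linarith
  have hb0 : 0 ≤ b := by rw [hb]; linarith
  have hab : 4 * (a * b) = z ^ 2 - w ^ 2 := by rw [ha, hb]; ring
  have hcz := Real.one_le_cosh z
  have haz : Real.cosh a ≤ Real.cosh z := Real.cosh_le_cosh.2 (by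
    rw [abs_of_nonneg ha0, abs_of_nonneg (by linarith)]; linarith)
  have hbz : Real.cosh b ≤ Real.cosh z := Real.cosh_le_cosh.2 (by
    rw [abs_of_nonneg hb0, abs_of_nonneg (by linarith)]; linarith)
  have sa := Real.self_le_sinh_iff.2 ha0
  have sb := Real.self_le_sinh_iff.2 hb0
  have sx := Real.self_le_sinh_iff.2 hx.le
  have sy := Real.self_le_sinh_iff.2 hy.le
  have sa' : Real.sinh a ≤ a * Real.cosh z :=
    (sinh_le_self_mul_cosh ha0).trans (by gcongr)
  have sb' : Real.sinh b ≤ b * Real.cosh z :=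
    (sinh_le_self_mul_cosh hb0).trans (by gcongr)
  have sx' := sinh_le_self_mul_cosh hx.le
  have sy' := sinh_le_self_mul_cosh hy.le
  have hc' : 0 ≤ 1 - c := by linarith
  constructor
  · rw [le_div_iff₀ (by positivity)]
    have h1 : a * b ≤ Real.sinh a * Real.sinh b := by gcongr
    have h2 : Real.sinh x * Real.sinh y * (1 - c) ≤
        (x * Real.cosh x) * (y * Real.cosh y) * (1 - c) := by gcongr
    nlinarith
  · rw [div_le_iff₀ (by positivity), sub_mul, div_mul_eq_mul_div, one_mul, le_sub_iff_add_le,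
      ← le_sub_iff_add_le', div_le_iff₀ (by positivity)]
    have h1 : Real.sinh a * Real.sinh b ≤ (a * Real.cosh z) * (b * Real.cosh z) := by
      gcongr
    have h2 : x * y * (1 - c) ≤ Real.sinh x * Real.sinh y * (1 - c) := by gcongr
    nlinarith

/-- The hyperbolic angle stays equal to γ while the three sides shrink, so the cosh factors in
`cos_comparison_bounds` tend to 1 and squeeze the Euclidean cosine to cos γ. -/
theorem tendsto_comparisonAngle {ι : Type*} {l : Filter ι} {P : UpperHalfPlane}
    {Q R : ι → UpperHalfPlane} {γ : ℝ} (hγ0 : 0 ≤ γ) (hγπ : γ ≤ Real.pi)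
    (hQ : Tendsto Q l (𝓝 P)) (hR : Tendsto R l (𝓝 P))
    (hγ : ∀ᶠ i in l, Q i ≠ P ∧ R i ≠ P ∧
      InnerProductGeometry.angle (tangentVec P (Q i)) (tangentVec P (R i)) = γ) :
    Tendsto (fun i => comparisonAngle P (Q i) (R i)) l (𝓝 γ) := by
  have hx : Tendsto (fun i => dist P (Q i)) l (𝓝 0) := by
    simpa using (tendsto_const_nhds (x := P)).dist hQ
  have hy : Tendsto (fun i => dist P (R i)) l (𝓝 0) := by
    simpa using (tendsto_const_nhds (x := P)).dist hR
  have hz : Tendsto (fun i => dist (Q i) (R i)) l (𝓝 0) := by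
    simpa using hQ.dist hR
  have hcosh : Tendsto Real.cosh (𝓝 0) (𝓝 1) := by
    simpa using Real.continuous_cosh.tendsto 0
  have hcx := hcosh.comp hx
  have hcy := hcosh.comp hy
  have hcz := hcosh.comp hz
  rw [← Real.arccos_cos hγ0 hγπ]
  refine (Real.continuous_arccos.tendsto _).comp ?_
  have hlow : Tendsto (fun i => 1 - Real.cosh (dist P (Q i)) * Real.cosh (dist P (R i)) *
      (1 - Real.cos γ)) l (𝓝 (Real.cos γ)) := by
    have := ((hcx.mul hcy).mul_const (1 - Real.cos γ)).const_sub 1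
    simpa using this
  have hup : Tendsto (fun i => 1 - (1 - Real.cos γ) / Real.cosh (dist (Q i) (R i)) ^ 2) l
      (𝓝 (Real.cos γ)) := by
    have := ((tendsto_const_nhds (x := 1 - Real.cos γ)).div (hcz.pow 2) (by simp)).const_sub 1
    simpa using this
  have hb : ∀ᶠ i in l, 1 - Real.cosh (dist P (Q i)) * Real.cosh (dist P (R i)) *
        (1 - Real.cos γ) ≤ (dist P (Q i) ^ 2 + dist P (R i) ^ 2 - dist (Q i) (R i) ^ 2) /
          (2 * dist P (Q i) * dist P (R i)) ∧
      (dist P (Q i) ^ 2 + dist P (R i) ^ 2 - dist (Q i) (R i) ^ 2) /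
          (2 * dist P (Q i) * dist P (R i)) ≤
        1 - (1 - Real.cos γ) / Real.cosh (dist (Q i) (R i)) ^ 2 := by
    filter_upwards [hγ] with i hi
    apply cos_comparison_bounds (dist_pos.2 hi.1.symm) (dist_pos.2 hi.2.1.symm) _
      (Real.cos_le_one _)
    · rw [law_of_cosines P, hi.2.2]
    · rw [dist_comm P, dist_comm P]; exact abs_dist_sub_le _ _ _
  exact tendsto_of_tendsto_of_tendsto_of_le_of_le' hlow hup (hb.mono fun _ h => h.1)
    (hb.mono fun _ h => h.2)

/-- The upper angle of curves that run along the sides of a hyperbolic triangle. -/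
theorem tendsto_comparisonAngle_sides {P A B : UpperHalfPlane} {c c' : ℝ → UpperHalfPlane}
    (hc : IsArc c) (hc' : IsArc c') (h0 : c 0 = P) (h0' : c' 0 = P)
    (hcA : ∀ s ∈ Ioc (0 : ℝ) 1, c s ∈ metricSegment P A)
    (hcB : ∀ s ∈ Ioc (0 : ℝ) 1, c' s ∈ metricSegment P B) :
    Tendsto (fun z : ℝ × ℝ => comparisonAngle (c 0) (c z.1) (c' z.2)) (𝓝[>] 0 ×ˢ 𝓝[>] 0)
      (𝓝 (InnerProductGeometry.angle (tangentVec P A) (tangentVec P B))) := by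
  have hI : ∀ᶠ z : ℝ × ℝ in 𝓝[>] 0 ×ˢ 𝓝[>] 0, z.1 ∈ Ioc (0 : ℝ) 1 ∧ z.2 ∈ Ioc (0 : ℝ) 1 :=
    prod_mem_prod (Ioc_mem_nhdsGT one_pos) (Ioc_mem_nhdsGT one_pos)
  have hne : ∀ᶠ z : ℝ × ℝ in 𝓝[>] 0 ×ˢ 𝓝[>] 0, c z.1 ≠ c 0 ∧ c' z.2 ≠ c' 0 :=
    hc.eventually_ne.prod_mk hc'.eventually_ne
  have t1 := hc.tendsto.comp (tendsto_fst (f := 𝓝[>] (0 : ℝ)) (g := 𝓝[>] (0 : ℝ)))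
  have t2 := hc'.tendsto.comp (tendsto_snd (f := 𝓝[>] (0 : ℝ)) (g := 𝓝[>] (0 : ℝ)))
  rw [h0] at t1 ⊢
  rw [h0'] at t2
  refine tendsto_comparisonAngle (InnerProductGeometry.angle_nonneg _ _)
    (InnerProductGeometry.angle_le_pi _ _) t1 t2 ?_
  rw [h0, h0'] at hne
  filter_upwards [hI, hne] with z hz hn
  exact ⟨hn.1, hn.2,
    angle_tangentVec_of_mem_metricSegment (hcA _ hz.1) (hcB _ hz.2) hn.1 hn.2⟩

end UpperHalfPlane

/-! ### Areas of hyperbolic triangles -/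

/-- `u` is nonzero with argument in `(-π / 2, π / 2]`. -/
def IsRightward (u : ℂ) : Prop := 0 < u.re ∨ (u.re = 0 ∧ 0 < u.im)

theorem IsRightward.arg_mem {u : ℂ} (h : IsRightward u) :
    -(Real.pi / 2) < u.arg ∧ u.arg ≤ Real.pi / 2 := by
  rw [Complex.neg_pi_div_two_lt_arg_iff, Complex.arg_le_pi_div_two_iff]
  rcases h with h | ⟨h, h'⟩
  · exact ⟨.inl h, .inl h.le⟩
  · exact ⟨.inr h'.le, .inl h.ge⟩

theorem IsRightward.norm_pos {u : ℂ} (h : IsRightward u) : 0 < ‖u‖ := by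
  rw [norm_pos_iff]
  rintro rfl
  rcases h with h | ⟨h, h'⟩ <;> simp at *

/-- Both arguments lie in a half-open interval of length π, so their difference needs no correction
by 2π. -/
theorem IsRightward.angle_eq {u v : ℂ} (hu : IsRightward u) (hv : IsRightward v) :
    InnerProductGeometry.angle u v = |u.arg - v.arg| := by
  have h1 := hu.arg_mem
  have h2 := hv.arg_mem
  have hπ : |u.arg - v.arg| ≤ Real.pi := by rw [abs_le]; constructor <;> linarith
  rw [InnerProductGeometry.angle, ← Real.arccos_cos (abs_nonneg _) hπ, Real.cos_abs,
    Real.cos_sub]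
  congr 1
  have := hu.norm_pos
  have := hv.norm_pos
  rw [div_eq_iff (by positivity), Complex.inner, Complex.mul_re, Complex.conj_re, Complex.conj_im,
    ← Complex.norm_mul_cos_arg u, ← Complex.norm_mul_cos_arg v, ← Complex.norm_mul_sin_arg u,
    ← Complex.norm_mul_sin_arg v]
  ring

/-- The cross product is the product of the norms with the sine of the difference of the arguments,
and that difference is less than π in absolute value. -/
theorem IsRightward.arg_le_arg {u v : ℂ} (hu : IsRightward u) (hv : IsRightward v)
    (h : 0 ≤ u.re * v.im - u.im * v.re) : u.arg ≤ v.arg := by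
  have h1 := hu.arg_mem
  have h2 := hv.arg_mem
  by_contra! hlt
  have hs : 0 < Real.sin (u.arg - v.arg) :=
    Real.sin_pos_of_pos_of_lt_pi (by linarith) (by linarith)
  rw [Real.sin_sub] at hs
  have := mul_pos (mul_pos hu.norm_pos hv.norm_pos) hs
  rw [← Complex.norm_mul_cos_arg u, ← Complex.norm_mul_cos_arg v, ← Complex.norm_mul_sin_arg u,
    ← Complex.norm_mul_sin_arg v] at h
  nlinarith

theorem IsRightward.arg_eq_arctan {u : ℂ} (h : 0 < u.re) : u.arg = Real.arctan (u.im / u.re) := by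
  have h1 := IsRightward.arg_mem (.inl h)
  have h2 : u.arg < Real.pi / 2 := (Complex.arg_lt_pi_div_two_iff).2 (.inl h)
  rw [← Complex.tan_arg, Real.arctan_tan h1.1 h2]

/-- Twice the signed area of the Euclidean triangle `(p, q, r)`. -/
def signedArea (p q r : ℂ) : ℝ := (q.re - p.re) * (r.im - p.im) - (q.im - p.im) * (r.re - p.re)

/-- The signed areas of the triangles spanned by w and the sides, divided by the total, are the
barycentric coordinates of w. -/
theorem mem_convexHull_triple_iff {p q r : ℂ} (h : 0 < signedArea p q r) (w : ℂ) :
    w ∈ convexHull ℝ {p, q, r} ↔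
      0 ≤ signedArea p q w ∧ 0 ≤ signedArea q r w ∧ 0 ≤ signedArea r p w := by
  have hconv : ∀ a b : ℂ, Convex ℝ {w | 0 ≤ signedArea a b w} := by
    intro a b
    let L : ℂ →ₗ[ℝ] ℝ := (b.re - a.re) • Complex.imLm - (b.im - a.im) • Complex.reLm
    have : {w | 0 ≤ signedArea a b w} = {w | L a ≤ L w} := by
      ext w
      simp only [mem_ofPred_eq, signedArea, L, LinearMap.sub_apply, LinearMap.smul_apply,
        Complex.imLm_coe, Complex.reLm_coe, smul_eq_mul]
      constructor <;> intro h <;> linarith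
    rw [this]
    exact convex_halfSpace_ge L.isLinear _
  constructor
  · have hsub : convexHull ℝ {p, q, r} ⊆
        {w | 0 ≤ signedArea p q w} ∩ ({w | 0 ≤ signedArea q r w} ∩ {w | 0 ≤ signedArea r p w}) := by
      apply convexHull_min _ ((hconv _ _).inter ((hconv _ _).inter (hconv _ _)))
      have e1 : signedArea q r p = signedArea p q r := by unfold signedArea; ring
      have e2 : signedArea r p q = signedArea p q r := by unfold signedArea; ring
      have z1 : ∀ a b, signedArea a b a = 0 := fun a b => by unfold signedArea; ring
      have z2 : ∀ a b, signedArea a b b = 0 := fun a b => by unfold signedArea; ring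
      rintro _ (rfl | rfl | rfl) <;> simp [e1, e2, z1, z2, h.le]
    exact fun hw => hsub hw
  · rintro ⟨h1, h2, h3⟩
    set D := signedArea p q r with hD
    have hw : w = (signedArea q r w / D) • p + ((signedArea r p w / D) • q +
        (signedArea p q w / D) • r) := by
      apply Complex.ext <;> simp <;> field_simp <;> rw [hD] <;> unfold signedArea <;> ring
    have hsum : signedArea q r w / D + (signedArea r p w / D + signedArea p q w / D) = 1 := by
      field_simp
      rw [hD]; unfold signedArea; ring
    have mp : p ∈ convexHull ℝ {p, q, r} := subset_convexHull ℝ _ (by simp)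
    have mq : q ∈ convexHull ℝ {p, q, r} := subset_convexHull ℝ _ (by simp)
    have mr : r ∈ convexHull ℝ {p, q, r} := subset_convexHull ℝ _ (by simp)
    have := (convex_convexHull ℝ {p, q, r}).sum_mem (t := Finset.univ)
      (w := ![signedArea q r w / D, signedArea r p w / D, signedArea p q w / D]) (z := ![p, q, r])
      (by intro i _; fin_cases i <;> simp <;> positivity)
      (by simpa [Fin.sum_univ_three, add_assoc] using hsum)
      (by intro i _; fin_cases i <;> simp [mp, mq, mr])
    rw [Fin.sum_univ_three] at this
    simp only [Matrix.cons_val_zero, Matrix.cons_val_one, Matrix.cons_val_two, Matrix.head_cons,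
      Matrix.tail_cons] at this
    rw [hw, ← add_assoc]
    exact this

/-- The second coordinate of the point over `x` of the line through `p` and `q`. -/
def lineHeight (p q : ℂ) (x : ℝ) : ℝ := p.im + (q.im - p.im) / (q.re - p.re) * (x - p.re)

theorem continuous_lineHeight (p q : ℂ) : Continuous (lineHeight p q) := by
  unfold lineHeight; fun_prop

theorem signedArea_eq_mul_sub_lineHeight {p q : ℂ} (h : p.re < q.re) (w : ℂ) :
    signedArea p q w = (q.re - p.re) * (w.im - lineHeight p q w.re) := by
  have : q.re - p.re ≠ 0 := (sub_pos.2 h).ne'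
  unfold signedArea lineHeight
  field_simp
  ring

/-- A chord between points strictly above a convex graph stays strictly above it; this keeps the
square roots in the edge integrals positive. -/
theorem sq_lt_lineHeight {p q : ℂ} (hp : p.re ^ 2 < p.im) (hq : q.re ^ 2 < q.im) (h : p.re < q.re)
    {x : ℝ} (hx : x ∈ Icc p.re q.re) : x ^ 2 < lineHeight p q x := by
  have h' : 0 < q.re - p.re := sub_pos.2 h
  have h1 : 0 ≤ x - p.re := sub_nonneg.2 hx.1
  have h2 : 0 ≤ q.re - x := sub_nonneg.2 hx.2
  have e : (q.re - p.re) * lineHeight p q x = (q.re - x) * p.im + (x - p.re) * q.im := by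
    unfold lineHeight
    field_simp
    ring
  apply lt_of_mul_lt_mul_left _ h'.le
  rw [e]
  -- At the left end the weight of q vanishes, so strictness must come from p; elsewhere it comes
  -- from q.
  rcases h1.eq_or_lt with h3 | h3
  · have hxp : x = p.re := by linarith
    rw [hxp]
    nlinarith
  · nlinarith [mul_nonneg h2 (sub_nonneg.2 hp.le), mul_pos h3 (sub_pos.2 hq), mul_nonneg h1 h2,
      mul_nonneg (mul_nonneg h1 h2) h'.le]

/-- The integral of the reciprocal of the Euclidean height along a geodesic. -/
def edgeIntegral (p q : ℂ) : ℝ := ∫ x in p.re..q.re, 1 / √(lineHeight p q x - x ^ 2)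

/-- In the half-plane the side is an arc of a circle centred on the real axis, and half the slope of
the chord is its centre c. With y the height, the slope of the arc is (c - x) / y; its arctangent is
the direction of the tangent and has derivative -1 / y. -/
theorem edgeIntegral_eq {p q : ℂ} (hp : p.re ^ 2 < p.im) (hq : q.re ^ 2 < q.im)
    (h : p.re < q.re) : edgeIntegral p q =
      Real.arctan (((q.im - p.im) / (q.re - p.re) / 2 - p.re) / √(p.im - p.re ^ 2)) -
      Real.arctan (((q.im - p.im) / (q.re - p.re) / 2 - q.re) / √(q.im - q.re ^ 2)) := by
  set c := (q.im - p.im) / (q.re - p.re) / 2 with hc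
  have hpos : ∀ x ∈ Icc p.re q.re, 0 < lineHeight p q x - x ^ 2 := fun x hx =>
    sub_pos.2 (sq_lt_lineHeight hp hq h hx)
  have hq' : lineHeight p q q.re = q.im := by
    have : q.re - p.re ≠ 0 := (sub_pos.2 h).ne'
    unfold lineHeight; field_simp; ring
  have hp' : lineHeight p q p.re = p.im := by unfold lineHeight; ring
  have hderiv : ∀ x ∈ Icc p.re q.re, HasDerivAt
      (fun x => -Real.arctan ((c - x) / √(lineHeight p q x - x ^ 2)))
      (1 / √(lineHeight p q x - x ^ 2)) x := by
    intro x hx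
    have h0 := hpos x hx
    have d1 : HasDerivAt (fun x => lineHeight p q x - x ^ 2) (2 * (c - x)) x := by
      have e1 : HasDerivAt (fun x => lineHeight p q x) (2 * c) x := by
        have := (((hasDerivAt_id x).sub_const p.re).const_mul
          ((q.im - p.im) / (q.re - p.re))).const_add p.im
        convert! this using 1
        rw [hc]; ring
      have := e1.sub (hasDerivAt_pow 2 x)
      convert! this using 1
      simp; ring
    have d2 := d1.sqrt h0.ne'
    have hs : 0 < √(lineHeight p q x - x ^ 2) := Real.sqrt_pos.2 h0
    have d3 := (((hasDerivAt_id x).const_sub c).div d2 hs.ne').arctan.neg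
    convert! d3 using 1
    simp only [id, Pi.div_apply]
    set s := √(lineHeight p q x - x ^ 2)
    field_simp
    ring
  have hint : IntervalIntegrable (fun x => 1 / √(lineHeight p q x - x ^ 2)) volume p.re q.re := by
    apply ContinuousOn.intervalIntegrable
    rw [uIcc_of_le h.le]
    apply continuousOn_const.div
    · exact (((continuous_lineHeight p q).sub (continuous_pow 2)).sqrt).continuousOn
    · exact fun x hx => (Real.sqrt_pos.2 (hpos x hx)).ne'
  rw [edgeIntegral, intervalIntegral.integral_eq_sub_of_hasDerivAt
    (by rw [uIcc_of_le h.le]; exact hderiv) hint, hp', hq']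
  ring

theorem edgeIntegral_of_re_eq {p q : ℂ} (h : p.re = q.re) : edgeIntegral p q = 0 := by
  rw [edgeIntegral, h, intervalIntegral.integral_same]

/-! ### Tangent directions along sides and angle sums of triangles -/

namespace UpperHalfPlane

/-- The lexicographic order on the upper half-plane. -/
def LexLT (A B : UpperHalfPlane) : Prop := A.re < B.re ∨ (A.re = B.re ∧ A.im < B.im)

/-- Traversing a side in lexicographic order gives forward tangents at both ends with arguments in
(-π/2, π/2]. The second coordinate breaks the tie for vertical sides, whose forward tangents then
point up. -/
theorem LexLT.isRightward {A B : UpperHalfPlane} (h : LexLT A B) :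
    IsRightward (tangentVec A B) ∧ IsRightward (-tangentVec B A) := by
  have := A.im_pos
  have := B.im_pos
  unfold IsRightward
  rw [Complex.neg_re, Complex.neg_im, tangentVec_re, tangentVec_re, tangentVec_im, tangentVec_im]
  rcases h with h | ⟨h, h'⟩
  · refine ⟨.inl (div_pos (sub_pos.2 h) B.im_pos), .inl ?_⟩
    rw [← neg_div, neg_sub]
    exact div_pos (sub_pos.2 h) A.im_pos
  · rw [h]
    have h2 : 0 < B.im ^ 2 - A.im ^ 2 := by nlinarith
    refine ⟨.inr ⟨by simp, ?_⟩, .inr ⟨by simp, ?_⟩⟩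
    · apply div_pos (by simpa using h2) (by positivity)
    · rw [← neg_div]
      apply div_pos (by simpa using h2) (by positivity)

theorem parab_sq_lt (A : UpperHalfPlane) : (parab A).re ^ 2 < (parab A).im := parab_mem A

/-- The edge integral measures how far the forward tangent turns from A to B. On a vertical side the
interval of integration is a point and the tangent does not turn. -/
theorem LexLT.edgeIntegral_eq {A B : UpperHalfPlane} (h : LexLT A B) :
    edgeIntegral (parab A) (parab B) = (tangentVec A B).arg - (-tangentVec B A).arg := by
  have hA := A.im_pos
  have hB := B.im_pos
  rcases h with h | ⟨h, h'⟩
  · rw [_root_.edgeIntegral_eq (parab_sq_lt A) (parab_sq_lt B) h]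
    have r := LexLT.isRightward (.inl h)
    have h1 : 0 < (tangentVec A B).re := by
      rw [tangentVec_re]; exact div_pos (sub_pos.2 h) hB
    have h2 : 0 < (-tangentVec B A).re := by
      rw [Complex.neg_re, tangentVec_re, ← neg_div, neg_sub]; exact div_pos (sub_pos.2 h) hA
    rw [IsRightward.arg_eq_arctan h1, IsRightward.arg_eq_arctan h2, Complex.neg_re, Complex.neg_im,
      tangentVec_re, tangentVec_re, tangentVec_im, tangentVec_im]
    simp only [parab_re, parab_im, add_sub_cancel_left, Real.sqrt_sq hA.le, Real.sqrt_sq hB.le]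
    have : B.re - A.re ≠ 0 := (sub_pos.2 h).ne'
    have : A.re - B.re ≠ 0 := (sub_neg.2 h).ne
    congr 2 <;> field_simp <;> ring
  · have r := LexLT.isRightward (.inr ⟨h, h'⟩)
    rw [edgeIntegral_of_re_eq (p := parab A) (q := parab B) h, eq_comm, sub_eq_zero]
    apply le_antisymm
    · apply r.1.arg_le_arg r.2
      simp [tangentVec_re, h]
    · apply r.2.arg_le_arg r.1
      simp [tangentVec_re, h]

/-- Orientation at A agrees with orientation in the chart up to a positive factor, so the sign of
one signed area orders the tangent directions at all three vertices. -/
theorem cross_tangentVec (A B C : UpperHalfPlane) :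
    (tangentVec A B).re * (tangentVec A C).im - (tangentVec A B).im * (tangentVec A C).re =
      signedArea (parab A) (parab B) (parab C) / (2 * A.im * B.im * C.im) := by
  have := A.im_pos.ne'
  have := B.im_pos.ne'
  have := C.im_pos.ne'
  rw [tangentVec_re, tangentVec_re, tangentVec_im, tangentVec_im, signedArea]
  simp only [parab_re, parab_im]
  field_simp
  ring

/-- The angle at `A` of the hyperbolic triangle `(A, B, C)`. -/
def triangleAngle (A B C : UpperHalfPlane) : ℝ :=
  InnerProductGeometry.angle (tangentVec A B) (tangentVec A C)

theorem triangleAngle_comm (A B C : UpperHalfPlane) : triangleAngle A B C = triangleAngle A C B :=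
  InnerProductGeometry.angle_comm _ _

/-- Here B lies on the chord AC or to its left. The angles at the extreme vertices are differences
of arguments of forward tangents, and the one at B is the supplement of such a difference;
regrouping the six arguments by sides gives the edge integrals. -/
theorem sum_angles_eq {A B C : UpperHalfPlane} (hAB : LexLT A B) (hBC : LexLT B C)
    (hAC : LexLT A C) (h : 0 ≤ signedArea (parab A) (parab C) (parab B)) :
    triangleAngle A B C + triangleAngle B C A + triangleAngle C A B = Real.pi +
      edgeIntegral (parab A) (parab B) + edgeIntegral (parab B) (parab C) -
      edgeIntegral (parab A) (parab C) := by
  have := A.im_pos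
  have := B.im_pos
  have := C.im_pos
  rw [hAB.edgeIntegral_eq, hBC.edgeIntegral_eq, hAC.edgeIntegral_eq]
  have hA : triangleAngle A B C = (tangentVec A B).arg - (tangentVec A C).arg := by
    rw [triangleAngle, hAB.isRightward.1.angle_eq hAC.isRightward.1, abs_of_nonneg]
    apply sub_nonneg.2
    apply hAC.isRightward.1.arg_le_arg hAB.isRightward.1
    rw [cross_tangentVec]
    positivity
  have hB : triangleAngle B C A =
      Real.pi - ((-tangentVec B A).arg - (tangentVec B C).arg) := by
    have e := InnerProductGeometry.angle_neg_right (tangentVec B C) (-tangentVec B A)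
    rw [neg_neg, InnerProductGeometry.angle_comm (tangentVec B C) (-tangentVec B A)] at e
    rw [triangleAngle, e,
      hAB.isRightward.2.angle_eq hBC.isRightward.1, abs_of_nonneg]
    apply sub_nonneg.2
    apply hBC.isRightward.1.arg_le_arg hAB.isRightward.2
    have e2 := cross_tangentVec B A C
    have : signedArea (parab B) (parab A) (parab C) = signedArea (parab A) (parab C) (parab B) := by
      unfold signedArea; ring
    rw [this] at e2
    have h3 : 0 ≤ signedArea (parab A) (parab C) (parab B) / (2 * B.im * A.im * C.im) := by
      positivity
    rw [Complex.neg_re, Complex.neg_im]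
    linarith
  have hC : triangleAngle C A B = (-tangentVec C A).arg - (-tangentVec C B).arg := by
    rw [triangleAngle, ← InnerProductGeometry.angle_neg_neg,
      hAC.isRightward.2.angle_eq hBC.isRightward.2, abs_of_nonneg]
    apply sub_nonneg.2
    apply hBC.isRightward.2.arg_le_arg hAC.isRightward.2
    have e2 := cross_tangentVec C B A
    have : signedArea (parab C) (parab B) (parab A) = signedArea (parab A) (parab C) (parab B) := by
      unfold signedArea; ring
    rw [this] at e2
    have h3 : 0 ≤ signedArea (parab A) (parab C) (parab B) / (2 * C.im * B.im * A.im) := by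
      positivity
    simp only [Complex.neg_re, Complex.neg_im]
    linarith
  rw [hA, hB, hC]
  ring

/-- The mirror case, with B on the chord AC or to its right: every difference of arguments changes
sign. -/
theorem sum_angles_eq' {A B C : UpperHalfPlane} (hAB : LexLT A B) (hBC : LexLT B C)
    (hAC : LexLT A C) (h : 0 ≤ signedArea (parab A) (parab B) (parab C)) :
    triangleAngle A B C + triangleAngle B C A + triangleAngle C A B = Real.pi -
      edgeIntegral (parab A) (parab B) - edgeIntegral (parab B) (parab C) +
      edgeIntegral (parab A) (parab C) := by
  have := A.im_pos
  have := B.im_pos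
  have := C.im_pos
  rw [hAB.edgeIntegral_eq, hBC.edgeIntegral_eq, hAC.edgeIntegral_eq]
  have hA : triangleAngle A B C = (tangentVec A C).arg - (tangentVec A B).arg := by
    rw [triangleAngle, hAB.isRightward.1.angle_eq hAC.isRightward.1, abs_of_nonpos, neg_sub]
    apply sub_nonpos.2
    apply hAB.isRightward.1.arg_le_arg hAC.isRightward.1
    rw [cross_tangentVec]
    positivity
  have hB : triangleAngle B C A =
      Real.pi - ((tangentVec B C).arg - (-tangentVec B A).arg) := by
    have e := InnerProductGeometry.angle_neg_right (tangentVec B C) (-tangentVec B A)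
    rw [neg_neg, InnerProductGeometry.angle_comm (tangentVec B C) (-tangentVec B A)] at e
    rw [triangleAngle, e,
      hAB.isRightward.2.angle_eq hBC.isRightward.1, abs_of_nonpos, neg_sub]
    apply sub_nonpos.2
    apply hAB.isRightward.2.arg_le_arg hBC.isRightward.1
    have e2 := cross_tangentVec B C A
    have : signedArea (parab B) (parab C) (parab A) = signedArea (parab A) (parab B) (parab C) := by
      unfold signedArea; ring
    rw [this] at e2
    have h3 : 0 ≤ signedArea (parab A) (parab B) (parab C) / (2 * B.im * C.im * A.im) := by
      positivity
    rw [Complex.neg_re, Complex.neg_im]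
    linarith
  have hC : triangleAngle C A B = (-tangentVec C B).arg - (-tangentVec C A).arg := by
    rw [triangleAngle, ← InnerProductGeometry.angle_neg_neg,
      hAC.isRightward.2.angle_eq hBC.isRightward.2, abs_of_nonpos, neg_sub]
    apply sub_nonpos.2
    apply hAC.isRightward.2.arg_le_arg hBC.isRightward.2
    have e2 := cross_tangentVec C A B
    have : signedArea (parab C) (parab A) (parab B) = signedArea (parab A) (parab B) (parab C) := by
      unfold signedArea; ring
    rw [this] at e2
    have h3 : 0 ≤ signedArea (parab A) (parab B) (parab C) / (2 * C.im * A.im * B.im) := by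
      positivity
    simp only [Complex.neg_re, Complex.neg_im]
    linarith
  rw [hA, hB, hC]
  ring

end UpperHalfPlane

/-! ### Hyperbolic area of regions between graphs -/

theorem setLIntegral_inv_sq {a b : ℝ} (ha : 0 < a) (hab : a ≤ b) :
    ∫⁻ y in Icc a b, ENNReal.ofReal (1 / y ^ 2) = ENNReal.ofReal (1 / a - 1 / b) := by
  have hpos : ∀ y ∈ Icc a b, 0 < y := fun y hy => ha.trans_le hy.1
  have hcont : ContinuousOn (fun y : ℝ => 1 / y ^ 2) (Icc a b) :=
    continuousOn_const.div (continuous_pow 2).continuousOn fun y hy => (pow_pos (hpos y hy) 2).ne'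
  rw [← ofReal_integral_eq_lintegral_ofReal hcont.integrableOn_Icc
    (Eventually.of_forall fun y => by positivity), integral_Icc_eq_integral_Ioc,
    ← intervalIntegral.integral_of_le hab]
  congr 1
  have hd : ∀ y ∈ uIcc a b, HasDerivAt (fun y : ℝ => -y⁻¹) (1 / y ^ 2) y := by
    intro y hy
    rw [uIcc_of_le hab] at hy
    have := (hasDerivAt_inv (hpos y hy).ne').neg
    convert! this using 1
    rw [neg_neg, one_div]
  rw [intervalIntegral.integral_eq_sub_of_hasDerivAt hd
    (by apply ContinuousOn.intervalIntegrable; rwa [uIcc_of_le hab])]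
  rw [one_div, one_div]
  ring

theorem Complex.lintegral_eq_lintegral_lintegral {f : ℂ → ENNReal} (hf : Measurable f) :
    ∫⁻ z, f z = ∫⁻ x : ℝ, ∫⁻ y : ℝ, f ⟨x, y⟩ := by
  rw [← (Complex.volume_preserving_equiv_real_prod.symm).lintegral_comp_emb
    Complex.measurableEquivRealProd.symm.measurableEmbedding, Measure.volume_eq_prod,
    lintegral_prod]
  · rfl
  · exact (hf.comp Complex.measurableEquivRealProd.symm.measurable).aemeasurable

namespace UpperHalfPlane

/-- The hyperbolic area of a region between two graphs in the chart `parab`. -/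
theorem volume_region {a c : ℝ} (hac : a ≤ c) {lo up : ℝ → ℝ} (hlo : Continuous lo)
    (hup : Continuous up) (h1 : ∀ x ∈ Icc a c, x ^ 2 < lo x) (h2 : ∀ x ∈ Icc a c, lo x ≤ up x) :
    volume {z : UpperHalfPlane | z.re ∈ Icc a c ∧ lo z.re ≤ (parab z).im ∧
      (parab z).im ≤ up z.re} = ENNReal.ofReal ((∫ x in a..c, 1 / √(lo x - x ^ 2)) -
        ∫ x in a..c, 1 / √(up x - x ^ 2)) := by
  -- The second chart coordinate is x² + y², so g and h are the boundary graphs read in the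
  -- half-plane itself, where the density is 1 / y².
  set g : ℝ → ℝ := fun x => √(lo x - x ^ 2) with hg
  set h : ℝ → ℝ := fun x => √(up x - x ^ 2) with hh
  have hgc : Continuous g := (hlo.sub (continuous_pow 2)).sqrt
  have hhc : Continuous h := (hup.sub (continuous_pow 2)).sqrt
  have hgpos : ∀ x ∈ Icc a c, 0 < g x := fun x hx => Real.sqrt_pos.2 (sub_pos.2 (h1 x hx))
  have hgh : ∀ x ∈ Icc a c, g x ≤ h x := fun x hx => Real.sqrt_le_sqrt (by linarith [h2 x hx])
  have himg : UpperHalfPlane.coe '' {z : UpperHalfPlane | z.re ∈ Icc a c ∧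
      lo z.re ≤ (parab z).im ∧ (parab z).im ≤ up z.re} =
      {w : ℂ | w.re ∈ Icc a c ∧ g w.re ≤ w.im ∧ w.im ≤ h w.re} := by
    have key : ∀ x y : ℝ, 0 < y → x ∈ Icc a c →
        ((lo x ≤ x ^ 2 + y ^ 2 ∧ x ^ 2 + y ^ 2 ≤ up x) ↔ (g x ≤ y ∧ y ≤ h x)) := by
      intro x y hy hx
      rw [hg, hh]
      simp only
      rw [Real.sqrt_le_left hy.le, Real.le_sqrt hy.le (by linarith [h1 x hx, h2 x hx])]
      constructor <;> rintro ⟨h3, h4⟩ <;> constructor <;> linarith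
    ext w
    constructor
    · rintro ⟨z, ⟨hz1, hz2⟩, rfl⟩
      exact ⟨hz1, (key z.re z.im z.im_pos hz1).1 hz2⟩
    · rintro ⟨hw1, hw2⟩
      have hw : 0 < w.im := (hgpos _ hw1).trans_le hw2.1
      exact ⟨⟨w, hw⟩, ⟨hw1, (key w.re w.im hw hw1).2 hw2⟩, rfl⟩
  have hclosed : IsClosed {w : ℂ | w.re ∈ Icc a c ∧ g w.re ≤ w.im ∧ w.im ≤ h w.re} :=
    (isClosed_Icc.preimage Complex.continuous_re).inter
      ((isClosed_le (hgc.comp Complex.continuous_re) Complex.continuous_im).inter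
        (isClosed_le Complex.continuous_im (hhc.comp Complex.continuous_re)))
  have hmeas : Measurable fun z : ℂ => ENNReal.ofReal (1 / z.im ^ 2) := by fun_prop
  have hfun : (fun z : ℂ => (((1 / ‖z.im‖₊) ^ 2 : NNReal) : ENNReal)) =
      fun z : ℂ => ENNReal.ofReal (1 / z.im ^ 2) := by
    funext z
    rw [ENNReal.ofReal, ENNReal.coe_inj]
    apply NNReal.coe_injective
    rw [Real.coe_toNNReal _ (by positivity)]
    simp
  rw [volume_eq_lintegral, himg, hfun, ← lintegral_indicator hclosed.measurableSet,
    Complex.lintegral_eq_lintegral_lintegral (hmeas.indicator hclosed.measurableSet)]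
  have hinner : ∀ x : ℝ, ∫⁻ y : ℝ, indicator {w : ℂ | w.re ∈ Icc a c ∧ g w.re ≤ w.im ∧ w.im ≤ h w.re}
      (fun z : ℂ => ENNReal.ofReal (1 / z.im ^ 2)) ⟨x, y⟩ =
      (Icc a c).indicator (fun x => ENNReal.ofReal (1 / g x - 1 / h x)) x := by
    intro x
    by_cases hx : x ∈ Icc a c
    · rw [indicator_of_mem hx, ← setLIntegral_inv_sq (hgpos x hx) (hgh x hx),
        ← lintegral_indicator measurableSet_Icc]
      congr 1
      funext y
      simp only [indicator, mem_ofPred_eq, mem_Icc, mem_Icc.1 hx, true_and, and_self]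
    · rw [indicator_of_notMem hx]
      simp only [indicator, mem_ofPred_eq, hx, false_and, if_false, lintegral_zero]
  rw [lintegral_congr hinner, lintegral_indicator measurableSet_Icc]
  have hhpos : ∀ x ∈ Icc a c, 0 < h x := fun x hx => (hgpos x hx).trans_le (hgh x hx)
  have cg : ContinuousOn (fun x => 1 / g x) (Icc a c) :=
    continuousOn_const.div hgc.continuousOn fun x hx => (hgpos x hx).ne'
  have ch : ContinuousOn (fun x => 1 / h x) (Icc a c) :=
    continuousOn_const.div hhc.continuousOn fun x hx => (hhpos x hx).ne'
  rw [← ofReal_integral_eq_lintegral_ofReal, integral_Icc_eq_integral_Ioc,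
    ← intervalIntegral.integral_of_le hac, intervalIntegral.integral_sub]
  · apply ContinuousOn.intervalIntegrable; rwa [uIcc_of_le hac]
  · apply ContinuousOn.intervalIntegrable; rwa [uIcc_of_le hac]
  · exact (cg.sub ch).integrableOn_Icc
  · rw [EventuallyLE, ae_restrict_iff' measurableSet_Icc]
    refine Eventually.of_forall fun x hx => ?_
    have := hgpos x hx
    have := hgh x hx
    rw [Pi.zero_apply, sub_nonneg]
    gcongr

theorem intervalIntegrable_one_div_sqrt {a c : ℝ} (hac : a ≤ c) {lo : ℝ → ℝ} (hlo : Continuous lo)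
    (h1 : ∀ x ∈ Icc a c, x ^ 2 < lo x) :
    IntervalIntegrable (fun x => 1 / √(lo x - x ^ 2)) volume a c := by
  apply ContinuousOn.intervalIntegrable
  rw [uIcc_of_le hac]
  exact continuousOn_const.div (hlo.sub (continuous_pow 2)).sqrt.continuousOn
    fun x hx => (Real.sqrt_pos.2 (sub_pos.2 (h1 x hx))).ne'

/-- The hyperbolic area of the triangle `(A, B, C)`. -/
def triangleArea (A B C : UpperHalfPlane) : ℝ :=
  (volume (geodesicHull {A, B, C})).toReal

theorem mem_geodesicHull_triple {A B C z : UpperHalfPlane} : z ∈ geodesicHull {A, B, C} ↔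
    parab z ∈ convexHull ℝ {parab A, parab B, parab C} := by
  rw [geodesicHull_eq, image_insert_eq, image_insert_eq, image_singleton, mem_preimage]

/-- Used for the broken boundary of a triangle, a minimum or maximum of two lines that switches at
the middle vertex. -/
theorem integral_split {a b c : ℝ} (hab : a ≤ b) (hbc : b ≤ c) {f p q : ℝ → ℝ}
    (hf : Continuous f) (h1 : ∀ x ∈ Icc a c, x ^ 2 < f x) (hp : ∀ x ∈ Icc a b, f x = p x)
    (hq : ∀ x ∈ Icc b c, f x = q x) : ∫ x in a..c, 1 / √(f x - x ^ 2) =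
      (∫ x in a..b, 1 / √(p x - x ^ 2)) + ∫ x in b..c, 1 / √(q x - x ^ 2) := by
  rw [← intervalIntegral.integral_add_adjacent_intervals
    (intervalIntegrable_one_div_sqrt hab hf fun x hx => h1 x ⟨hx.1, hx.2.trans hbc⟩)
    (intervalIntegrable_one_div_sqrt hbc hf fun x hx => h1 x ⟨hab.trans hx.1, hx.2⟩)]
  congr 1
  · refine intervalIntegral.integral_congr fun x hx => ?_
    rw [uIcc_of_le hab] at hx
    simp only [hp x hx]
  · refine intervalIntegral.integral_congr fun x hx => ?_
    rw [uIcc_of_le hbc] at hx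
    simp only [hq x hx]

theorem toReal_ofReal_sub_of_le {S : Set UpperHalfPlane} {u v : ℝ}
    (h : volume S = ENNReal.ofReal (u - v)) (huv : v ≤ u) : (volume S).toReal = u - v := by
  rw [h, ENNReal.toReal_ofReal (sub_nonneg.2 huv)]

/-- The region bounded below by the line `lo` and above by `up` has area the difference of the
edge integrals. -/
theorem area_region {S : Set UpperHalfPlane} {a c : ℝ} (hac : a ≤ c) {lo up : ℝ → ℝ}
    (hlo : Continuous lo) (hup : Continuous up) (h1 : ∀ x ∈ Icc a c, x ^ 2 < lo x)
    (h2 : ∀ x ∈ Icc a c, lo x ≤ up x) (hS : ∀ z, z ∈ S ↔ z.re ∈ Icc a c ∧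
      lo z.re ≤ (parab z).im ∧ (parab z).im ≤ up z.re) :
    (volume S).toReal = (∫ x in a..c, 1 / √(lo x - x ^ 2)) -
      ∫ x in a..c, 1 / √(up x - x ^ 2) := by
  have e : S = {z : UpperHalfPlane | z.re ∈ Icc a c ∧ lo z.re ≤ (parab z).im ∧
      (parab z).im ≤ up z.re} := by ext z; exact hS z
  refine toReal_ofReal_sub_of_le (e ▸ volume_region hac hlo hup h1 h2) ?_
  apply intervalIntegral.integral_mono_on hac
    (intervalIntegrable_one_div_sqrt hac hup fun x hx => (h1 x hx).trans_le (h2 x hx))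
    (intervalIntegrable_one_div_sqrt hac hlo h1)
  intro x hx
  have h3 := h1 x hx
  have h4 := h2 x hx
  have : 0 < √(lo x - x ^ 2) := Real.sqrt_pos.2 (sub_pos.2 h3)
  gcongr

/-- Two side lines through a common vertex differ in height by a multiple of the horizontal distance
to it, with a factor whose sign is that of the signed area. This and the next two identities decide
which lines bound the triangle over each abscissa. -/
theorem lineHeight_sub_right {p q r : ℂ} (h1 : q.re < r.re) (h2 : p.re < r.re) (x : ℝ) :
    lineHeight q r x - lineHeight p r x =
      signedArea p r q / ((r.re - q.re) * (r.re - p.re)) * (r.re - x) := by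
  have := (sub_pos.2 h1).ne'
  have := (sub_pos.2 h2).ne'
  unfold lineHeight signedArea
  field_simp
  ring

theorem lineHeight_sub_left {p q r : ℂ} (h1 : p.re < q.re) (h2 : p.re < r.re) (x : ℝ) :
    lineHeight p q x - lineHeight p r x =
      signedArea p r q / ((q.re - p.re) * (r.re - p.re)) * (x - p.re) := by
  have := (sub_pos.2 h1).ne'
  have := (sub_pos.2 h2).ne'
  unfold lineHeight signedArea
  field_simp
  ring

theorem lineHeight_sub_mid {p q r : ℂ} (h1 : p.re < q.re) (h2 : q.re < r.re) (x : ℝ) :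
    lineHeight q r x - lineHeight p q x =
      signedArea p r q / ((q.re - p.re) * (r.re - q.re)) * (q.re - x) := by
  have := (sub_pos.2 h1).ne'
  have := (sub_pos.2 h2).ne'
  unfold lineHeight signedArea
  field_simp
  ring

theorem signedArea_nonneg_iff {p q w : ℂ} (h : p.re < q.re) :
    0 ≤ signedArea p q w ↔ lineHeight p q w.re ≤ w.im := by
  rw [signedArea_eq_mul_sub_lineHeight h, mul_nonneg_iff_of_pos_left (sub_pos.2 h), sub_nonneg]

theorem signedArea_rev (p q w : ℂ) : signedArea q p w = -signedArea p q w := by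
  unfold signedArea; ring

theorem signedArea_rev_nonneg_iff {p q w : ℂ} (h : p.re < q.re) :
    0 ≤ signedArea q p w ↔ w.im ≤ lineHeight p q w.re := by
  rw [signedArea_rev, signedArea_eq_mul_sub_lineHeight h, ← mul_neg,
    mul_nonneg_iff_of_pos_left (sub_pos.2 h), neg_sub, sub_nonneg]

theorem LexLT.re_le {A B : UpperHalfPlane} (h : LexLT A B) : (parab A).re ≤ (parab B).re :=
  h.elim le_of_lt fun h => h.1.le

theorem LexLT.parab_im_lt {A B : UpperHalfPlane} (h : LexLT A B)
    (e : (parab A).re = (parab B).re) : (parab A).im < (parab B).im := by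
  rcases h with h1 | ⟨h1, h2⟩
  · exact absurd e h1.ne
  · simp only [parab_im, h1]
    have := A.im_pos
    nlinarith

/-- With B to the left of AC, the triangle lies over the chord AC and under the two other sides,
that is, under the minimum of their lines. -/
theorem area_above {A B C : UpperHalfPlane} (hAB : LexLT A B) (hBC : LexLT B C)
    (h : 0 < signedArea (parab A) (parab C) (parab B)) : triangleArea A B C =
      edgeIntegral (parab A) (parab C) - edgeIntegral (parab A) (parab B) -
        edgeIntegral (parab B) (parab C) := by
  have pA := parab_sq_lt A
  have pB := parab_sq_lt B
  have pC := parab_sq_lt C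
  have mem : ∀ z, z ∈ geodesicHull {A, B, C} ↔
      parab z ∈ convexHull ℝ {parab A, parab C, parab B} := by
    intro z; rw [mem_geodesicHull_triple, pair_comm (parab B)]
  have hab' := hAB.re_le
  have hbc' := hBC.re_le
  have hAI := hAB.parab_im_lt
  have hBI := hBC.parab_im_lt
  unfold triangleArea
  simp only [mem_convexHull_triple_iff h] at mem
  set p := parab A
  set q := parab B
  set r := parab C
  -- If BC were vertical, then B would lie below C and the signed area could not be positive. Only
  -- the side AB can be vertical.
  have hbc : q.re < r.re := by
    rcases hbc'.lt_or_eq with h1 | h1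
    · exact h1
    · have := hBI h1
      unfold signedArea at h
      rw [← h1] at h
      nlinarith
  have hac : p.re < r.re := hab'.trans_lt hbc
  have hlo : ∀ x ∈ Icc p.re r.re, x ^ 2 < lineHeight p r x :=
    fun x hx => sq_lt_lineHeight pA pC hac hx
  have s1 := sub_pos.2 hbc
  have s2 := sub_pos.2 hac
  have R := lineHeight_sub_right (p := p) hbc hac
  have k1 : 0 < signedArea p r q / ((r.re - q.re) * (r.re - p.re)) := by positivity
  rcases hab'.lt_or_eq with hab | hab
  · have s3 := sub_pos.2 hab
    have L := lineHeight_sub_left (r := r) hab hac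
    have N := lineHeight_sub_mid hab hbc
    have k2 : 0 < signedArea p r q / ((q.re - p.re) * (r.re - p.re)) := by positivity
    have k3 : 0 < signedArea p r q / ((q.re - p.re) * (r.re - q.re)) := by positivity
    have hlu : ∀ x ∈ Icc p.re r.re, lineHeight p r x ≤ min (lineHeight p q x) (lineHeight q r x) := by
      intro x hx
      apply le_min
      · have := mul_nonneg k2.le (sub_nonneg.2 hx.1)
        linarith [L x]
      · have := mul_nonneg k1.le (sub_nonneg.2 hx.2)
        linarith [R x]
    rw [area_region hac.le (continuous_lineHeight p r)
      ((continuous_lineHeight p q).min (continuous_lineHeight q r)) hlo hlu,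
      integral_split hab' hbc' ((continuous_lineHeight p q).min (continuous_lineHeight q r))
        (fun x hx => (hlo x hx).trans_le (hlu x hx)) (p := lineHeight p q) (q := lineHeight q r),
      edgeIntegral, edgeIntegral, edgeIntegral]
    · ring
    · intro x hx
      have := mul_nonneg k3.le (sub_nonneg.2 hx.2)
      exact min_eq_left (by linarith [N x])
    · intro x hx
      have := mul_nonneg k3.le (sub_nonneg.2 hx.1)
      exact min_eq_right (by linarith [N x])
    · intro z
      rw [mem, signedArea_nonneg_iff hac, signedArea_rev_nonneg_iff hab,
        signedArea_rev_nonneg_iff hbc, le_min_iff]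
      constructor
      · rintro ⟨h1, h2, h3⟩
        -- The bounds on the abscissa come for free: left of A the line AB runs below AC, and right
        -- of C so does BC.
        refine ⟨⟨?_, ?_⟩, h1, h3, h2⟩
        · by_contra! hlt
          have := mul_pos k2 (sub_pos.2 hlt)
          have := L (parab z).re
          simp only [parab_re] at *
          linarith
        · by_contra! hlt
          have := mul_pos k1 (sub_pos.2 hlt)
          have := R (parab z).re
          simp only [parab_re] at *
          linarith
      · rintro ⟨-, h1, h3, h2⟩
        exact ⟨h1, h2, h3⟩
  -- Vertical side AB: its half-plane condition becomes the left bound on the abscissa, and its edge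
  -- integral is zero.
  · have hlu : ∀ x ∈ Icc p.re r.re, lineHeight p r x ≤ lineHeight q r x := by
      intro x hx
      have := mul_nonneg k1.le (sub_nonneg.2 hx.2)
      linarith [R x]
    rw [area_region hac.le (continuous_lineHeight p r) (continuous_lineHeight q r) hlo hlu,
      edgeIntegral_of_re_eq hab, edgeIntegral, edgeIntegral, sub_zero, hab]
    intro z
    have e : signedArea q p (parab z) = (q.im - p.im) * ((parab z).re - p.re) := by
      unfold signedArea; rw [hab]; ring
    rw [mem, signedArea_nonneg_iff hac, signedArea_rev_nonneg_iff hbc, e,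
      mul_nonneg_iff_of_pos_left (sub_pos.2 (hAI hab)), sub_nonneg]
    constructor
    · rintro ⟨h1, h2, h3⟩
      refine ⟨⟨h3, ?_⟩, h1, h2⟩
      by_contra! hlt
      have := mul_pos k1 (sub_pos.2 hlt)
      have := R (parab z).re
      simp only [parab_re] at *
      linarith
    · rintro ⟨h3, h1, h2⟩
      exact ⟨h1, h2, h3.1⟩

/-- With B to the right of AC, the chord AC is the upper boundary and the maximum of the two other
lines the lower one; now only BC can be vertical. -/
theorem area_below {A B C : UpperHalfPlane} (hAB : LexLT A B) (hBC : LexLT B C)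
    (h : 0 < signedArea (parab A) (parab B) (parab C)) : triangleArea A B C =
      edgeIntegral (parab A) (parab B) + edgeIntegral (parab B) (parab C) -
        edgeIntegral (parab A) (parab C) := by
  have pA := parab_sq_lt A
  have pB := parab_sq_lt B
  have pC := parab_sq_lt C
  have mem : ∀ z, z ∈ geodesicHull {A, B, C} ↔
      parab z ∈ convexHull ℝ {parab A, parab B, parab C} := fun z => mem_geodesicHull_triple
  have hab' := hAB.re_le
  have hbc' := hBC.re_le
  have hAI := hAB.parab_im_lt
  have hBI := hBC.parab_im_lt
  unfold triangleArea
  simp only [mem_convexHull_triple_iff h] at mem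
  set p := parab A
  set q := parab B
  set r := parab C
  have hneg : signedArea p r q = -signedArea p q r := by unfold signedArea; ring
  have hab : p.re < q.re := by
    rcases hab'.lt_or_eq with h1 | h1
    · exact h1
    · have := hAI h1
      unfold signedArea at h
      rw [← h1] at h
      nlinarith
  have hac : p.re < r.re := hab.trans_le hbc'
  have s1 := sub_pos.2 hab
  have s2 := sub_pos.2 hac
  have L := lineHeight_sub_left (r := r) hab hac
  have k1 : 0 < signedArea p q r / ((q.re - p.re) * (r.re - p.re)) := by positivity
  rw [hneg, neg_div] at L
  rcases hbc'.lt_or_eq with hbc | hbc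
  · have s3 := sub_pos.2 hbc
    have R := lineHeight_sub_right (p := p) hbc hac
    have N := lineHeight_sub_mid hab hbc
    rw [hneg, neg_div] at R N
    have k2 : 0 < signedArea p q r / ((r.re - q.re) * (r.re - p.re)) := by positivity
    have k3 : 0 < signedArea p q r / ((q.re - p.re) * (r.re - q.re)) := by positivity
    have hlo : ∀ x ∈ Icc p.re r.re, x ^ 2 < max (lineHeight p q x) (lineHeight q r x) := by
      intro x hx
      rcases le_total x q.re with h1 | h1
      · exact (sq_lt_lineHeight pA pB hab ⟨hx.1, h1⟩).trans_le (le_max_left _ _)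
      · exact (sq_lt_lineHeight pB pC hbc ⟨h1, hx.2⟩).trans_le (le_max_right _ _)
    have hlu : ∀ x ∈ Icc p.re r.re, max (lineHeight p q x) (lineHeight q r x) ≤ lineHeight p r x := by
      intro x hx
      apply max_le
      · have := mul_nonneg k1.le (sub_nonneg.2 hx.1)
        linarith [L x]
      · have := mul_nonneg k2.le (sub_nonneg.2 hx.2)
        linarith [R x]
    rw [area_region hac.le ((continuous_lineHeight p q).max (continuous_lineHeight q r))
      (continuous_lineHeight p r) hlo hlu,
      integral_split hab' hbc' ((continuous_lineHeight p q).max (continuous_lineHeight q r))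
        hlo (p := lineHeight p q) (q := lineHeight q r), edgeIntegral, edgeIntegral, edgeIntegral]
    · intro x hx
      have := mul_nonneg k3.le (sub_nonneg.2 hx.2)
      exact max_eq_left (by linarith [N x])
    · intro x hx
      have := mul_nonneg k3.le (sub_nonneg.2 hx.1)
      exact max_eq_right (by linarith [N x])
    · intro z
      rw [mem, signedArea_rev_nonneg_iff hac, signedArea_nonneg_iff hab,
        signedArea_nonneg_iff hbc, max_le_iff]
      constructor
      · rintro ⟨h1, h2, h3⟩
        refine ⟨⟨?_, ?_⟩, ⟨h1, h2⟩, h3⟩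
        · by_contra! hlt
          have := mul_pos k1 (sub_pos.2 hlt)
          have := L (parab z).re
          simp only [parab_re] at *
          linarith
        · by_contra! hlt
          have := mul_pos k2 (sub_pos.2 hlt)
          have := R (parab z).re
          simp only [parab_re] at *
          linarith
      · rintro ⟨-, ⟨h1, h2⟩, h3⟩
        exact ⟨h1, h2, h3⟩
  -- Vertical side BC: its half-plane condition becomes the right bound on the abscissa.
  · have hlo : ∀ x ∈ Icc p.re r.re, x ^ 2 < lineHeight p q x := by
      intro x hx
      rw [← hbc] at hx
      exact sq_lt_lineHeight pA pB hab hx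
    have hlu : ∀ x ∈ Icc p.re r.re, lineHeight p q x ≤ lineHeight p r x := by
      intro x hx
      have := mul_nonneg k1.le (sub_nonneg.2 hx.1)
      linarith [L x]
    rw [area_region hac.le (continuous_lineHeight p q) (continuous_lineHeight p r) hlo hlu,
      edgeIntegral_of_re_eq hbc, edgeIntegral, edgeIntegral, add_zero, hbc]
    intro z
    have e : signedArea q r (parab z) = (r.im - q.im) * (r.re - (parab z).re) := by
      unfold signedArea; rw [hbc]; ring
    rw [mem, signedArea_nonneg_iff hab, signedArea_rev_nonneg_iff hac, e,
      mul_nonneg_iff_of_pos_left (sub_pos.2 (hBI hbc)), sub_nonneg]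
    constructor
    · rintro ⟨h1, h2, h3⟩
      refine ⟨⟨?_, h2⟩, h1, h3⟩
      by_contra! hlt
      have := mul_pos k1 (sub_pos.2 hlt)
      have := L (parab z).re
      simp only [parab_re] at *
      linarith
    · rintro ⟨h3, h1, h2⟩
      exact ⟨h1, h3.2, h2⟩

/-- The hull of collinear points is contained in a convex region between two graphs with equal
integrals, which is a null set. The upper and lower graphs are both the line AC, unless that line is
vertical. -/
theorem area_degenerate {A B C : UpperHalfPlane} (hAB : LexLT A B) (hBC : LexLT B C)
    (h : signedArea (parab A) (parab C) (parab B) = 0) : triangleArea A B C = 0 := by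
  have pA := parab_sq_lt A
  have pC := parab_sq_lt C
  have hab' := hAB.re_le
  have hbc' := hBC.re_le
  have hAI := hAB.parab_im_lt
  have hBI := hBC.parab_im_lt
  unfold triangleArea
  have key : ∀ {lo up : ℝ → ℝ}, Continuous lo → Continuous up →
      (∀ x ∈ Icc A.re C.re, x ^ 2 < lo x) → (∀ x ∈ Icc A.re C.re, lo x ≤ up x) →
      (∫ x in A.re..C.re, 1 / √(lo x - x ^ 2)) = (∫ x in A.re..C.re, 1 / √(up x - x ^ 2)) →
      Convex ℝ {w : ℂ | w.re ∈ Icc A.re C.re ∧ lo w.re ≤ w.im ∧ w.im ≤ up w.re} →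
      (∀ P ∈ ({A, B, C} : Set UpperHalfPlane), P.re ∈ Icc A.re C.re ∧ lo P.re ≤ (parab P).im ∧
        (parab P).im ≤ up P.re) → (volume (geodesicHull {A, B, C})).toReal = 0 := by
    intro lo up hlo hup h1 h2 h3 hc hP
    have hsub : geodesicHull {A, B, C} ⊆ {z : UpperHalfPlane | z.re ∈ Icc A.re C.re ∧
        lo z.re ≤ (parab z).im ∧ (parab z).im ≤ up z.re} := by
      rw [geodesicHull_eq]
      intro z hz
      have : parab '' {A, B, C} ⊆
          {w : ℂ | w.re ∈ Icc A.re C.re ∧ lo w.re ≤ w.im ∧ w.im ≤ up w.re} := by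
        rintro _ ⟨P, hPm, rfl⟩
        exact hP P hPm
      exact convexHull_min this hc hz
    have hv := volume_region (hab'.trans hbc') hlo hup h1 h2
    simp only [parab_re, h3, sub_self, ENNReal.ofReal_zero] at hv
    rw [measure_mono_null hsub hv, ENNReal.toReal_zero]
  rcases (hab'.trans hbc').lt_or_eq with hac | hac
  · refine key (continuous_lineHeight (parab A) (parab C)) (continuous_lineHeight _ _)
      (fun x hx => sq_lt_lineHeight pA pC hac hx) (fun x _ => le_rfl) rfl ?_ ?_
    · have : {w : ℂ | w.re ∈ Icc A.re C.re ∧ lineHeight (parab A) (parab C) w.re ≤ w.im ∧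
          w.im ≤ lineHeight (parab A) (parab C) w.re} =
          {w : ℂ | w.re ∈ Icc A.re C.re ∧ signedArea (parab A) (parab C) w = 0} := by
        ext w
        rw [mem_ofPred_eq, mem_ofPred_eq, signedArea_eq_mul_sub_lineHeight hac, mul_eq_zero,
          or_iff_right (sub_pos.2 hac).ne', sub_eq_zero, le_antisymm_iff (a := w.im)]
        tauto
      rw [this]
      let M : ℂ →ₗ[ℝ] ℝ := ((parab C).re - (parab A).re) • Complex.imLm -
        ((parab C).im - (parab A).im) • Complex.reLm
      have e : {w : ℂ | w.re ∈ Icc A.re C.re ∧ signedArea (parab A) (parab C) w = 0} =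
          (Complex.reLm ⁻¹' (Icc A.re C.re)) ∩ {w | M w = M (parab A)} := by
        ext w
        simp only [mem_ofPred_eq, signedArea, M, LinearMap.sub_apply, LinearMap.smul_apply,
          Complex.imLm_coe, Complex.reLm_coe, smul_eq_mul, mem_inter_iff, mem_preimage]
        refine and_congr_right fun _ => ?_
        constructor <;> intro h <;> linarith
      rw [e]
      exact ((convex_Icc A.re C.re).linear_preimage Complex.reLm).inter
        (convex_hyperplane M.isLinear _)
    · have hL : ∀ w : ℂ, signedArea (parab A) (parab C) w = 0 →
          lineHeight (parab A) (parab C) w.re = w.im := by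
        intro w hw
        rw [signedArea_eq_mul_sub_lineHeight hac, mul_eq_zero,
          or_iff_right (sub_pos.2 hac).ne'] at hw
        linarith
      have z1 : signedArea (parab A) (parab C) (parab A) = 0 := by unfold signedArea; ring
      have z2 : signedArea (parab A) (parab C) (parab C) = 0 := by unfold signedArea; ring
      rintro P (rfl | rfl | rfl)
      · exact ⟨⟨le_rfl, hac.le⟩, (hL _ z1).le, (hL _ z1).ge⟩
      · exact ⟨⟨hab', hbc'⟩, (hL _ h).le, (hL _ h).ge⟩
      · exact ⟨⟨hac.le, le_rfl⟩, (hL _ z2).le, (hL _ z2).ge⟩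
  · have e1 : (parab A).re = (parab B).re := le_antisymm hab' (hac ▸ hbc')
    have e2 : (parab B).re = (parab C).re := e1 ▸ hac
    have i1 := hAI e1
    have i2 := hBI e2
    -- All three points on a vertical line: the region has width zero, so constant bounds suffice.
    refine key (lo := fun _ => (parab A).im) (up := fun _ => (parab C).im) continuous_const
      continuous_const ?_ (fun _ _ => (i1.trans i2).le) ?_ ?_ ?_
    · intro x hx
      have : x = A.re := le_antisymm (hx.2.trans_eq hac.symm) hx.1
      rw [this]; exact pA
    · rw [show A.re = C.re from hac, intervalIntegral.integral_same, intervalIntegral.integral_same]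
    · exact ((convex_Icc A.re C.re).linear_preimage Complex.reLm).inter
        ((convex_Icc (parab A).im (parab C).im).linear_preimage Complex.imLm)
    · rintro P (rfl | rfl | rfl)
      · exact ⟨⟨le_rfl, hac.le⟩, le_rfl, (i1.trans i2).le⟩
      · exact ⟨⟨hab', hbc'⟩, i1.le, i2.le⟩
      · exact ⟨⟨hac.le, le_rfl⟩, (i1.trans i2).le, le_rfl⟩

theorem LexLT.trans {A B C : UpperHalfPlane} (h : LexLT A B) (h' : LexLT B C) : LexLT A C := by
  unfold LexLT at *
  grind

theorem lexLT_or_lexLT {A B : UpperHalfPlane} (h : A ≠ B) : LexLT A B ∨ LexLT B A := by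
  have : ¬ (A.re = B.re ∧ A.im = B.im) := fun e => h (UpperHalfPlane.ext (Complex.ext e.1 e.2))
  unfold LexLT
  grind

/-- The area and the angle sum involve the same combination of edge integrals. For collinear points
the two angle formulas both apply, and averaging them gives angle sum π. -/
theorem triangleArea_of_lexLT {A B C : UpperHalfPlane} (hAB : LexLT A B) (hBC : LexLT B C) :
    triangleArea A B C =
      Real.pi - (triangleAngle A B C + triangleAngle B C A + triangleAngle C A B) := by
  have hAC := hAB.trans hBC
  have hneg : signedArea (parab A) (parab B) (parab C) =
    -signedArea (parab A) (parab C) (parab B) := by unfold signedArea; ring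
  rcases lt_trichotomy (signedArea (parab A) (parab C) (parab B)) 0 with h | h | h
  · have h' : 0 < signedArea (parab A) (parab B) (parab C) := by rw [hneg]; linarith
    rw [area_below hAB hBC h', sum_angles_eq' hAB hBC hAC h'.le]
    ring
  · have e1 := sum_angles_eq hAB hBC hAC h.ge
    have e2 := sum_angles_eq' hAB hBC hAC (by rw [hneg, h, neg_zero])
    rw [area_degenerate hAB hBC h]
    linarith
  · rw [area_above hAB hBC h, sum_angles_eq hAB hBC hAC h.le]
    ring

theorem triangleArea_rotate (A B C : UpperHalfPlane) : triangleArea A B C = triangleArea B C A := by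
  unfold triangleArea
  rw [insert_comm, pair_comm A C]

theorem triangleArea_swap (A B C : UpperHalfPlane) : triangleArea A B C = triangleArea A C B := by
  unfold triangleArea
  rw [pair_comm]

/-- The area of a hyperbolic triangle, degenerate or not, is its angle defect. -/
theorem triangleArea_eq {A B C : UpperHalfPlane} (hAB : A ≠ B) (hBC : B ≠ C) (hCA : C ≠ A) :
    triangleArea A B C =
      Real.pi - (triangleAngle A B C + triangleAngle B C A + triangleAngle C A B) := by
  have first : ∀ {A B C : UpperHalfPlane}, B ≠ C → LexLT A B → LexLT A C → triangleArea A B C =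
      Real.pi - (triangleAngle A B C + triangleAngle B C A + triangleAngle C A B) := by
    intro A B C hBC hAB hAC
    rcases lexLT_or_lexLT hBC with h | h
    · exact triangleArea_of_lexLT hAB h
    · rw [triangleArea_swap, triangleArea_of_lexLT hAC h, triangleAngle_comm A, triangleAngle_comm B,
        triangleAngle_comm C]
      ring
  rcases lexLT_or_lexLT hAB with h1 | h1 <;> rcases lexLT_or_lexLT hBC with h2 | h2 <;>
    rcases lexLT_or_lexLT hCA with h3 | h3
  -- This cyclic order is impossible, but no contradiction is needed, since two of the relations
  -- suffice.
  · exact triangleArea_of_lexLT h1 h2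
  · exact triangleArea_of_lexLT h1 h2
  · rw [triangleArea_rotate, triangleArea_rotate, first hAB h3 h2]; ring
  · exact first hBC h1 h3
  · rw [triangleArea_rotate, first hCA h2 h1]; ring
  · rw [triangleArea_rotate, first hCA h2 h1]; ring
  · rw [triangleArea_rotate, triangleArea_rotate, first hAB h3 h2]; ring
  -- The cyclic order A < C < B < A, excluded by transitivity and irreflexivity.
  · exact first hBC (h3.trans (h2.trans h1)|>.elim (fun h => absurd h (lt_irrefl _)) (fun h => absurd h.2 (lt_irrefl _))) h3

end UpperHalfPlane

/-! ### Totally geodesic maps of the hyperbolic plane are locally isometric -/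

theorem eVariationOn_congr_edist {α X Y : Type*} [LinearOrder α] [PseudoEMetricSpace X]
    [PseudoEMetricSpace Y] {f : α → X} {g : α → Y}
    (h : ∀ s t, edist (f s) (f t) = edist (g s) (g t)) (A : Set α) :
    eVariationOn f A = eVariationOn g A := by
  unfold eVariationOn
  simp only [h]

namespace UpperHalfPlane

/-- The geodesic segment from `x` to `y`, parametrized linearly in the chart `parab`. -/
def geodesicPoint (x y : UpperHalfPlane) (s : unitInterval) : UpperHalfPlane :=
  unparab (AffineMap.lineMap (parab x) (parab y) (s : ℝ))
    (convex_aboveParabola.lineMap_mem (parab_mem x) (parab_mem y) s.2)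

theorem parab_geodesicPoint (x y : UpperHalfPlane) (s : unitInterval) :
    parab (geodesicPoint x y s) = AffineMap.lineMap (parab x) (parab y) (s : ℝ) :=
  parab_unparab _ _

theorem continuous_geodesicPoint (x y : UpperHalfPlane) : Continuous (geodesicPoint x y) := by
  rw [isEmbedding_coe.continuous_iff]
  have h : Continuous fun s : unitInterval =>
      (AffineMap.lineMap (parab x) (parab y) (s : ℝ) : ℂ) := by fun_prop
  have h1 := Complex.continuous_re.comp h
  have h2 := Complex.continuous_im.comp h
  have h3 := (h2.sub (h1.pow 2)).sqrt
  have : (UpperHalfPlane.coe ∘ geodesicPoint x y) = fun s : unitInterval =>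
      Complex.equivRealProdCLM.symm ((AffineMap.lineMap (parab x) (parab y) (s : ℝ) : ℂ).re,
        √((AffineMap.lineMap (parab x) (parab y) (s : ℝ) : ℂ).im -
          (AffineMap.lineMap (parab x) (parab y) (s : ℝ) : ℂ).re ^ 2)) := by
    funext s
    apply Complex.ext <;> rfl
  rw [this]
  exact Complex.equivRealProdCLM.symm.continuous.comp (h1.prodMk h3)

theorem geodesicPoint_mem (x y : UpperHalfPlane) (s : unitInterval) :
    geodesicPoint x y s ∈ metricSegment x y := by
  rw [mem_metricSegment_iff, parab_geodesicPoint, segment_eq_image_lineMap]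
  exact mem_image_of_mem _ s.2

theorem geodesicPoint_zero (x y : UpperHalfPlane) : geodesicPoint x y 0 = x := by
  apply parab_injective
  simp [parab_geodesicPoint]

theorem geodesicPoint_one (x y : UpperHalfPlane) : geodesicPoint x y 1 = y := by
  apply parab_injective
  simp [parab_geodesicPoint]

theorem dist_geodesicPoint (x y : UpperHalfPlane) {s t : unitInterval} (h : s ≤ t) :
    dist x (geodesicPoint x y s) + dist (geodesicPoint x y s) (geodesicPoint x y t) =
      dist x (geodesicPoint x y t) := by
  change geodesicPoint x y s ∈ metricSegment x (geodesicPoint x y t)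
  rw [mem_metricSegment_iff, parab_geodesicPoint, parab_geodesicPoint, mem_segment_iff_wbtw]
  have : Wbtw ℝ (0 : ℝ) (s : ℝ) (t : ℝ) := by
    rw [wbtw_iff_of_le t.2.1]; exact ⟨s.2.1, h⟩
  have := this.map (AffineMap.lineMap (parab x) (parab y))
  simpa using this

/-- Distances along the segment are differences of the distance to x, a monotone real function, and
the variation of such a function is its total increase. -/
theorem eVariationOn_geodesicPoint (x y : UpperHalfPlane) :
    eVariationOn (geodesicPoint x y) univ ≤ edist x y := by
  have hd : ∀ s t : unitInterval, s ≤ t → dist (geodesicPoint x y s) (geodesicPoint x y t) =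
      dist x (geodesicPoint x y t) - dist x (geodesicPoint x y s) :=
    fun s t h => by linarith [dist_geodesicPoint x y h]
  have hmono : MonotoneOn (fun s => dist x (geodesicPoint x y s)) univ := by
    intro s _ t _ h
    have := hd s t h
    have h2 := dist_nonneg (x := geodesicPoint x y s) (y := geodesicPoint x y t)
    simp only
    linarith
  rw [eVariationOn_congr_edist (g := fun s => dist x (geodesicPoint x y s))]
  · have := hmono.eVariationOn_eq (a := 0) (b := 1) (mem_univ _) (mem_univ _)
    have hI : (univ ∩ Icc 0 1 : Set unitInterval) = univ := by
      ext s; simp [unitInterval.le_one']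
    rw [hI, geodesicPoint_zero, geodesicPoint_one, dist_self, sub_zero] at this
    exact this.le.trans_eq (edist_dist x y).symm
  · intro s t
    rw [edist_dist, edist_dist]
    congr 1
    rcases le_total s t with h | h
    · have h1 := hd s t h
      have h2 := dist_nonneg (x := geodesicPoint x y s) (y := geodesicPoint x y t)
      rw [h1, Real.dist_eq, abs_of_nonpos (by linarith)]
      ring
    · have h1 := hd t s h
      have h2 := dist_nonneg (x := geodesicPoint x y t) (y := geodesicPoint x y s)
      rw [dist_comm, h1, Real.dist_eq, abs_of_nonneg (by linarith)]

end UpperHalfPlane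

section LocalIsometry

variable {M : Type*} [MetricSpace M]

theorem HypChart.continuous_of_comp {Y : Type*} [TopologicalSpace Y] (φ : HypChart M)
    {g : Y → M} (hs : ∀ y, g y ∈ φ.source) (hc : Continuous fun y => φ.toFun (g y)) :
    Continuous g := by
  have h : Continuous fun y => (⟨g y, hs y⟩ : φ.source) := by
    rw [φ.isEmbedding.continuous_iff]
    exact hc
  exact continuous_subtype_val.comp h

theorem edist_le_edist_iff_dist_le {X Y : Type*} [PseudoMetricSpace X] [PseudoMetricSpace Y]
    {x x' : X} {y y' : Y} : edist x x' ≤ edist y y' ↔ dist x x' ≤ dist y y' := by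
  rw [edist_dist, edist_dist, ENNReal.ofReal_le_ofReal_iff dist_nonneg]

/-- Lengths of paths agree in M and in a chart. The image of a geodesic segment therefore has the
length of the segment, which bounds the distance in M from above. Conversely, a path in M between
the image points either stays in the chart, where it is no shorter than the distance between its
ends in `Hyp3`, or it is too long to matter; as M is a length space, this bounds the distance from
below. -/
theorem HypAtlas.IsTotallyGeodesicOn.exists_isometric_near {A : HypAtlas M}
    (hL : IsLengthMetric M) {ι : UpperHalfPlane → M} {D : Set UpperHalfPlane}
    (hD : ∀ x ∈ D, ∀ y ∈ D, metricSegment x y ⊆ D) (h : A.IsTotallyGeodesicOn ι D)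
    {p : UpperHalfPlane} (hp : p ∈ D) : ∃ δ > 0, ∀ x ∈ D, ∀ y ∈ D, dist p x < δ → dist p y < δ →
      dist (ι x) (ι y) = dist x y := by
  obtain ⟨φ, hφ, hpφ, e, he, hev⟩ := h p hp
  obtain ⟨δ₀, hδ₀, hδ⟩ := Metric.mem_nhdsWithin_iff.1 hev
  have hloc : ∀ x ∈ D, dist p x < δ₀ → ι x ∈ φ.source ∧ φ.toFun (ι x) = e x := fun x hx hd =>
    hδ ⟨by rwa [Metric.mem_ball, dist_comm], hx⟩
  -- A segment between points within δ₀ / 3 of p stays within δ₀ / 3 + 2δ₀ / 3 of p.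
  have hupper : ∀ x ∈ D, ∀ y ∈ D, dist p x < δ₀ / 3 → dist p y < δ₀ / 3 →
      edist (ι x) (ι y) ≤ edist x y := by
    intro x hx y hy hpx hpy
    have hγ : ∀ s, UpperHalfPlane.geodesicPoint x y s ∈ D ∧
        dist p (UpperHalfPlane.geodesicPoint x y s) < δ₀ := by
      intro s
      have hs := UpperHalfPlane.geodesicPoint_mem x y s
      refine ⟨hD x hx y hy hs, ?_⟩
      have h1 : dist x (UpperHalfPlane.geodesicPoint x y s) +
        dist (UpperHalfPlane.geodesicPoint x y s) y = dist x y := hs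
      have h2 := dist_triangle_left x y p
      have h3 := dist_triangle p x (UpperHalfPlane.geodesicPoint x y s)
      have h4 := dist_nonneg (x := UpperHalfPlane.geodesicPoint x y s) (y := y)
      linarith
    have hsrc : ∀ s, ι (UpperHalfPlane.geodesicPoint x y s) ∈ φ.source := fun s =>
      (hloc _ (hγ s).1 (hγ s).2).1
    have hφι : ∀ s, φ.toFun (ι (UpperHalfPlane.geodesicPoint x y s)) =
        e (UpperHalfPlane.geodesicPoint x y s) := fun s => (hloc _ (hγ s).1 (hγ s).2).2
    have hcont : Continuous fun s => ι (UpperHalfPlane.geodesicPoint x y s) := by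
      apply φ.continuous_of_comp hsrc
      simp only [hφι]
      exact he.continuous.comp (UpperHalfPlane.continuous_geodesicPoint x y)
    have hlen := A.length_eq φ hφ ⟨_, hcont⟩ hsrc
    simp only [ContinuousMap.coe_mk, hφι] at hlen
    rw [eVariationOn_congr_edist (g := UpperHalfPlane.geodesicPoint x y)
      (fun s t => he.edist_eq _ _)] at hlen
    calc edist (ι x) (ι y) = edist (ι (UpperHalfPlane.geodesicPoint x y 0))
          (ι (UpperHalfPlane.geodesicPoint x y 1)) := by
          rw [UpperHalfPlane.geodesicPoint_zero, UpperHalfPlane.geodesicPoint_one]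
      _ ≤ eVariationOn (fun s => ι (UpperHalfPlane.geodesicPoint x y s)) univ :=
          eVariationOn.edist_le _ (mem_univ _) (mem_univ _)
      _ = eVariationOn (UpperHalfPlane.geodesicPoint x y) univ := hlen.symm
      _ ≤ edist x y := UpperHalfPlane.eVariationOn_geodesicPoint x y
  obtain ⟨r, hr, hrs⟩ := Metric.isOpen_iff.1 φ.isOpen_source _ hpφ
  -- A path of length below r / 2 that starts within r / 4 of the centre stays in the ball of radius
  -- r inside the chart, and a longer one exceeds the distance from x to y, which is below r / 4 + r
  -- / 4.
  refine ⟨min (δ₀ / 3) (r / 4), by positivity, fun x hx y hy hpx hpy => ?_⟩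
  rw [lt_min_iff] at hpx hpy
  have hle := hupper x hx y hy hpx.1 hpy.1
  have hxp := hupper p hp x hx (by rw [dist_self]; positivity) hpx.1
  rw [edist_le_edist_iff_dist_le] at hxp
  refine le_antisymm (edist_le_edist_iff_dist_le.1 hle) (edist_le_edist_iff_dist_le.1 ?_)
  rw [hL (ι x) (ι y)]
  refine le_iInf fun γ => ?_
  by_cases hγ : eVariationOn γ univ < ENNReal.ofReal (r / 2)
  · have hsrc : ∀ s, γ s ∈ φ.source := by
      intro s
      apply hrs
      have h1 : edist (γ s) (γ 0) < ENNReal.ofReal (r / 2) :=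
        (eVariationOn.edist_le _ (mem_univ _) (mem_univ _)).trans_lt hγ
      rw [γ.source, edist_lt_ofReal] at h1
      rw [Metric.mem_ball]
      have := dist_triangle (γ s) (ι x) (ι p)
      rw [dist_comm (ι x)] at this
      linarith
    have hlen := A.length_eq φ hφ γ.toContinuousMap hsrc
    have h2 : edist (φ.toFun (γ 0)) (φ.toFun (γ 1)) ≤
        eVariationOn (fun s => φ.toFun (γ s)) univ :=
      eVariationOn.edist_le (fun s => φ.toFun (γ s)) (mem_univ _) (mem_univ _)
    rw [γ.source, γ.target, (hloc x hx (by linarith)).2, (hloc y hy (by linarith)).2,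
      he.edist_eq] at h2
    exact h2.trans hlen.le
  · refine le_trans ?_ (not_lt.1 hγ)
    rw [edist_dist]
    apply ENNReal.ofReal_le_ofReal
    have := dist_triangle_left x y p
    linarith

end LocalIsometry

/-! ### Angles, areas and images of the triangles of a surface -/

namespace HyperbolicSurface

variable {E T M : Type*} [NormedAddCommGroup E] [NormedSpace ℝ E] [Fintype T] [MetricSpace M]
  (S : HyperbolicSurface E T)

theorem corner_mem_cell (t : T) (i : Fin 3) : S.corner t i ∈ S.cell t :=
  subset_convexHull ℝ _ (mem_range_self i)

theorem segment_subset_cell (t : T) (i j : Fin 3) :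
    segment ℝ (S.corner t i) (S.corner t j) ⊆ S.cell t :=
  (convex_convexHull ℝ _).segment_subset (S.corner_mem_cell t i) (S.corner_mem_cell t j)

theorem lineMap_mem_segment {a b : E} {s : ℝ} (hs : s ∈ Icc (0 : ℝ) 1) :
    AffineMap.lineMap a b s ∈ segment ℝ a b := by
  rw [segment_eq_image_lineMap]
  exact mem_image_of_mem _ hs

theorem dev_lineMap_mem (t : T) {i j : Fin 3} (h : i ≠ j) {s : ℝ} (hs : s ∈ Icc (0 : ℝ) 1) :
    S.dev t (AffineMap.lineMap (S.corner t i) (S.corner t j) s) ∈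
      metricSegment (S.dev t (S.corner t i)) (S.dev t (S.corner t j)) :=
  (S.dev_edge t i j h).mapsTo (lineMap_mem_segment hs)

theorem dev_lineMap_ne (t : T) {i j : Fin 3} (h : i ≠ j) {s : ℝ} (hs : s ∈ Ioc (0 : ℝ) 1) :
    S.dev t (AffineMap.lineMap (S.corner t i) (S.corner t j) s) ≠ S.dev t (S.corner t i) := by
  intro e
  have := (S.dev_edge t i j h).injOn (lineMap_mem_segment (Ioc_subset_Icc_self hs))
    (left_mem_segment ℝ _ _) e
  rw [AffineMap.lineMap_eq_left_iff] at this
  rcases this with h1 | h1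
  · exact h (S.corner_injective t h1)
  · exact hs.1.ne' h1

theorem dev_corner_ne (t : T) {i j : Fin 3} (h : i ≠ j) :
    S.dev t (S.corner t i) ≠ S.dev t (S.corner t j) := by
  have := S.dev_lineMap_ne t h (s := 1) (by simp)
  rw [AffineMap.lineMap_apply_one] at this
  exact this.symm

theorem continuousOn_dev_lineMap (t : T) (i j : Fin 3) : ContinuousOn
    (fun s : ℝ => S.dev t (AffineMap.lineMap (S.corner t i) (S.corner t j) s)) (Icc 0 1) :=
  (S.dev_continuousOn t).comp (by fun_prop) fun _ hs =>
    S.segment_subset_cell t i j (lineMap_mem_segment hs)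

theorem isArc_dev (t : T) {i j : Fin 3} (h : i ≠ j) :
    IsArc fun s : ℝ => S.dev t (AffineMap.lineMap (S.corner t i) (S.corner t j) s) :=
  ⟨1, one_pos, S.continuousOn_dev_lineMap t i j, fun s hs => by
    simpa only [AffineMap.lineMap_apply_zero] using S.dev_lineMap_ne t h hs⟩

theorem upperAngle_dev (t : T) {i j k : Fin 3} (hj : i ≠ j) (hk : i ≠ k) :
    upperAngle (fun s : ℝ => S.dev t (AffineMap.lineMap (S.corner t i) (S.corner t j) s))
      (fun s : ℝ => S.dev t (AffineMap.lineMap (S.corner t i) (S.corner t k) s)) =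
    UpperHalfPlane.triangleAngle (S.dev t (S.corner t i)) (S.dev t (S.corner t j))
      (S.dev t (S.corner t k)) := by
  have h := UpperHalfPlane.tendsto_comparisonAngle_sides (A := S.dev t (S.corner t j))
    (B := S.dev t (S.corner t k)) (S.isArc_dev t hj) (S.isArc_dev t hk)
    (P := S.dev t (S.corner t i))
    (by simp only [AffineMap.lineMap_apply_zero]) (by simp only [AffineMap.lineMap_apply_zero])
    (fun s hs => S.dev_lineMap_mem t hj (Ioc_subset_Icc_self hs))
    (fun s hs => S.dev_lineMap_mem t hk (Ioc_subset_Icc_self hs))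
  exact upperAngle_eq_of_tendsto h

theorem angle_eq (t : T) {i j k : Fin 3} (hj : i ≠ j) (hk : i ≠ k) (hjk : j ≠ k) :
    S.angle t i = UpperHalfPlane.triangleAngle (S.dev t (S.corner t i)) (S.dev t (S.corner t j))
      (S.dev t (S.corner t k)) := by
  have h1 : i ≠ i + 1 := by fin_cases i <;> decide
  have h2 : i ≠ i + 2 := by fin_cases i <;> decide
  rw [angle, S.upperAngle_dev t h1 h2]
  have : (j = i + 1 ∧ k = i + 2) ∨ (j = i + 2 ∧ k = i + 1) := by
    revert i j k; decide
  rcases this with ⟨rfl, rfl⟩ | ⟨rfl, rfl⟩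
  · rfl
  · rw [UpperHalfPlane.triangleAngle_comm]

theorem volume_model (t : T) :
    (volume (S.model t)).toReal = Real.pi - ∑ i, S.angle t i := by
  have hr : (range fun i => S.dev t (S.corner t i)) = {S.dev t (S.corner t 0),
      S.dev t (S.corner t 1), S.dev t (S.corner t 2)} := by
    ext x; simp [Fin.exists_fin_succ, eq_comm]
  rw [model, hr, Fin.sum_univ_three]
  change UpperHalfPlane.triangleArea _ _ _ = _
  rw [UpperHalfPlane.triangleArea_eq (S.dev_corner_ne t (by decide))
    (S.dev_corner_ne t (by decide)) (S.dev_corner_ne t (by decide)),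
    S.angle_eq t (i := 0) (j := 1) (k := 2) (by decide) (by decide) (by decide),
    S.angle_eq t (i := 1) (j := 2) (k := 0) (by decide) (by decide) (by decide),
    S.angle_eq t (i := 2) (j := 0) (k := 1) (by decide) (by decide) (by decide)]

theorem area_eq : S.area = Fintype.card T * Real.pi - ∑ t, ∑ i, S.angle t i := by
  simp [area, S.volume_model, Finset.sum_sub_distrib]

theorem angle_nonneg (t : T) (i : Fin 3) : 0 ≤ S.angle t i := upperAngle_nonneg _ _

theorem metricSegment_subset_model (t : T) {x y : UpperHalfPlane} (hx : x ∈ S.model t)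
    (hy : y ∈ S.model t) : metricSegment x y ⊆ S.model t := by
  intro z hz C hC
  exact hC.2 x (hx C hC) y (hy C hC) hz

theorem dev_mem_model (t : T) {x : E} (hx : x ∈ S.cell t) : S.dev t x ∈ S.model t := by
  rw [model, ← S.dev_image t]
  exact mem_image_of_mem _ hx

theorem IsTriangulatedMap.exists_isometric_near {S : HyperbolicSurface E T} {A : HypAtlas M}
    {f : E → M} (hL : IsLengthMetric M) (hf : S.IsTriangulatedMap A f) (t : T) {p : E}
    (hp : p ∈ S.cell t) : ∃ δ > 0, ∀ x ∈ S.cell t, ∀ y ∈ S.cell t,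
      dist (S.dev t p) (S.dev t x) < δ → dist (S.dev t p) (S.dev t y) < δ →
      dist (f x) (f y) = dist (S.dev t x) (S.dev t y) := by
  obtain ⟨ι, hι, hfι⟩ := hf t
  obtain ⟨δ, hδ, H⟩ := hι.exists_isometric_near hL
    (fun x hx y hy => S.metricSegment_subset_model t hx hy) (S.dev_mem_model t hp)
  refine ⟨δ, hδ, fun x hx y hy h1 h2 => ?_⟩
  rw [hfι x hx, hfι y hy]
  exact H _ (S.dev_mem_model t hx) _ (S.dev_mem_model t hy) h1 h2

theorem IsTriangulatedMap.continuousOn {S : HyperbolicSurface E T} {A : HypAtlas M}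
    {f : E → M} (hL : IsLengthMetric M) (hf : S.IsTriangulatedMap A f) (t : T) :
    ContinuousOn f (S.cell t) := by
  intro p hp
  obtain ⟨δ, hδ, H⟩ := hf.exists_isometric_near hL t hp
  have h1 : Tendsto (S.dev t) (𝓝[S.cell t] p) (𝓝 (S.dev t p)) := S.dev_continuousOn t p hp
  have h2 : Tendsto (fun x => dist (S.dev t x) (S.dev t p)) (𝓝[S.cell t] p) (𝓝 0) := by
    simpa using h1.dist (tendsto_const_nhds (x := S.dev t p))
  rw [ContinuousWithinAt, tendsto_iff_dist_tendsto_zero]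
  refine h2.congr' ?_
  have h3 := h1.eventually (Metric.ball_mem_nhds _ hδ)
  filter_upwards [h3, self_mem_nhdsWithin] with x hx hxc
  rw [dist_comm] at hx
  exact (H x hxc p hp hx (by rwa [dist_self])).symm

/-- Near a corner, f has the same mutual distances as the developed triangle, so all small
comparison angles in M and in the hyperbolic plane coincide. -/
theorem IsTriangulatedMap.isArc_and_upperAngle {S : HyperbolicSurface E T} {A : HypAtlas M}
    {f : E → M} (hL : IsLengthMetric M) (hf : S.IsTriangulatedMap A f) (t : T) {i j k : Fin 3}
    (hj : i ≠ j) (hk : i ≠ k) (hjk : j ≠ k) :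
    IsArc (fun s : ℝ => f (AffineMap.lineMap (S.corner t i) (S.corner t j) s)) ∧
    upperAngle (fun s : ℝ => f (AffineMap.lineMap (S.corner t i) (S.corner t j) s))
      (fun s : ℝ => f (AffineMap.lineMap (S.corner t i) (S.corner t k) s)) = S.angle t i := by
  have hp := S.corner_mem_cell t i
  obtain ⟨δ, hδ, H⟩ := hf.exists_isometric_near hL t hp
  have hseg : ∀ j, ∀ s ∈ Icc (0 : ℝ) 1,
      AffineMap.lineMap (S.corner t i) (S.corner t j) s ∈ S.cell t := fun j s hs =>
    S.segment_subset_cell t i j (lineMap_mem_segment hs)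
  have hnear : ∀ j, i ≠ j → ∀ᶠ s in 𝓝[>] (0 : ℝ), s ∈ Ioc (0 : ℝ) 1 ∧ dist (S.dev t (S.corner t i))
      (S.dev t (AffineMap.lineMap (S.corner t i) (S.corner t j) s)) < δ := by
    intro j hj
    have h1 := (S.isArc_dev t hj).tendsto.eventually (Metric.ball_mem_nhds _ hδ)
    filter_upwards [h1, Ioc_mem_nhdsGT one_pos] with s hs hs'
    rw [AffineMap.lineMap_apply_zero, dist_comm] at hs
    exact ⟨hs', hs⟩
  constructor
  · obtain ⟨δ', hδ', H'⟩ := (nhdsGT_basis (0 : ℝ)).eventually_iff.1 (hnear j hj)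
    refine ⟨min (δ' / 2) 1, by positivity, ?_, ?_⟩
    · refine (hf.continuousOn hL t).comp (by fun_prop) fun s hs => hseg j s ⟨hs.1, ?_⟩
      exact hs.2.trans (min_le_right _ _)
    · intro s hs
      have hs2 := (le_min_iff.1 hs.2).1
      obtain ⟨h1, h2⟩ := H' (x := s) ⟨hs.1, by linarith⟩
      simp only [AffineMap.lineMap_apply_zero]
      rw [← dist_pos, H _ (hseg j s (Ioc_subset_Icc_self h1)) _ hp h2
        (by rwa [dist_self]), dist_pos]
      exact S.dev_lineMap_ne t hj h1
  · rw [S.angle_eq t hj hk hjk, ← S.upperAngle_dev t hj hk]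
    apply upperAngle_congr
    filter_upwards [(hnear j hj).prod_mk (hnear k hk)] with z hz
    obtain ⟨⟨h1, h2⟩, ⟨h3, h4⟩⟩ := hz
    have m1 := hseg j _ (Ioc_subset_Icc_self h1)
    have m3 := hseg k _ (Ioc_subset_Icc_self h3)
    have h0 : dist (S.dev t (S.corner t i)) (S.dev t (S.corner t i)) < δ := by rwa [dist_self]
    simp only [comparisonAngle, AffineMap.lineMap_apply_zero, H _ hp _ m1 h0 h2,
      H _ hp _ m3 h0 h4, H _ m1 _ m3 h2 h4]

end HyperbolicSurface

/-! ### Counting in triangulated surfaces -/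

namespace TriangulatedSurface

variable {E T : Type*} [NormedAddCommGroup E] [NormedSpace ℝ E] [Fintype T]
  (S : TriangulatedSurface E T)

open Classical in
/-- The vertices of the triangle `t`. -/
def triVertices (t : T) : Finset E := Finset.univ.image (S.corner t)

theorem mem_triVertices {t : T} {a : E} : a ∈ S.triVertices t ↔ a ∈ range (S.corner t) := by
  simp [triVertices]

theorem coe_triVertices (t : T) : (S.triVertices t : Set E) = range (S.corner t) := by
  simp [triVertices]

theorem card_triVertices (t : T) : (S.triVertices t).card = 3 := by
  classical
  rw [triVertices, Finset.card_image_of_injective _ (S.corner_injective t)]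
  simp

theorem triVertices_injective : Function.Injective S.triVertices := by
  intro t t' h
  apply S.triangle_injective
  simp only
  rw [← coe_triVertices, ← coe_triVertices, h]

open Classical in
/-- The vertices of the surface. -/
def vertexFinset : Finset E := Finset.univ.biUnion S.triVertices

theorem mem_vertexFinset {a : E} : a ∈ S.vertexFinset ↔ ∃ t, a ∈ S.triVertices t := by
  simp [vertexFinset]

theorem singleton_mem_faces {v : E} : {v} ∈ S.faces ↔ v ∈ S.vertexFinset := by
  rw [S.mem_faces_iff, mem_vertexFinset]
  simp [mem_triVertices]

theorem mem_faces_iff' (s : Finset E) :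
    s ∈ S.faces ↔ s.Nonempty ∧ ∃ t, s ⊆ S.triVertices t := by
  rw [S.mem_faces_iff]
  simp only [← coe_triVertices, Finset.coe_subset]

open Classical in
/-- The edges of the surface. -/
def edgeFinset : Finset (Finset E) :=
  Finset.univ.biUnion fun t => (S.triVertices t).powersetCard 2

theorem mem_edgeFinset {s : Finset E} :
    s ∈ S.edgeFinset ↔ (∃ t, s ⊆ S.triVertices t) ∧ s.card = 2 := by
  simp [edgeFinset, Finset.mem_powersetCard]

theorem eulerChar_eq : S.eulerChar =
    (S.vertexFinset.card : ℤ) - S.edgeFinset.card + Fintype.card T := by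
  classical
  have h1 : {s ∈ S.faces | s.card = 1} =
      ((S.vertexFinset.map ⟨fun v => ({v} : Finset E), Finset.singleton_injective⟩ :
        Finset (Finset E)) : Set (Finset E)) := by
    ext s
    simp only [mem_ofPred_eq, Finset.coe_map, Function.Embedding.coeFn_mk, mem_image,
      Finset.mem_coe, Finset.card_eq_one]
    constructor
    · rintro ⟨hs, a, rfl⟩
      exact ⟨a, S.singleton_mem_faces.1 hs, rfl⟩
    · rintro ⟨a, ha, rfl⟩
      exact ⟨S.singleton_mem_faces.2 ha, a, rfl⟩
  have h2 : {s ∈ S.faces | s.card = 2} = (S.edgeFinset : Set (Finset E)) := by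
    ext s
    rw [mem_ofPred_eq, Finset.mem_coe, mem_edgeFinset, mem_faces_iff', ← Finset.card_pos]
    constructor
    · rintro ⟨⟨-, h⟩, h'⟩; exact ⟨h, h'⟩
    · rintro ⟨h, h'⟩; exact ⟨⟨by omega, h⟩, h'⟩
  have h3 : {s ∈ S.faces | s.card = 3} =
      ((Finset.univ.map ⟨S.triVertices, S.triVertices_injective⟩ :
        Finset (Finset E)) : Set (Finset E)) := by
    ext s
    simp only [mem_ofPred_eq, Finset.coe_map, Function.Embedding.coeFn_mk, mem_image,
      Finset.coe_univ, mem_univ, true_and, mem_faces_iff']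
    constructor
    · rintro ⟨⟨-, t, ht⟩, h'⟩
      exact ⟨t, (Finset.eq_of_subset_of_card_le ht (by rw [S.card_triVertices, h'])).symm⟩
    · rintro ⟨t, rfl⟩
      refine ⟨⟨?_, t, subset_rfl⟩, S.card_triVertices t⟩
      rw [← Finset.card_pos, S.card_triVertices]; norm_num
  rw [eulerChar, h1, h2, h3, ncard_coe_finset, ncard_coe_finset, ncard_coe_finset,
    Finset.card_map, Finset.card_map, Finset.card_univ]

open Classical in
/-- The triangles around `v`. -/
def starFinset (v : E) : Finset T := {t | v ∈ S.triVertices t}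

theorem mem_starFinset {v : E} {t : T} : t ∈ S.starFinset v ↔ v ∈ S.triVertices t := by
  simp [starFinset]

open Classical in
/-- The vertices adjacent to `v`. -/
def linkFinset (v : E) : Finset E := ((S.starFinset v).biUnion S.triVertices).erase v

theorem mem_linkFinset {v a : E} : a ∈ S.linkFinset v ↔
    a ≠ v ∧ ∃ t, v ∈ S.triVertices t ∧ a ∈ S.triVertices t := by
  simp [linkFinset, mem_starFinset]

theorem sum_card_starFinset : ∑ v ∈ S.vertexFinset, (S.starFinset v).card =
    3 * Fintype.card T := by
  classical
  have := Finset.sum_card_bipartiteAbove_eq_sum_card_bipartiteBelow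
    (s := S.vertexFinset) (t := (Finset.univ : Finset T)) (fun v t => v ∈ S.triVertices t)
  have e1 : ∀ v, (Finset.univ : Finset T).bipartiteAbove (fun v t => v ∈ S.triVertices t) v =
      S.starFinset v := by
    intro v; ext t; simp [Finset.mem_bipartiteAbove, mem_starFinset]
  have e2 : ∀ t, S.vertexFinset.bipartiteBelow (fun v t => v ∈ S.triVertices t) t =
      S.triVertices t := by
    intro t; ext v; simp only [Finset.mem_bipartiteBelow, mem_vertexFinset, and_iff_right_iff_imp]
    exact fun h => ⟨t, h⟩
  simp only [e1, e2, S.card_triVertices] at this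
  rw [this]
  simp [mul_comm]

/-- Double counting of incidences: neighbours of v correspond to edges at v, and every edge has two
ends. -/
theorem sum_card_linkFinset : ∑ v ∈ S.vertexFinset, (S.linkFinset v).card =
    2 * S.edgeFinset.card := by
  classical
  have := Finset.sum_card_bipartiteAbove_eq_sum_card_bipartiteBelow
    (s := S.vertexFinset) (t := S.edgeFinset) (fun v s => v ∈ s)
  have e1 : ∀ v, (S.edgeFinset.bipartiteAbove (fun v s => v ∈ s) v).card =
      (S.linkFinset v).card := by
    intro v
    symm
    apply Finset.card_bij (fun a _ => ({v, a} : Finset E))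
    · intro a ha
      obtain ⟨hav, t, hv, ht⟩ := S.mem_linkFinset.1 ha
      rw [Finset.mem_bipartiteAbove, mem_edgeFinset]
      refine ⟨⟨⟨t, ?_⟩, Finset.card_pair hav.symm⟩, by simp⟩
      intro x hx
      rcases Finset.mem_insert.1 hx with rfl | hx
      · exact hv
      · rwa [Finset.mem_singleton.1 hx]
    · intro a ha b hb h
      have hb' := (S.mem_linkFinset.1 hb).1
      have : b ∈ ({v, a} : Finset E) := by rw [h]; simp
      simpa [hb', eq_comm] using this
    · intro s hs
      rw [Finset.mem_bipartiteAbove, mem_edgeFinset] at hs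
      obtain ⟨⟨⟨t, ht⟩, h2⟩, hv⟩ := hs
      obtain ⟨x, y, hxy, rfl⟩ := Finset.card_eq_two.1 h2
      rcases Finset.mem_insert.1 hv with rfl | hv
      · exact ⟨y, S.mem_linkFinset.2 ⟨hxy.symm, t, ht (by simp), ht (by simp)⟩, rfl⟩
      · rw [Finset.mem_singleton] at hv
        subst hv
        exact ⟨x, S.mem_linkFinset.2 ⟨hxy, t, ht (by simp), ht (by simp)⟩, Finset.pair_comm _ _⟩
  have e2 : ∀ s ∈ S.edgeFinset, (S.vertexFinset.bipartiteBelow (fun v s => v ∈ s) s).card = 2 := by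
    intro s hs
    obtain ⟨⟨t, ht⟩, h2⟩ := S.mem_edgeFinset.1 hs
    rw [← h2]
    congr 1
    ext v
    simp only [Finset.mem_bipartiteBelow, mem_vertexFinset, and_iff_right_iff_imp]
    exact fun h => ⟨t, ht h⟩
  simp only [e1] at this
  rw [this, Finset.sum_congr rfl e2]
  simp [mul_comm]

open Classical in
/-- The triangles that contain the edge `[v, a]`. -/
def edgeStar (v a : E) : Finset T := {t ∈ S.starFinset v | a ∈ S.triVertices t}

theorem mem_edgeStar {v a : E} {t : T} :
    t ∈ S.edgeStar v a ↔ v ∈ S.triVertices t ∧ a ∈ S.triVertices t := by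
  simp [edgeStar, mem_starFinset]

theorem ncard_edge (v a : E) : {t | v ∈ range (S.corner t) ∧ a ∈ range (S.corner t)}.ncard =
    (S.edgeStar v a).card := by
  rw [← ncard_coe_finset]
  congr 1
  ext t
  simp [mem_edgeStar, mem_triVertices]

theorem isBoundaryEdge_iff {v a : E} :
    S.IsBoundaryEdge v a ↔ v ≠ a ∧ (S.edgeStar v a).card = 1 := by
  rw [IsBoundaryEdge, ncard_edge]

theorem IsBoundaryEdge.mem_linkFinset {S : TriangulatedSurface E T} {v a : E}
    (h : S.IsBoundaryEdge v a) : a ∈ S.linkFinset v := by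
  rw [isBoundaryEdge_iff] at h
  obtain ⟨t, ht⟩ := Finset.card_pos.1 (h.2.symm ▸ one_pos)
  exact S.mem_linkFinset.2 ⟨h.1.symm, t, S.mem_edgeStar.1 ht⟩

theorem IsBoundaryVertex.mem_vertexFinset {S : TriangulatedSurface E T} {v : E}
    (h : S.IsBoundaryVertex v) : v ∈ S.vertexFinset := by
  obtain ⟨a, ha⟩ := h
  obtain ⟨-, t, ht, -⟩ := S.mem_linkFinset.1 ha.mem_linkFinset
  exact S.mem_vertexFinset.2 ⟨t, ht⟩

theorem triVertices_eq {t : T} {v a b : E} (hv : v ∈ S.triVertices t) (ha : a ∈ S.triVertices t)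
    (hb : b ∈ S.triVertices t) (hav : a ≠ v) (hbv : b ≠ v) (hab : a ≠ b) :
    ∀ x, x ∈ S.triVertices t ↔ x = v ∨ x = a ∨ x = b := by
  classical
  have h : ({v, a, b} : Finset E) = S.triVertices t := by
    apply Finset.eq_of_subset_of_card_le
    · intro x hx
      simp only [Finset.mem_insert, Finset.mem_singleton] at hx
      rcases hx with rfl | rfl | rfl <;> assumption
    · rw [S.card_triVertices, Finset.card_eq_three.2 ⟨v, a, b, hav.symm, hbv.symm, hab, rfl⟩]
  intro x
  rw [← h]
  simp

/-- Each triangle around v has exactly two vertices other than v, so the incidences of link vertices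
with triangles number two per triangle. -/
theorem sum_card_edgeStar (v : E) :
    ∑ a ∈ S.linkFinset v, (S.edgeStar v a).card = 2 * (S.starFinset v).card := by
  classical
  have := Finset.sum_card_bipartiteAbove_eq_sum_card_bipartiteBelow
    (s := S.linkFinset v) (t := S.starFinset v) (fun a t => a ∈ S.triVertices t)
  have e2 : ∀ t ∈ S.starFinset v,
      ((S.linkFinset v).bipartiteBelow (fun a t => a ∈ S.triVertices t) t).card = 2 := by
    intro t ht
    rw [mem_starFinset] at ht
    have : (S.linkFinset v).bipartiteBelow (fun a t => a ∈ S.triVertices t) t =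
        (S.triVertices t).erase v := by
      ext a
      rw [Finset.mem_bipartiteBelow, mem_linkFinset, Finset.mem_erase]
      constructor
      · rintro ⟨⟨h, -⟩, h'⟩; exact ⟨h, h'⟩
      · rintro ⟨h, h'⟩; exact ⟨⟨h, t, ht, h'⟩, h'⟩
    rw [this, Finset.card_erase_of_mem ht, S.card_triVertices]
  rw [Finset.sum_congr rfl e2] at this
  simp only [Finset.sum_const, smul_eq_mul] at this
  rw [mul_comm, ← this]
  rfl

/-- The link of the vertex `v`. -/
def linkGraph (v : E) : SimpleGraph {a : E // a ≠ v ∧ ∃ t, v ∈ range (S.corner t) ∧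
    a ∈ range (S.corner t)} :=
  SimpleGraph.fromRel fun a b =>
    ∃ t, v ∈ range (S.corner t) ∧ a.1 ∈ range (S.corner t) ∧ b.1 ∈ range (S.corner t)

theorem linkGraph_adj {v : E} {a b : {a : E // a ≠ v ∧ ∃ t, v ∈ range (S.corner t) ∧
    a ∈ range (S.corner t)}} (h : (S.linkGraph v).Adj a b) : a.1 ≠ b.1 ∧
      ∃ t, v ∈ S.triVertices t ∧ a.1 ∈ S.triVertices t ∧ b.1 ∈ S.triVertices t := by
  rw [linkGraph, SimpleGraph.fromRel_adj] at h
  simp only [mem_triVertices]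
  refine ⟨fun e => h.1 (Subtype.ext e), ?_⟩
  rcases h.2 with ⟨t, h1, h2, h3⟩ | ⟨t, h1, h2, h3⟩
  · exact ⟨t, h1, h2, h3⟩
  · exact ⟨t, h1, h3, h2⟩

/-- A triangle that contains a given edge of the link of `v`. -/
def dartTriangle {v : E} (d : (S.linkGraph v).Dart) : T := (S.linkGraph_adj d.adj).2.choose

theorem dartTriangle_spec {v : E} (d : (S.linkGraph v).Dart) :
    v ∈ S.triVertices (S.dartTriangle d) ∧ d.fst.1 ∈ S.triVertices (S.dartTriangle d) ∧
      d.snd.1 ∈ S.triVertices (S.dartTriangle d) :=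
  (S.linkGraph_adj d.adj).2.choose_spec

/-- A triangle at v has only two further vertices, so it determines its edge in the link. Distinct
link edges thus come from distinct triangles. -/
theorem edge_eq_of_dartTriangle_eq {v : E} {d d' : (S.linkGraph v).Dart}
    (h : S.dartTriangle d = S.dartTriangle d') : d.edge = d'.edge := by
  obtain ⟨h1, h2, h3⟩ := S.dartTriangle_spec d
  obtain ⟨h1', h2', h3'⟩ := S.dartTriangle_spec d'
  rw [← h] at h2' h3'
  have key := S.triVertices_eq h1 h2 h3 d.fst.2.1 d.snd.2.1 (S.linkGraph_adj d.adj).1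
  have k1 := ((key _).1 h2').resolve_left d'.fst.2.1
  have k2 := ((key _).1 h3').resolve_left d'.snd.2.1
  have k3 := (S.linkGraph_adj d'.adj).1
  have : (d.fst = d'.fst ∧ d.snd = d'.snd) ∨ (d.fst = d'.snd ∧ d.snd = d'.fst) := by
    simp only [Subtype.ext_iff]
    grind
  rw [SimpleGraph.Dart.edge, SimpleGraph.Dart.edge, Sym2.mk_eq_mk_iff]
  rcases this with ⟨e1, e2⟩ | ⟨e1, e2⟩
  · left; exact Prod.ext e1 e2
  · right; exact Prod.ext e1 e2

/-- A connected graph has at most one vertex more than it has edges, and the edges of the link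
inject into the triangles around v. -/
theorem card_linkFinset_le {v : E} (hv : v ∈ S.vertexFinset) :
    (S.linkFinset v).card ≤ (S.starFinset v).card + 1 := by
  classical
  have hconn : (S.linkGraph v).Connected := S.link_connected v (S.singleton_mem_faces.2 hv)
  have h1 := hconn.card_vert_le_card_edgeSet_add_one
  have e : Nat.card {a : E // a ≠ v ∧ ∃ t, v ∈ range (S.corner t) ∧ a ∈ range (S.corner t)} =
      (S.linkFinset v).card :=
    Nat.subtype_card _ fun a => by rw [mem_linkFinset]; simp only [mem_triVertices]
  rw [e] at h1
  refine h1.trans (Nat.add_le_add_right ?_ 1)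
  have hd : ∀ e : (S.linkGraph v).edgeSet, ∃ d : (S.linkGraph v).Dart, d.edge = e.1 := by
    rintro ⟨e, he⟩
    induction e with
    | _ a b => exact ⟨⟨(a, b), he⟩, rfl⟩
  choose d hd using hd
  have hinj : Function.Injective fun e : (S.linkGraph v).edgeSet =>
      (⟨S.dartTriangle (d e), S.mem_starFinset.2 (S.dartTriangle_spec (d e)).1⟩ :
        {t // t ∈ S.starFinset v}) := by
    intro e e' h
    apply Subtype.ext
    rw [← hd e, ← hd e']
    exact S.edge_eq_of_dartTriangle_eq (Subtype.ext_iff.1 h)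
  have := Nat.card_le_card_of_injective _ hinj
  rwa [Nat.subtype_card (S.starFinset v) fun _ => Iff.rfl] at this

theorem card_edgeStar_mem {v a : E} (ha : a ∈ S.linkFinset v) :
    (S.edgeStar v a).card = 1 ∨ (S.edgeStar v a).card = 2 := by
  obtain ⟨hav, t, hv, ht⟩ := S.mem_linkFinset.1 ha
  have h1 : 0 < (S.edgeStar v a).card := Finset.card_pos.2 ⟨t, S.mem_edgeStar.2 ⟨hv, ht⟩⟩
  have h2 := S.edge_le_two v a hav.symm
  rw [ncard_edge] at h2
  omega

-- This is the combinatorial form of "the link is a circle or an arc". If B is the set of boundary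
-- edges at v, counting incidences gives 2|link| - |B| = 2|star|. So |B| is even, and the bound from
-- connectedness makes it at most 2; hence it is 0 or 2.
open Classical in
theorem card_starFinset {v : E} (hv : v ∈ S.vertexFinset) :
    (S.linkFinset v).card = (S.starFinset v).card + if S.IsBoundaryVertex v then 1 else 0 := by
  have h1 := S.sum_card_edgeStar v
  have h2 := S.card_linkFinset_le hv
  set B : Finset E := {a ∈ S.linkFinset v | (S.edgeStar v a).card = 1} with hB
  have h3 : ∑ a ∈ S.linkFinset v, (S.edgeStar v a).card + B.card = 2 * (S.linkFinset v).card := by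
    rw [hB, Finset.card_filter, ← Finset.sum_add_distrib, mul_comm, ← smul_eq_mul,
      ← Finset.sum_const]
    refine Finset.sum_congr rfl fun a ha => ?_
    rcases S.card_edgeStar_mem ha with h | h <;> simp [h]
  split_ifs with hb
  · have : 0 < B.card := by
      obtain ⟨a, ha⟩ := hb
      exact Finset.card_pos.2 ⟨a, Finset.mem_filter.2
        ⟨ha.mem_linkFinset, (S.isBoundaryEdge_iff.1 ha).2⟩⟩
    omega
  · have : B.card = 0 := by
      rw [Finset.card_eq_zero, hB, Finset.filter_eq_empty_iff]
      intro a ha h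
      exact hb ⟨a, S.isBoundaryEdge_iff.2 ⟨(S.mem_linkFinset.1 ha).1.symm, h⟩⟩
    omega

open Classical in
/-- The vertices on the boundary. -/
def boundaryVertexFinset : Finset E := {v ∈ S.vertexFinset | S.IsBoundaryVertex v}

theorem mem_boundaryVertexFinset {v : E} : v ∈ S.boundaryVertexFinset ↔ S.IsBoundaryVertex v := by
  classical
  rw [boundaryVertexFinset, Finset.mem_filter, and_iff_right_iff_imp]
  exact fun h => h.mem_vertexFinset

/-- Sum the local relation between link and star over all vertices: edges are counted twice,
triangles three times. -/
theorem two_mul_card_edgeFinset :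
    2 * S.edgeFinset.card = 3 * Fintype.card T + S.boundaryVertexFinset.card := by
  classical
  rw [← S.sum_card_linkFinset, ← S.sum_card_starFinset,
    Finset.sum_congr rfl fun v hv => S.card_starFinset hv, Finset.sum_add_distrib,
    boundaryVertexFinset, Finset.card_filter]

/-- Triangles, counted by vertices and the Euler characteristic. -/
theorem card_triangles : (Fintype.card T : ℤ) =
    2 * S.vertexFinset.card - S.boundaryVertexFinset.card - 2 * S.eulerChar := by
  have := S.two_mul_card_edgeFinset
  rw [eulerChar_eq]
  omega

theorem isInteriorVertex_iff {v : E} :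
    S.IsInteriorVertex v ↔ v ∈ S.vertexFinset ∧ v ∉ S.boundaryVertexFinset := by
  rw [IsInteriorVertex, singleton_mem_faces, mem_boundaryVertexFinset]

end TriangulatedSurface

/-! ### Gauss–Bonnet, and angles in M against angle sums -/

namespace HyperbolicSurface

variable {E T M : Type*} [NormedAddCommGroup E] [NormedSpace ℝ E] [Fintype T] [MetricSpace M]
  (S : HyperbolicSurface E T)

open Classical in
/-- The angle of the triangle `t` at the vertex `v`, zero if `v` is not a vertex of `t`. -/
def angleAt (t : T) (v : E) : ℝ := ∑ i, if S.corner t i = v then S.angle t i else 0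

theorem angleSum_eq (v : E) : S.angleSum v = ∑ t, S.angleAt t v := rfl

theorem angleAt_nonneg (t : T) (v : E) : 0 ≤ S.angleAt t v :=
  Finset.sum_nonneg fun i _ => by split_ifs; exacts [S.angle_nonneg t i, le_rfl]

theorem angleAt_corner (t : T) (i : Fin 3) : S.angleAt t (S.corner t i) = S.angle t i := by
  classical
  rw [angleAt, Finset.sum_eq_single i]
  · simp
  · intro j _ hj
    rw [if_neg fun e => hj (S.corner_injective t e)]
  · simp

theorem sum_angleSum : ∑ v ∈ S.vertexFinset, S.angleSum v = ∑ t, ∑ i, S.angle t i := by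
  classical
  simp only [angleSum_eq]
  rw [Finset.sum_comm]
  refine Finset.sum_congr rfl fun t _ => ?_
  simp only [angleAt]
  rw [Finset.sum_comm]
  refine Finset.sum_congr rfl fun i _ => ?_
  rw [Finset.sum_ite_eq, if_pos]
  exact S.mem_vertexFinset.2 ⟨t, S.mem_triVertices.2 (mem_range_self i)⟩

open Classical in
/-- The Gauss-Bonnet formula: the area in terms of the angle sums. -/
theorem area_eq_gaussBonnet : S.area =
    ∑ v ∈ S.vertexFinset \ S.boundaryVertexFinset, (2 * Real.pi - S.angleSum v) +
      ∑ v ∈ S.boundaryVertexFinset, (Real.pi - S.angleSum v) - 2 * Real.pi * S.eulerChar := by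
  have hsub : S.boundaryVertexFinset ⊆ S.vertexFinset := Finset.filter_subset _ _
  have h1 := Finset.sum_sdiff (f := S.angleSum) hsub
  have h2 : ((S.vertexFinset \ S.boundaryVertexFinset).card : ℝ) =
      S.vertexFinset.card - S.boundaryVertexFinset.card := by
    rw [Finset.card_sdiff_of_subset hsub, Nat.cast_sub (Finset.card_le_card hsub)]
  have h3 : (Fintype.card T : ℝ) =
      2 * S.vertexFinset.card - S.boundaryVertexFinset.card - 2 * S.eulerChar := by
    exact_mod_cast S.card_triangles
  rw [S.area_eq, ← S.sum_angleSum, ← h1, Finset.sum_sub_distrib, Finset.sum_sub_distrib,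
    Finset.sum_const, Finset.sum_const, nsmul_eq_mul, nsmul_eq_mul, h2, h3]
  ring

theorem exists_corner {t : T} {a : E} (h : a ∈ S.triVertices t) : ∃ i, S.corner t i = a :=
  S.mem_triVertices.1 h

theorem IsTriangulatedMap.isArc {S : HyperbolicSurface E T} {A : HypAtlas M} {f : E → M}
    (hL : IsLengthMetric M) (hf : S.IsTriangulatedMap A f) {v a : E} (h : a ∈ S.linkFinset v) :
    IsArc fun s : ℝ => f (AffineMap.lineMap v a s) := by
  obtain ⟨hav, t, hv, ha⟩ := S.mem_linkFinset.1 h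
  obtain ⟨i, rfl⟩ := S.exists_corner hv
  obtain ⟨j, rfl⟩ := S.exists_corner ha
  have hij : i ≠ j := by rintro rfl; exact hav rfl
  obtain ⟨k, hk⟩ : ∃ k, i ≠ k ∧ j ≠ k :=
    (by decide : ∀ i j : Fin 3, ∃ k, i ≠ k ∧ j ≠ k) i j
  exact (hf.isArc_and_upperAngle hL t hij hk.1 hk.2).1

theorem IsTriangulatedMap.upperAngle_eq {S : HyperbolicSurface E T} {A : HypAtlas M} {f : E → M}
    (hL : IsLengthMetric M) (hf : S.IsTriangulatedMap A f) {t : T} {v a b : E}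
    (hv : v ∈ S.triVertices t) (ha : a ∈ S.triVertices t) (hb : b ∈ S.triVertices t)
    (hav : a ≠ v) (hbv : b ≠ v) (hab : a ≠ b) :
    upperAngle (fun s : ℝ => f (AffineMap.lineMap v a s))
      (fun s : ℝ => f (AffineMap.lineMap v b s)) = S.angleAt t v := by
  obtain ⟨i, rfl⟩ := S.exists_corner hv
  obtain ⟨j, rfl⟩ := S.exists_corner ha
  obtain ⟨k, rfl⟩ := S.exists_corner hb
  have hij : i ≠ j := by rintro rfl; exact hav rfl
  have hik : i ≠ k := by rintro rfl; exact hbv rfl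
  have hjk : j ≠ k := by rintro rfl; exact hab rfl
  rw [(hf.isArc_and_upperAngle hL t hij hik hjk).2, angleAt_corner]

/-- Repeated use of the triangle inequality for upper angles: each step of the walk crosses one
triangle and contributes its angle at v. -/
theorem IsTriangulatedMap.upperAngle_le_sum {S : HyperbolicSurface E T} {A : HypAtlas M}
    {f : E → M} (hL : IsLengthMetric M) (hf : S.IsTriangulatedMap A f) {v : E}
    {a b : {a : E // a ≠ v ∧ ∃ t, v ∈ range (S.corner t) ∧ a ∈ range (S.corner t)}}
    (p : (S.linkGraph v).Walk a b) (hp : p.length ≠ 0) :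
    upperAngle (fun s : ℝ => f (AffineMap.lineMap v a.1 s))
      (fun s : ℝ => f (AffineMap.lineMap v b.1 s)) ≤
        (p.darts.map fun d => S.angleAt (S.dartTriangle d) v).sum := by
  have hlink : ∀ a : {a : E // a ≠ v ∧ ∃ t, v ∈ range (S.corner t) ∧ a ∈ range (S.corner t)},
      a.1 ∈ S.linkFinset v := by
    intro a
    rw [S.mem_linkFinset]
    simp only [S.mem_triVertices]
    exact a.2
  induction p with
  | nil => simp at hp
  | @cons a c b h p ih =>
    have hstep : upperAngle (fun s : ℝ => f (AffineMap.lineMap v a.1 s))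
        (fun s : ℝ => f (AffineMap.lineMap v c.1 s)) =
          S.angleAt (S.dartTriangle ⟨(a, c), h⟩) v := by
      obtain ⟨h1, h2, h3⟩ := S.dartTriangle_spec ⟨(a, c), h⟩
      exact hf.upperAngle_eq hL h1 h2 h3 a.2.1 c.2.1 (S.linkGraph_adj h).1
    rw [SimpleGraph.Walk.darts_cons, List.map_cons, List.sum_cons, ← hstep]
    -- The induction starts from a walk of one edge, so the upper angle of an edge with itself never
    -- has to be computed.
    by_cases hp0 : p.length = 0
    · cases p with
      | nil => simp
      | cons h' p' => simp at hp0
    · refine (upperAngle_triangle (hf.isArc hL (hlink a)) (hf.isArc hL (hlink c))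
        (hf.isArc hL (hlink b)) ?_ ?_).trans (add_le_add_right (ih hp0) _)
      · simp only [AffineMap.lineMap_apply_zero]
      · simp only [AffineMap.lineMap_apply_zero]

/-- The angle in `M` between two edges at a vertex is at most the angle sum. -/
theorem IsTriangulatedMap.upperAngle_le_angleSum {S : HyperbolicSurface E T} {A : HypAtlas M}
    {f : E → M} (hL : IsLengthMetric M) (hf : S.IsTriangulatedMap A f) {v a b : E}
    (hab : a ≠ b) (ha : a ∈ S.linkFinset v) (hb : b ∈ S.linkFinset v) :
    upperAngle (fun s : ℝ => f (AffineMap.lineMap v a s))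
      (fun s : ℝ => f (AffineMap.lineMap v b s)) ≤ S.angleSum v := by
  classical
  have hv : v ∈ S.vertexFinset := by
    obtain ⟨-, t, ht, -⟩ := S.mem_linkFinset.1 ha
    exact S.mem_vertexFinset.2 ⟨t, ht⟩
  have hconn : (S.linkGraph v).Connected := S.link_connected v (S.singleton_mem_faces.2 hv)
  rw [S.mem_linkFinset] at ha hb
  simp only [S.mem_triVertices] at ha hb
  -- A path is needed, not just a walk: it repeats no edge, hence no triangle, and its angles form a
  -- partial sum of the nonnegative terms of the angle sum.
  obtain ⟨p, hp⟩ := (hconn.preconnected ⟨a, ha⟩ ⟨b, hb⟩).exists_isPath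
  have hlen : p.length ≠ 0 := fun h =>
    hab (Subtype.ext_iff.1 (SimpleGraph.Walk.eq_of_length_eq_zero h))
  refine (hf.upperAngle_le_sum hL p hlen).trans ?_
  have hnd : (p.darts.map S.dartTriangle).Nodup := by
    have h1 : (p.darts.map SimpleGraph.Dart.edge).Nodup := hp.isTrail.edges_nodup
    rw [List.Nodup, List.pairwise_map] at h1 ⊢
    exact h1.imp fun h e => h (S.edge_eq_of_dartTriangle_eq e)
  have e : (p.darts.map fun d => S.angleAt (S.dartTriangle d) v) =
      (p.darts.map S.dartTriangle).map fun t => S.angleAt t v := by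
    rw [List.map_map]; rfl
  rw [e, ← List.sum_toFinset _ hnd, angleSum_eq]
  exact Finset.sum_le_sum_of_subset_of_nonneg (Finset.subset_univ _)
    fun t _ _ => S.angleAt_nonneg t v

end HyperbolicSurface

/-! ### Geodesic boundary -/

namespace TriangulatedSurface

variable {E T : Type*} [NormedAddCommGroup E] [NormedSpace ℝ E] [Fintype T]
  (S : TriangulatedSurface E T)

theorem IsBoundaryEdge.symm {S : TriangulatedSurface E T} {a b : E} (h : S.IsBoundaryEdge a b) :
    S.IsBoundaryEdge b a := by
  refine ⟨h.1.symm, ?_⟩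
  rw [← h.2]
  congr 1
  ext t
  exact and_comm

open Classical in
theorem IsBoundaryEdge.pair_mem_faces {S : TriangulatedSurface E T} {a b : E}
    (h : S.IsBoundaryEdge a b) : ({a, b} : Finset E) ∈ S.faces := by
  obtain ⟨-, t, ha, hb⟩ := S.mem_linkFinset.1 h.mem_linkFinset
  rw [mem_faces_iff']
  refine ⟨by simp, t, ?_⟩
  simp [Finset.insert_subset_iff, ha, hb]

/-- A boundary vertex has exactly two boundary edges. -/
theorem IsBoundaryVertex.exists_edges {S : TriangulatedSurface E T} {v : E}
    (h : S.IsBoundaryVertex v) : ∃ a b, a ≠ b ∧ S.IsBoundaryEdge v a ∧ S.IsBoundaryEdge v b ∧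
      ∀ c, S.IsBoundaryEdge v c → c = a ∨ c = b := by
  classical
  have h1 := S.sum_card_edgeStar v
  have h2 := S.card_starFinset h.mem_vertexFinset
  rw [if_pos h] at h2
  set B : Finset E := {a ∈ S.linkFinset v | (S.edgeStar v a).card = 1} with hB
  have h3 : ∑ a ∈ S.linkFinset v, (S.edgeStar v a).card + B.card = 2 * (S.linkFinset v).card := by
    rw [hB, Finset.card_filter, ← Finset.sum_add_distrib, mul_comm, ← smul_eq_mul,
      ← Finset.sum_const]
    refine Finset.sum_congr rfl fun a ha => ?_
    rcases S.card_edgeStar_mem ha with h | h <;> simp [h]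
  have hmem : ∀ c, c ∈ B ↔ S.IsBoundaryEdge v c := by
    intro c
    rw [hB, Finset.mem_filter]
    constructor
    · rintro ⟨hc, hc'⟩
      exact S.isBoundaryEdge_iff.2 ⟨(S.mem_linkFinset.1 hc).1.symm, hc'⟩
    · exact fun hc => ⟨hc.mem_linkFinset, (S.isBoundaryEdge_iff.1 hc).2⟩
  -- On the boundary |link| = |star| + 1, and 2|link| - |B| = 2|star| then forces |B| = 2.
  obtain ⟨a, b, hab, e⟩ := Finset.card_eq_two.1 (show B.card = 2 by omega)
  simp only [← hmem]
  exact ⟨a, b, hab, by simp [e], by simp [e], by simp [e]⟩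

/-- Faces of a simplicial complex meet only in the hull of their common vertices; if v lies on the
edge, the common vertex set cannot be empty. -/
theorem mem_of_mem_segment {v c d : E} (hv : v ∈ S.vertexFinset) (h : S.IsBoundaryEdge c d)
    (hm : v ∈ segment ℝ c d) : v = c ∨ v = d := by
  classical
  have h1 := S.singleton_mem_faces.2 hv
  have := S.inter_subset_convexHull h1 h.pair_mem_faces
  simp only [Finset.coe_singleton, convexHull_singleton, Finset.coe_insert, convexHull_pair] at this
  have hne : ({v} ∩ {c, d} : Set E).Nonempty :=
    (convexHull_nonempty_iff (𝕜 := ℝ)).1 ⟨v, this ⟨rfl, hm⟩⟩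
  obtain ⟨x, hx, hx'⟩ := hne
  rw [mem_singleton_iff] at hx
  subst hx
  exact hx'

theorem segment_inter_segment {v a b : E} (ha : S.IsBoundaryEdge v a) (hb : S.IsBoundaryEdge v b)
    (hab : a ≠ b) : segment ℝ v a ∩ segment ℝ v b ⊆ {v} := by
  classical
  have := S.inter_subset_convexHull ha.pair_mem_faces hb.pair_mem_faces
  have e : ({v, a} ∩ {v, b} : Set E) = {v} := by
    ext x
    simp only [mem_inter_iff, mem_insert_iff, mem_singleton_iff]
    constructor
    · rintro ⟨rfl | rfl, h | h⟩
      · rfl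
      · rfl
      · exact h
      · exact absurd h hab
    · rintro rfl; simp
  simp only [Finset.coe_insert, Finset.coe_singleton, convexHull_pair, e,
    convexHull_singleton] at this
  exact this

theorem isClosed_segment (a b : E) : IsClosed (segment ℝ a b) := by
  rw [segment_eq_image_lineMap]
  exact (isCompact_Icc.image (by fun_prop)).isClosed

/-- Near a boundary vertex, the boundary consists of the two boundary edges. -/
theorem eventually_mem_edges {v a b : E} (hv : v ∈ S.vertexFinset)
    (hall : ∀ c, S.IsBoundaryEdge v c → c = a ∨ c = b) :
    ∀ᶠ x in 𝓝 v, x ∈ S.boundary → x ∈ segment ℝ v a ∪ segment ℝ v b := by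
  classical
  -- The boundary edges that avoid v are finitely many closed sets, so some neighbourhood of v
  -- misses all of them.
  have hfin : ∀ p ∈ (S.vertexFinset ×ˢ S.vertexFinset), ∀ᶠ x in 𝓝 v,
      S.IsBoundaryEdge p.1 p.2 → v ∉ segment ℝ p.1 p.2 → x ∉ segment ℝ p.1 p.2 := by
    intro p _
    by_cases hp : v ∈ segment ℝ p.1 p.2
    · exact Eventually.of_forall fun x _ h => absurd hp h
    · filter_upwards [(isClosed_segment p.1 p.2).isOpen_compl.mem_nhds hp] with x hx _ _
      exact hx
  filter_upwards [(Filter.eventually_all_finset _).2 hfin] with x hx hxb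
  obtain ⟨c, d, hcd, hxs⟩ := hxb
  have hc : c ∈ S.vertexFinset := IsBoundaryVertex.mem_vertexFinset ⟨d, hcd⟩
  have hd : d ∈ S.vertexFinset := IsBoundaryVertex.mem_vertexFinset ⟨c, hcd.symm⟩
  have hvs : v ∈ segment ℝ c d := by
    by_contra h
    exact hx (c, d) (Finset.mem_product.2 ⟨hc, hd⟩) hcd h hxs
  rcases S.mem_of_mem_segment hv hcd hvs with rfl | rfl
  · rcases hall d hcd with rfl | rfl
    · exact .inl hxs
    · exact .inr hxs
  · rw [segment_symm] at hxs
    rcases hall c hcd.symm with rfl | rfl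
    · exact .inl hxs
    · exact .inr hxs

end TriangulatedSurface

theorem comparisonAngle_eq_pi {X : Type*} [MetricSpace X] {p x y : X} (hx : x ≠ p) (hy : y ≠ p)
    (h : dist x y = dist p x + dist p y) : comparisonAngle p x y = Real.pi := by
  have h1 : 0 < dist p x := dist_pos.2 hx.symm
  have h2 : 0 < dist p y := dist_pos.2 hy.symm
  rw [comparisonAngle, h, ← Real.arccos_neg_one]
  congr 1
  field_simp
  ring

namespace HyperbolicSurface

variable {E T M : Type*} [NormedAddCommGroup E] [NormedSpace ℝ E] [Fintype T] [MetricSpace M]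

/-- Points near v on the two different boundary edges have parameters of opposite sign under the
local geodesic parametrization. Their distance in M is therefore the sum of their distances to f v,
every comparison angle is π, and the angle in M, which is π, is at most the angle sum. -/
theorem HasGeodesicBoundary.pi_le_angleSum {S : HyperbolicSurface E T} {A : HypAtlas M}
    {f : E → M} (hL : IsLengthMetric M) (hf : S.IsTriangulatedMap A f) {V : Set E}
    (hg : S.HasGeodesicBoundary f V) {v : E} (hv : S.IsBoundaryVertex v) (hvV : v ∉ V) :
    Real.pi ≤ S.angleSum v := by
  obtain ⟨a, b, hab, ha, hb, hall⟩ := hv.exists_edges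
  have hseg : ∀ {a}, S.IsBoundaryEdge v a → ∀ s ∈ Icc (0 : ℝ) 1,
      AffineMap.lineMap v a s ∈ S.boundary := fun ha s hs => ⟨v, _, ha, lineMap_mem_segment hs⟩
  have hvb : v ∈ S.boundary := ⟨v, a, ha, left_mem_segment ℝ v a⟩
  obtain ⟨ε, hε, γ, hγ0, hγc, hγb, hγn, hγd⟩ := hg v hvb hvV
  have h0 : (0 : ℝ) ∈ Ioo (-ε) ε := by constructor <;> linarith
  have hdist : ∀ s ∈ Ioo (-ε) ε, dist (f v) (f (γ s)) = |s| := by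
    intro s hs
    have := hγd 0 h0 s hs
    rwa [hγ0, zero_sub, abs_neg] at this
  have hγne : ∀ s ∈ Ioo (-ε) ε, s ≠ 0 → γ s ≠ v := by
    intro s hs hs0 e
    have := hdist s hs
    rw [e, dist_self, eq_comm, abs_eq_zero] at this
    exact hs0 this
  obtain ⟨δ, hδ, hδε, hδs⟩ : ∃ δ > 0, δ ≤ ε ∧ ∀ s, |s| < δ →
      γ s ∈ segment ℝ v a ∪ segment ℝ v b := by
    have h1 : Tendsto γ (𝓝 0) (𝓝 v) := by
      have := (hγc 0 h0).continuousAt (Ioo_mem_nhds h0.1 h0.2)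
      rwa [ContinuousAt, hγ0] at this
    obtain ⟨δ, hδ, H⟩ := Metric.eventually_nhds_iff.1
      (h1.eventually (S.eventually_mem_edges hv.mem_vertexFinset hall))
    refine ⟨min δ ε, lt_min hδ hε, min_le_right _ _, fun s hs => ?_⟩
    rw [lt_min_iff] at hs
    exact H (by rw [Real.dist_eq, sub_zero]; exact hs.1) (hγb (abs_lt.1 hs.2))
  -- each side of the parameter interval stays in one of the two edges
  have hside : ∀ I : Set ℝ, IsPreconnected I → I ⊆ Ioo (-δ) δ → (0 : ℝ) ∉ I →
      ∀ s ∈ I, ∀ t ∈ I, γ s ∈ segment ℝ v a → γ t ∈ segment ℝ v b → False := by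
    intro I hI hIδ hI0 s hs t ht hsa htb
    have hIε : I ⊆ Ioo (-ε) ε := hIδ.trans (Ioo_subset_Ioo (by linarith) hδε)
    have hne : ∀ u ∈ I, γ u ∉ segment ℝ v a ∩ segment ℝ v b := fun u hu hm =>
      hγne u (hIε hu) (fun e => hI0 (e ▸ hu)) (S.segment_inter_segment ha hb hab hm)
    have hpre := hI.image γ (hγc.mono hIε)
    -- The two closed edges cover the connected image and meet only at v, which is not attained for
    -- nonzero parameters.
    rw [isPreconnected_iff_subset_of_disjoint_closed] at hpre
    rcases hpre _ _ (TriangulatedSurface.isClosed_segment v a)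
      (TriangulatedSurface.isClosed_segment v b)
      (by rintro _ ⟨u, hu, rfl⟩; exact hδs u (abs_lt.2 (hIδ hu)))
      (by
        rw [← disjoint_iff_inter_eq_empty, Set.disjoint_left]
        rintro _ ⟨u, hu, rfl⟩
        exact hne u hu) with h | h
    · exact hne t ht ⟨h (mem_image_of_mem _ ht), htb⟩
    · exact hne s hs ⟨hsa, h (mem_image_of_mem _ hs)⟩
  -- The image of γ is a neighbourhood of v in the boundary, so it contains the start of each edge.
  -- The parameter is small because its absolute value is a distance in M.
  have hparam : ∀ {a}, S.IsBoundaryEdge v a → ∀ᶠ s in 𝓝[>] (0 : ℝ), ∃ σ, |σ| < δ ∧ σ ≠ 0 ∧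
      AffineMap.lineMap v a s = γ σ ∧ γ σ ∈ segment ℝ v a := by
    intro a ha
    have harc := hf.isArc hL ha.mem_linkFinset
    have h1 := harc.tendsto.eventually (Metric.ball_mem_nhds _ hδ)
    have h2 : Tendsto (fun s : ℝ => AffineMap.lineMap v a s) (𝓝[>] 0) (𝓝[S.boundary] v) := by
      apply tendsto_nhdsWithin_iff.2 ⟨?_, ?_⟩
      · have : Continuous fun s : ℝ => AffineMap.lineMap v a s := by fun_prop
        have := this.tendsto 0
        rw [AffineMap.lineMap_apply_zero] at this
        exact this.mono_left nhdsWithin_le_nhds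
      · filter_upwards [Ioc_mem_nhdsGT one_pos] with s hs
        exact hseg ha s (Ioc_subset_Icc_self hs)
    filter_upwards [h1, h2 hγn, harc.eventually_ne, Ioc_mem_nhdsGT one_pos] with s hs1 hs2 hs3 hs4
    obtain ⟨σ, hσ, e⟩ := hs2
    simp only [AffineMap.lineMap_apply_zero] at hs1 hs3 e
    refine ⟨σ, ?_, ?_, e.symm, ?_⟩
    · rw [← hdist σ hσ, e, dist_comm]; exact hs1
    · rintro rfl
      rw [← e, hγ0] at hs3
      exact hs3 rfl
    · rw [e]
      exact lineMap_mem_segment (Ioc_subset_Icc_self hs4)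
  have hπ : upperAngle (fun s : ℝ => f (AffineMap.lineMap v a s))
      (fun s : ℝ => f (AffineMap.lineMap v b s)) = Real.pi := by
    apply upperAngle_eq_of_tendsto
    refine tendsto_const_nhds.congr' ?_
    filter_upwards [(hparam ha).prod_mk (hparam hb)] with z hz
    obtain ⟨⟨σ, hσδ, hσ0, hσe, hσm⟩, ⟨τ, hτδ, hτ0, hτe, hτm⟩⟩ := hz
    have hσε : σ ∈ Ioo (-ε) ε := abs_lt.1 (hσδ.trans_le hδε)
    have hτε : τ ∈ Ioo (-ε) ε := abs_lt.1 (hτδ.trans_le hδε)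
    have dσ := hdist σ hσε
    have dτ := hdist τ hτε
    simp only [AffineMap.lineMap_apply_zero, hσe, hτe]
    refine (comparisonAngle_eq_pi ?_ ?_ ?_).symm
    · rw [← dist_pos, dist_comm, dσ]; exact abs_pos.2 hσ0
    · rw [← dist_pos, dist_comm, dτ]; exact abs_pos.2 hτ0
    · rw [dσ, dτ, hγd σ hσε τ hτε]
      have hσ' := abs_lt.1 hσδ
      have hτ' := abs_lt.1 hτδ
      rcases lt_or_gt_of_ne hσ0 with h1 | h1 <;> rcases lt_or_gt_of_ne hτ0 with h2 | h2
      · exact (hside (Ioo (-δ) 0) isPreconnected_Ioo (Ioo_subset_Ioo_right hδ.le) (by simp)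
          σ ⟨hσ'.1, h1⟩ τ ⟨hτ'.1, h2⟩ hσm hτm).elim
      · rw [abs_of_neg h1, abs_of_pos h2, abs_of_neg (by linarith)]; ring
      · rw [abs_of_pos h1, abs_of_neg h2, abs_of_pos (by linarith)]; ring
      · exact (hside (Ioo 0 δ) isPreconnected_Ioo (Ioo_subset_Ioo_left (by linarith)) (by simp)
          σ ⟨h1, hσ'.2⟩ τ ⟨h2, hτ'.2⟩ hσm hτm).elim
  rw [← hπ]
  exact hf.upperAngle_le_angleSum hL hab ha.mem_linkFinset hb.mem_linkFinset

/-- The area bound in terms of the exterior angles and the Euler characteristic. -/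
theorem area_le {S : HyperbolicSurface E T} {A : HypAtlas M} {f : E → M} (hL : IsLengthMetric M)
    (hf : S.IsTriangulatedMap A f) {n : ℕ} {v : Fin n → E} (hv : Function.Injective v)
    (hv' : ∀ i, S.IsBoundaryVertex (v i)) {θ : Fin n → ℝ}
    (hθ : ∀ i, S.IsExteriorAngle f (v i) (θ i))
    (hint : ∀ w, S.IsInteriorVertex w → 2 * Real.pi ≤ S.angleSum w)
    (hbd : ∀ w, S.IsBoundaryVertex w → w ∉ Set.range v → Real.pi ≤ S.angleSum w) :
    S.area ≤ ∑ i, θ i - 2 * Real.pi * S.eulerChar := by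
  classical
  rw [S.area_eq_gaussBonnet]
  have h1 : ∑ w ∈ S.vertexFinset \ S.boundaryVertexFinset, (2 * Real.pi - S.angleSum w) ≤ 0 :=
    Finset.sum_nonpos fun w hw => sub_nonpos.2
      (hint w (S.isInteriorVertex_iff.2 (Finset.mem_sdiff.1 hw)))
  have hsub : Finset.univ.map ⟨v, hv⟩ ⊆ S.boundaryVertexFinset := by
    intro w hw
    obtain ⟨i, -, rfl⟩ := Finset.mem_map.1 hw
    exact S.mem_boundaryVertexFinset.2 (hv' i)
  have h2 : ∑ w ∈ S.boundaryVertexFinset, (Real.pi - S.angleSum w) ≤ ∑ i, θ i := by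
    rw [← Finset.sum_sdiff hsub, Finset.sum_map]
    have h3 : ∑ w ∈ S.boundaryVertexFinset \ Finset.univ.map ⟨v, hv⟩,
        (Real.pi - S.angleSum w) ≤ 0 := by
      refine Finset.sum_nonpos fun w hw => sub_nonpos.2 ?_
      rw [Finset.mem_sdiff, S.mem_boundaryVertexFinset] at hw
      refine hbd w hw.1 fun ⟨i, hi⟩ => hw.2 ?_
      exact Finset.mem_map.2 ⟨i, Finset.mem_univ _, hi⟩
    -- At a marked vertex the angle in M is at most the angle sum, so θ dominates π minus the angle
    -- sum.
    have h4 : ∑ i, (Real.pi - S.angleSum (v i)) ≤ ∑ i, θ i := by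
      refine Finset.sum_le_sum fun i _ => ?_
      obtain ⟨a, b, hab, ha, hb, e⟩ := hθ i
      have := hf.upperAngle_le_angleSum hL hab ha.mem_linkFinset hb.mem_linkFinset
      linarith
    have h5 : ∑ i, (Real.pi - S.angleSum ((⟨v, hv⟩ : Fin n ↪ E) i)) =
      ∑ i, (Real.pi - S.angleSum (v i)) := rfl
    linarith
  linarith

theorem IsExteriorAngle.le_pi {S : HyperbolicSurface E T} {f : E → M} {v : E} {θ : ℝ}
    (h : S.IsExteriorAngle f v θ) : θ ≤ Real.pi := by
  obtain ⟨a, b, -, -, -, rfl⟩ := h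
  linarith [upperAngle_nonneg (fun s : ℝ => f (AffineMap.lineMap v a s))
    (fun s : ℝ => f (AffineMap.lineMap v b s))]

end HyperbolicSurface

/-! ### The Euler characteristic of a disk -/

namespace TriangulatedSurface

variable {E T : Type*} [NormedAddCommGroup E] [NormedSpace ℝ E] [Fintype T]
  (S : TriangulatedSurface E T)

/-- A continuous map from a disk to the circle lifts to the real line. -/
theorem IsDisk.exists_lift {S : TriangulatedSurface E T} (h : S.IsDisk)
    {g : S.space → AddCircle (1 : ℝ)} (hg : Continuous g) :
    ∃ G : S.space → ℝ, Continuous G ∧ ∀ x, (G x : AddCircle (1 : ℝ)) = g x := by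
  obtain ⟨φ⟩ := h
  -- The radial retraction extends the map to the whole plane, to which the lifting theorem for
  -- coverings is applied.
  let r : EuclideanSpace ℝ (Fin 2) → Metric.closedBall (0 : EuclideanSpace ℝ (Fin 2)) 1 :=
    fun x => ⟨(max 1 ‖x‖)⁻¹ • x, by
      have h1 : 0 < max 1 ‖x‖ := lt_max_of_lt_left one_pos
      rw [mem_closedBall_zero_iff, norm_smul, norm_inv, Real.norm_of_nonneg h1.le,
        inv_mul_le_iff₀ h1, mul_one]
      exact le_max_right _ _⟩
  have hr : Continuous r := by
    have hc : Continuous fun x : EuclideanSpace ℝ (Fin 2) => max 1 ‖x‖ :=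
      continuous_const.max continuous_norm
    have hc' : Continuous fun x : EuclideanSpace ℝ (Fin 2) => (max 1 ‖x‖)⁻¹ • x :=
      (hc.inv₀ fun x => (lt_max_of_lt_left one_pos).ne').smul continuous_id
    exact hc'.subtype_mk _
  have hr' : ∀ y : Metric.closedBall (0 : EuclideanSpace ℝ (Fin 2)) 1, r y = y := by
    intro y
    apply Subtype.ext
    have := mem_closedBall_zero_iff.1 y.2
    simp only [r]
    rw [max_eq_left this, inv_one, one_smul]
  let F : C(EuclideanSpace ℝ (Fin 2), AddCircle (1 : ℝ)) :=
    ⟨fun x => g (φ.symm (r x)), hg.comp (φ.symm.continuous.comp hr)⟩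
  obtain ⟨e₀, he₀⟩ := QuotientAddGroup.mk_surjective (F 0)
  obtain ⟨G, ⟨-, hG⟩, -⟩ := (AddCircle.isCoveringMap_coe (1 : ℝ)).existsUnique_continuousMap_lifts
    F 0 e₀ he₀
  refine ⟨fun x => G (φ x), G.continuous.comp (continuous_subtype_val.comp φ.continuous),
    fun x => ?_⟩
  have := congrFun hG (φ x)
  simp only [Function.comp_apply] at this
  rw [this]
  change g (φ.symm (r (φ x))) = g x
  rw [hr', φ.symm_apply_apply]

theorem triVertices_mem_faces (t : T) : S.triVertices t ∈ S.faces := by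
  rw [mem_faces_iff']
  refine ⟨?_, t, subset_rfl⟩
  rw [← Finset.card_pos, S.card_triVertices]; norm_num

theorem affineIndependent_corner (t : T) : AffineIndependent ℝ (S.corner t) := by
  have h := S.indep (S.triVertices_mem_faces t)
  have hc : ∀ i, S.corner t i ∈ S.triVertices t := fun i => S.mem_triVertices.2 (mem_range_self i)
  exact h.comp_embedding ⟨fun i => ⟨S.corner t i, hc i⟩, fun i j e =>
    S.corner_injective t (Subtype.ext_iff.1 e)⟩

/-- Prescribed values at the vertices of a triangle extend to a continuous affine function. -/
theorem exists_affine_interpolation (t : T) (y : Fin 3 → ℝ) :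
    ∃ l : E →ᴬ[ℝ] ℝ, ∀ i, l (S.corner t i) = y i := by
  have hli := (affineIndependent_iff_linearIndependent_vsub ℝ _ (0 : Fin 3)).1
    (S.affineIndependent_corner t)
  set b := fun i : {x : Fin 3 // x ≠ 0} => S.corner t i -ᵥ S.corner t 0 with hb
  let W := Submodule.span ℝ (range b)
  have : FiniteDimensional ℝ W := FiniteDimensional.span_of_finite ℝ (finite_range b)
  let B := Module.Basis.span hli
  let L₀ : W →ₗ[ℝ] ℝ := B.constr ℝ fun i => y i - y 0
  -- Hahn–Banach: E is an arbitrary normed space, and the functional is prescribed only on the plane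
  -- of the triangle.
  obtain ⟨L, hL, -⟩ := exists_extension_norm_eq W (LinearMap.toContinuousLinearMap L₀)
  have key : ∀ i : Fin 3, L (S.corner t i - S.corner t 0) = y i - y 0 := by
    intro i
    by_cases hi : i = 0
    · subst hi; simp
    · have h1 := hL (B ⟨i, hi⟩)
      have h2 : ((B ⟨i, hi⟩ : W) : E) = S.corner t i - S.corner t 0 := by
        rw [Module.Basis.span_apply]; rfl
      rw [h2] at h1
      rw [h1]
      exact B.constr_basis ℝ _ _
  refine ⟨L.toContinuousAffineMap + ContinuousAffineMap.const ℝ E (y 0 - L (S.corner t 0)),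
    fun i => ?_⟩
  have := key i
  rw [map_sub] at this
  simp
  linarith

theorem cell_inter (t t' : T) : S.cell t ∩ S.cell t' =
    convexHull ℝ (S.triVertices t ∩ S.triVertices t' : Set E) := by
  rw [cell, cell, ← coe_triVertices, ← coe_triVertices]
  exact S.convexHull_inter_convexHull (S.triVertices_mem_faces t) (S.triVertices_mem_faces t')

theorem mem_space_iff_exists_cell {x : E} : x ∈ S.space ↔ ∃ t, x ∈ S.cell t := by
  rw [Geometry.SimplicialComplex.mem_space_iff]
  constructor
  · rintro ⟨s, hs, hx⟩
    obtain ⟨-, t, ht⟩ := (S.mem_faces_iff s).1 hs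
    exact ⟨t, convexHull_mono ht hx⟩
  · rintro ⟨t, ht⟩
    refine ⟨_, S.triVertices_mem_faces t, ?_⟩
    rwa [coe_triVertices]

theorem isClosed_cell (t : T) : IsClosed (S.cell t) :=
  ((finite_range (S.corner t)).isCompact_convexHull (𝕜 := ℝ)).isClosed

/-- Integral 1-cocycles on a triangulated disk are coboundaries. -/
theorem IsDisk.exists_primitive {S : TriangulatedSurface E T} (h : S.IsDisk) {z : E → E → ℤ}
    (hz : ∀ t, ∀ a ∈ S.triVertices t, ∀ b ∈ S.triVertices t, ∀ c ∈ S.triVertices t,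
      z a b + z b c = z a c) :
    ∃ w : E → ℤ, ∀ t, ∀ a ∈ S.triVertices t, ∀ b ∈ S.triVertices t, z a b = w b - w a := by
  classical
  have hcorner : ∀ t i, S.corner t i ∈ S.triVertices t := fun t i =>
    S.mem_triVertices.2 (mem_range_self i)
  -- On each triangle the cocycle has an affine primitive, normalized to vanish at corner 0.
  choose l hl using fun t => S.exists_affine_interpolation t
    fun i => (z (S.corner t 0) (S.corner t i) : ℝ)
  have hl' : ∀ t, ∀ a ∈ S.triVertices t, l t a = z (S.corner t 0) a := by
    intro t a ha
    obtain ⟨i, rfl⟩ := S.mem_triVertices.1 ha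
    exact hl t i
  have hdiff : ∀ t, ∀ a ∈ S.triVertices t, ∀ b ∈ S.triVertices t, l t b - l t a = z a b := by
    intro t a ha b hb
    rw [hl' t a ha, hl' t b hb, ← hz t _ (hcorner t 0) a ha b hb]
    push_cast
    ring
  -- Both primitives have the same increments between common vertices, so their difference is
  -- constant on the common face, and it is an integer at a vertex. Modulo 1 they glue to a map to
  -- the circle.
  have hcompat : ∀ t t' x, x ∈ S.cell t → x ∈ S.cell t' → ∃ k : ℤ, l t x - l t' x = k := by
    intro t t' x hx hx'
    have hm : x ∈ convexHull ℝ (S.triVertices t ∩ S.triVertices t' : Set E) :=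
      S.cell_inter t t' ▸ ⟨hx, hx'⟩
    obtain ⟨a, ha, ha'⟩ := (convexHull_nonempty_iff (𝕜 := ℝ)).1 ⟨x, hm⟩
    refine ⟨z (S.corner t 0) a - z (S.corner t' 0) a, ?_⟩
    have hsub : (S.triVertices t ∩ S.triVertices t' : Set E) ⊆
        (l t - l t').toAffineMap ⁻¹' {l t a - l t' a} := by
      rintro b ⟨hb, hb'⟩
      have h1 := hdiff t a ha b hb
      have h2 := hdiff t' a ha' b hb'
      have : l t b - l t' b = l t a - l t' a := by linarith
      simpa using this
    have := convexHull_min hsub ((convex_singleton _).affine_preimage _) hm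
    have h3 : l t x - l t' x = l t a - l t' a := by simpa using this
    rw [h3, hl' t a ha, hl' t' a ha']
    push_cast
    ring
  choose τ hτ using fun x : S.space => S.mem_space_iff_exists_cell.1 x.2
  let g : S.space → AddCircle (1 : ℝ) := fun x => (l (τ x) x : ℝ)
  have hg : ∀ t (x : S.space), x.1 ∈ S.cell t → g x = (l t x : ℝ) := by
    intro t x hx
    obtain ⟨k, hk⟩ := hcompat (τ x) t x (hτ x) hx
    rw [← sub_eq_zero]
    simp only [g]
    rw [← AddCircle.coe_sub, hk, AddCircle.coe_eq_zero_iff]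
    exact ⟨k, by simp⟩
  have hgc : Continuous g := by
    apply (locallyFinite_of_finite fun t : T => {x : S.space | x.1 ∈ S.cell t}).continuous
    · exact iUnion_eq_univ_iff.2 fun x => ⟨τ x, hτ x⟩
    · exact fun t => (S.isClosed_cell t).preimage continuous_subtype_val
    · intro t
      have : Continuous fun x : S.space => ((l t x : ℝ) : AddCircle (1 : ℝ)) :=
        (AddCircle.continuous_mk' 1).comp ((l t).continuous.comp continuous_subtype_val)
      exact this.continuousOn.congr fun x hx => hg t x hx
  obtain ⟨G, hGc, hG⟩ := h.exists_lift hgc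
  have hspace : ∀ t x, x ∈ S.cell t → x ∈ S.space := fun t x hx =>
    S.mem_space_iff_exists_cell.2 ⟨t, hx⟩
  let G' : E → ℝ := fun x => if hx : x ∈ S.space then G ⟨x, hx⟩ else 0
  -- On a triangle the lift and the affine primitive differ by a continuous integer-valued function
  -- on a connected set.
  have hconst : ∀ t, ∀ a ∈ S.cell t, ∀ b ∈ S.cell t, G' a - l t a = G' b - l t b := by
    intro t a ha b hb
    have hcont : ContinuousOn (fun x => G' x - l t x) (S.cell t) := by
      apply ContinuousOn.sub _ (l t).continuous.continuousOn
      have h1 : ContinuousOn G' S.space := by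
        rw [continuousOn_iff_continuous_domRestrict]
        convert hGc using 1
        funext x
        simp [G']
      exact h1.mono fun x hx => hspace t x hx
    have hmaps : MapsTo (fun x => G' x - l t x) (S.cell t) (range ((↑) : ℤ → ℝ)) := by
      intro x hx
      have h1 := hG ⟨x, hspace t x hx⟩
      rw [hg t _ hx, ← sub_eq_zero, ← AddCircle.coe_sub, AddCircle.coe_eq_zero_iff] at h1
      obtain ⟨k, hk⟩ := h1
      refine ⟨k, ?_⟩
      simp only [G', hspace t x hx, dif_pos]
      simpa using hk
    have hdisc : IsDiscrete (range ((↑) : ℤ → ℝ)) := by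
      simpa using IsDiscrete.univ.image Int.isClosedEmbedding_coe_real.isInducing
    exact (convex_convexHull ℝ _).isPreconnected.constant_of_mapsTo hdisc hcont hmaps ha hb
  have hvc : ∀ t, ∀ a ∈ S.triVertices t, a ∈ S.cell t := by
    intro t a ha
    apply subset_convexHull ℝ _
    exact S.mem_triVertices.1 ha
  -- The lift need not take integer values at vertices, but its increments along edges are integers,
  -- and the floor preserves those.
  refine ⟨fun a => ⌊G' a⌋, fun t a ha b hb => ?_⟩
  have h1 := hconst t a (hvc t a ha) b (hvc t b hb)
  have h2 := hdiff t a ha b hb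
  have h3 : G' b = G' a + (z a b : ℝ) := by linarith
  show z a b = ⌊G' b⌋ - ⌊G' a⌋
  rw [h3, Int.floor_add_intCast]
  ring

end TriangulatedSurface

/-! ### Simplicial cochains and the rank count for a disk -/

namespace TriangulatedSurface

variable {E T : Type*} [NormedAddCommGroup E] [NormedSpace ℝ E] [Fintype T]
  (S : TriangulatedSurface E T)

-- An arbitrary orientation of each edge, with no coherence between edges; it only serves to
-- identify 1-cochains with functions on edges.
open Classical in
theorem exists_edge_orientation : ∃ src tgt : S.edgeFinset → S.vertexFinset,
    ∀ e, src e ≠ tgt e ∧ (e : Finset E) = {(src e : E), (tgt e : E)} := by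
  have h : ∀ e : S.edgeFinset, ∃ p : S.vertexFinset × S.vertexFinset,
      p.1 ≠ p.2 ∧ (e : Finset E) = {(p.1 : E), (p.2 : E)} := by
    rintro ⟨e, he⟩
    obtain ⟨⟨t, ht⟩, h2⟩ := S.mem_edgeFinset.1 he
    obtain ⟨a, b, hab, rfl⟩ := Finset.card_eq_two.1 h2
    exact ⟨(⟨a, S.mem_vertexFinset.2 ⟨t, ht (by simp)⟩⟩,
      ⟨b, S.mem_vertexFinset.2 ⟨t, ht (by simp)⟩⟩), fun h => hab (Subtype.ext_iff.1 h), rfl⟩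
  choose p hp using h
  exact ⟨fun e => (p e).1, fun e => (p e).2, hp⟩

/-- The value on the oriented edge from `a` to `b` of a cochain given on the edges oriented
from `src`. -/
def orientedValue (src : S.edgeFinset → S.vertexFinset) (a b : E) :
    (S.edgeFinset → ℤ) →ₗ[ℤ] ℤ :=
  open Classical in
  if h : ({a, b} : Finset E) ∈ S.edgeFinset then
    if a = src ⟨_, h⟩ then LinearMap.proj ⟨_, h⟩ else -LinearMap.proj ⟨_, h⟩
  -- This default also covers a = b, where the pair is a singleton and not an edge.
  else 0

variable {src tgt : S.edgeFinset → S.vertexFinset}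

theorem orientedValue_self (a : E) : S.orientedValue src a a = 0 := by
  rw [orientedValue, dif_neg]
  intro h
  simpa using (S.mem_edgeFinset.1 h).2

open Classical in
theorem orientedValue_of_eq {a b : E} {e : S.edgeFinset} (he : (e : Finset E) = {a, b}) :
    S.orientedValue src a b = if a = src e then LinearMap.proj e else -LinearMap.proj e := by
  obtain ⟨e, h⟩ := e
  simp only at he
  subst he
  rw [orientedValue, dif_pos h]

open Classical in
theorem orientedValue_swap (h : ∀ e, src e ≠ tgt e ∧ (e : Finset E) = {(src e : E), (tgt e : E)})
    (a b : E) : S.orientedValue src b a = -S.orientedValue src a b := by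
  by_cases hab : ({a, b} : Finset E) ∈ S.edgeFinset
  · have hne : a ≠ b := by
      rintro rfl
      simpa using (S.mem_edgeFinset.1 hab).2
    have hs : (src ⟨_, hab⟩ : E) ∈ ({a, b} : Finset E) :=
      (Finset.ext_iff.1 (h ⟨_, hab⟩).2 _).2 (by simp)
    rw [S.orientedValue_of_eq (e := ⟨_, hab⟩) rfl,
      S.orientedValue_of_eq (e := ⟨_, hab⟩) (Finset.pair_comm a b)]
    rcases Finset.mem_insert.1 hs with hs | hs
    · rw [if_pos hs.symm, if_neg]
      rw [hs]; exact hne.symm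
    · rw [Finset.mem_singleton] at hs
      rw [if_pos hs.symm, if_neg, neg_neg]
      rw [hs]; exact hne
  · rw [orientedValue, orientedValue, dif_neg hab, dif_neg, neg_zero]
    rwa [Finset.pair_comm]

/-- The Euler characteristic of a triangulated disk is at least `1`. -/
theorem IsDisk.one_le_eulerChar {S : TriangulatedSurface E T} (hS : S.IsDisk) :
    (1 : ℤ) ≤ S.eulerChar := by
  classical
  obtain ⟨src, tgt, h⟩ := S.exists_edge_orientation
  let z := S.orientedValue src
  -- The coboundary maps from vertices to edges, and below from edges to triangles.
  let d₀ : (S.vertexFinset → ℤ) →ₗ[ℤ] (S.edgeFinset → ℤ) :=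
    LinearMap.pi fun e => LinearMap.proj (R := ℤ) (φ := fun _ => ℤ) (tgt e) -
      LinearMap.proj (R := ℤ) (φ := fun _ => ℤ) (src e)
  let d₁ : (S.edgeFinset → ℤ) →ₗ[ℤ] (T → ℤ) :=
    LinearMap.pi fun t => z (S.corner t 0) (S.corner t 1) + z (S.corner t 1) (S.corner t 2) +
      z (S.corner t 2) (S.corner t 0)
  -- Vanishing of the first integral cohomology. Together with antisymmetry, the relation around
  -- each triangle gives the cocycle identity for all triples of its vertices.
  have hexact : LinearMap.ker d₁ ≤ LinearMap.range d₀ := by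
    intro x hx
    have hx' : ∀ t, z (S.corner t 0) (S.corner t 1) x + z (S.corner t 1) (S.corner t 2) x +
        z (S.corner t 2) (S.corner t 0) x = 0 := fun t => congrFun hx t
    have hswap : ∀ a b, z b a x = -z a b x := fun a b => by
      simp only [z]; rw [S.orientedValue_swap h a b]; rfl
    have hself : ∀ a, z a a x = 0 := fun a => by
      simp only [z]; rw [S.orientedValue_self a]; rfl
    obtain ⟨w, hw⟩ := hS.exists_primitive (z := fun a b => z a b x) (by
      intro t a ha b hb c hc
      obtain ⟨i, rfl⟩ := S.mem_triVertices.1 ha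
      obtain ⟨j, rfl⟩ := S.mem_triVertices.1 hb
      obtain ⟨k, rfl⟩ := S.mem_triVertices.1 hc
      have e0 := hx' t
      have e1 := hswap (S.corner t 0) (S.corner t 1)
      have e2 := hswap (S.corner t 1) (S.corner t 2)
      have e3 := hswap (S.corner t 2) (S.corner t 0)
      fin_cases i <;> fin_cases j <;> fin_cases k <;>
        simp only [Fin.zero_eta, Fin.mk_one, Fin.reduceFinMk, hself] <;> linarith)
    refine ⟨fun v => w v, funext fun e => ?_⟩
    obtain ⟨⟨t, ht⟩, -⟩ := S.mem_edgeFinset.1 e.2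
    obtain ⟨-, he⟩ := h e
    rw [he] at ht
    have h1 := hw t (src e) (ht (by simp)) (tgt e) (ht (by simp))
    have h2 : z (src e) (tgt e) x = x e := by
      simp only [z]
      rw [S.orientedValue_of_eq he, if_pos rfl]; rfl
    change w (tgt e) - w (src e) = x e
    rw [← h2]
    exact h1.symm
  have hne : Nonempty S.vertexFinset := by
    obtain ⟨φ⟩ := hS
    obtain ⟨t, -⟩ := S.mem_space_iff_exists_cell.1 (φ.symm ⟨0, by simp⟩).2
    exact ⟨⟨S.corner t 0, S.mem_vertexFinset.2 ⟨t, S.mem_triVertices.2 (mem_range_self 0)⟩⟩⟩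
  -- Constant functions are killed by d₀, and they are nonzero because the disk has a vertex.
  have hker : 1 ≤ Module.finrank ℤ (LinearMap.ker d₀) := by
    have hmem : (fun _ => 1 : S.vertexFinset → ℤ) ∈ LinearMap.ker d₀ :=
      funext fun e => sub_self (1 : ℤ)
    have : Nontrivial (LinearMap.ker d₀) := by
      refine ⟨⟨⟨_, hmem⟩, 0, fun e => ?_⟩⟩
      have := congrFun (Subtype.ext_iff.1 e) hne.some
      exact one_ne_zero this
    exact Module.finrank_pos
  -- Rank–nullity writes χ as rank ker d₀ + (rank im d₀ - rank ker d₁) + (F - rank im d₁), where F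
  -- is the number of triangles; the first term is at least 1 and the others are nonnegative.
  have rn₀ := d₀.ker.finrank_quotient_add_finrank
  have rn₁ := d₁.ker.finrank_quotient_add_finrank
  rw [d₀.quotKerEquivRange.finrank_eq, Module.finrank_fintype_fun_eq_card,
    Fintype.card_coe] at rn₀
  rw [d₁.quotKerEquivRange.finrank_eq, Module.finrank_fintype_fun_eq_card,
    Fintype.card_coe] at rn₁
  have hr := Submodule.finrank_le (LinearMap.range d₁)
  rw [Module.finrank_fintype_fun_eq_card] at hr
  have hm := Submodule.finrank_mono hexact
  rw [S.eulerChar_eq]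
  omega

end TriangulatedSurface

end

/-! ### The area bound for hyperbolic-maps and hyperbolically-mapped polygons -/

theorem mainTheorem6 {M : Type*} [MetricSpace M] (H : GeneralHyperbolicManifold M)
    {E T : Type*} [NormedAddCommGroup E] [NormedSpace ℝ E] [Fintype T]
    (S : HyperbolicSurface E T) (f : E → M) (n : ℕ) (v : Fin n → E)
    (hv : Function.Injective v) (hv' : ∀ i, S.IsBoundaryVertex (v i))
    (θ : Fin n → ℝ) (hθ : ∀ i, S.IsExteriorAngle f (v i) (θ i))
    (hf : S.IsHyperbolicMapRel H.toHypAtlas f (Set.range v) ∨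
      S.IsHyperbolicMap H.toHypAtlas f ∧ S.HasGeodesicBoundary f (Set.range v)) :
    S.area ≤ ∑ i, θ i - 2 * Real.pi * S.eulerChar ∧
      (S.IsDisk → S.area ≤ (n - 2) * Real.pi) := by
  have hL := H.isLengthMetric
  have hmap : S.IsHyperbolicMap H.toHypAtlas f := hf.elim (fun h => h.toIsHyperbolicMap) And.left
  have hbd : ∀ w, S.IsBoundaryVertex w → w ∉ Set.range v → Real.pi ≤ S.angleSum w := by
    rcases hf with h | ⟨-, h⟩
    · exact h.boundary
    · exact fun w hw hwV => h.pi_le_angleSum hL hmap.isTriangulatedMap hw hwV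
  have key := HyperbolicSurface.area_le hL hmap.isTriangulatedMap hv hv' hθ hmap.interior hbd
  refine ⟨key, fun hdisk => key.trans ?_⟩
  have h1 : ∑ i, θ i ≤ n * Real.pi := by
    have := Finset.sum_le_sum fun i (_ : i ∈ Finset.univ) => (hθ i).le_pi
    simpa using this
  -- The Euler characteristic enters with a negative sign, so a lower bound for it is enough.
  have h2 : (1 : ℝ) ≤ S.eulerChar := by exact_mod_cast hdisk.one_le_eulerChar
  have h3 := mul_le_mul_of_nonneg_left h2 (show 0 ≤ 2 * Real.pi by positivity)
  linarith
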